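/- Let $n\ge 1$, let $\theta_t,\theta_1,\theta_0\in\mathbb C$ be nonzero, and let $\kappa_1,\dots,\kappa_{2n}\in\mathbb C$ be pairwise distinct with $n\theta_t+n\theta_1+\theta_0+\sum_{i=1}^{2n}\kappa_i=0$. (These are the exponents of a Fuchsian system $\frac{\partial Y}{\partial x}=\bigl(\frac{A_t}{x-t}+\frac{A_1}{x-1}+\frac{A_0}{x}\bigr)Y$ of rank $2n$ with spectral type $\{(n,n),(n,n),(2n-1,1),(1^{2n})\}$ at $x=t,1,0,\infty$.) **Schlesinger system and canonical variables.** The Schlesinger system is $$\frac{dA_t}{dt}=-\frac{[A_t,A_0]}{t}-\frac{[A_t,A_1]}{t-1},\qquad \frac{dA_1}{dt}=\frac{[A_t,A_1]}{t-1},\qquad \frac{dA_0}{dt}=\frac{[A_t,A_0]}{t},\qquad A_\infty=-A_t-A_1-A_0 .$$ Let $G=G_1G_2$, where $G_1$ is a constant matrix with $G_1^{-1}A_\infty G_1=\mathrm{diag}(\kappa_1,\dots,\kappa_{2n})$ and $G_2=G_2(t)$ is lower triangular with ones on the diagonal, be such that $\widetilde A_\xi=G^{-1}A_\xi G$ satisfy: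 $\widetilde A_0$ has first row $(\theta_0,a^{(0)}_2,\dots,a^{(0)}_{2n})$ and all other rows zero; $\widetilde A_\infty$ has diagonal $(\kappa_1,\dots,\kappa_{2n})$, first column $(\kappa_1,a^{(\infty)}_2,\dots,a^{(\infty)}_{2n})^{T}$ and all other entries zero; and $$\widetilde A_\xi=\begin{bmatrix}I_n\\B_\xi\end{bmatrix}\begin{bmatrix}\theta_\xi I_n-C_\xi B_\xi& C_\xi\end{bmatrix}\qquad(\xi=t,1)$$ with $n\times n$ matrices $B_\xi=[b^{(\xi)}_{i,j}]$, $C_\xi=[c^{(\xi)}_{i,j}]$. Thus $\widetilde A_t+\widetilde A_1+\widetilde A_0+\widetilde A_\infty=0$ (R). On the space of all $(B_t,C_t,B_1,C_1)$ use the Poisson bracket $\{b^{(\xi)}_{i,j},c^{(\xi)}_{j,i}\}=-1$, all other brackets of coordinates being zero, and the Hamiltonian $K=\frac{\mathrm{tr}\,\widetilde A_t\widetilde A_1}{t-1}+\frac{\mathrm{tr}\,\widetilde A_t\widetilde A_0}{t}$, where $\widetilde A_0$ is expressed by $a^{(0)}_j=-(\widetilde A_t+\widetilde A_1)_{1,j}$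 $(j\ge2)$. Let $\Delta^{i_1,\dots,i_r}_{j_1,\dots,j_r}(A)$ be the minor of $A$ with rows $i_1,\dots,i_r$ and columns $j_1,\dots,j_r$ (the empty minor is $1$). For $i=1,\dots,n$ put $$\mu_i=(-1)^{n-i}t^{-1}\frac{\Delta^{1,i+1,\dots,n}_{i,i+1,\dots,n}(C_1)}{\Delta^{i+1,\dots,n}_{i+1,\dots,n}(C_t)}\sum_{k=1}^{i}\frac{\Delta^{i,i+1,\dots,n}_{k,i+1,\dots,n}(C_t)}{\Delta^{i,\dots,n}_{i,\dots,n}(C_t)}\,b^{(t)}_{k,1},\qquad \lambda_i=(-1)^{n-i+1}t\,\frac{\Delta^{1,i+1,\dots,n}_{i,i+1,\dots,n}(C_t)}{\Delta^{1,i+1,\dots,n}_{i,i+1,\dots,n}(C_1)},$$ wherever all the denominators are nonzero; call such points nondegenerate. **Sasano system.** Define $\alpha_1=-\theta_t$, $\alpha_2=-\kappa_{n+1}$, $\alpha_{2i-1}=\theta_t+\theta_1+\kappa_i+\kappa_{n+i-1}$ and $\alpha_{2i}=-\theta_t-\theta_1-\kappa_i-\kappa_{n+i}$ $(i=2,\dots,n)$,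 $\alpha_{2n+1}=\theta_t+\theta_1+\kappa_1+\kappa_{2n}$, $\alpha_{2n+2}=-\kappa_1+\kappa_{2n}+1$, and $\alpha_0$ by $\alpha_0+\alpha_1+\sum_{j=2}^{2n}2\alpha_j+\alpha_{2n+1}+\alpha_{2n+2}=1$. Put $$\kappa_{i,s}=\alpha_1+\sum_{j=1}^{i-1}\alpha_{2j+1},\quad \kappa_{i,1}=\sum_{j=i}^{n-1}\alpha_{2j+1}+\sum_{j=i+1}^{n}2\alpha_{2j}+\alpha_{2n+1},\quad \kappa_{i,0}=\sum_{j=i}^{n-1}\alpha_{2j+1}+\alpha_{2n+2},\quad \kappa_{i,\infty}=\alpha_0+\sum_{j=1}^{i-1}2\alpha_{2j}+\sum_{j=1}^{i-1}\alpha_{2j+1}.$$ The Sasano system of type $D^{(1)}_{2n+2}$ is $$t(t-1)\frac{d\lambda_i}{dt}=\frac{\partial H}{\partial\mu_i},\qquad t(t-1)\frac{d\mu_i}{dt}=-\frac{\partial H}{\partial\lambda_i}\qquad(i=1,\dots,n),$$ $$\begin{aligned}H=\sum_{i=1}^n\Bigl\{&\lambda_i(\lambda_i-1)(\lambda_i-t)\mu_i^2-(\kappa_{i,1}-1)\lambda_i(\lambda_i-1)\mu_i-\kappa_{i,0}\lambda_i(\lambda_i-t)\mu_i-\kappa_{i,s}(\lambda_i-1)(\lambda_i-t)\mu_i+\alpha_{2i}(\alpha_{2i}+\kappa_{i,\infty})\lambda_i\Bigr\}\\&+\sum_{1\le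 i<j\le n}2\lambda_i\mu_i(\lambda_j-1)\{(\lambda_j-t)\mu_j+\alpha_{2j}\}.\end{aligned}$$ **Theorem.** 1. For $t\ne0$, at every nondegenerate point, $\{\mu_i,\lambda_j\}=\delta_{ij}$ and $\{\mu_i,\mu_j\}=\{\lambda_i,\lambda_j\}=0$ $(i,j=1,\dots,n)$. 2. For $t\neq0$ the functions $(\lambda_1,\dots,\lambda_n,\mu_1,\dots,\mu_n)$ are coordinates on the set of nondegenerate points satisfying (R) for some $a^{(0)},a^{(\infty)}$, modulo the residual gauge group of simultaneous conjugations of the $\widetilde A_\xi$ by invertible diagonal matrices: two such points have the same $(\lambda,\mu)$ if and only if they lie in the same orbit, and the values attained are exactly the $(\lambda,\mu)\in\mathbb C^{2n}$ with $\lambda_1\neq0$. 3. Let $U\subset\mathbb C\setminus\{0,1\}$ be open. If $(B_t,C_t,B_1,C_1)$ is a solution on $U$ of the Hamiltonian system $\frac{df}{dt}=\{K,f\}$ ($f$ any of the coordinates $b^{(\xi)}_{i,j},c^{(\xi)}_{i,j}$) that satisfies (R) and is nondegenerate at every $t\in U$, then $(\lambda_i,\mu_i)$ satisfies the Sasano system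 on $U$. 4. Likewise, if $(A_t,A_1,A_0)$ solves the Schlesinger system on $U$ and $B_\xi,C_\xi$ are obtained from it by a gauge transformation $G=G_1G_2$ as above and are nondegenerate at every $t\in U$, then $(\lambda_i,\mu_i)$ satisfies the Sasano system on $U$. -/

import Mathlib

open scoped BigOperators

/-- Index set of the `2n × 2n` matrices: `Sum.inl i` is row `i + 1`, `Sum.inr i` is row
`n + i + 1` (for `i = 0, …, n - 1`). -/
abbrev Idx (n : ℕ) : Type := Fin n ⊕ Fin n

/-- The number (from `1` to `2n`) of an index. -/
def Idx.num {n : ℕ} : Idx n → ℕ :=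
  Sum.elim (fun i => (i : ℕ) + 1) (fun i => n + (i : ℕ) + 1)

/-- The two singular points `x = t` and `x = 1` whose residues carry canonical variables. -/
inductive Pole : Type
  | t : Pole
  | one : Pole
  deriving DecidableEq

/-- The space of the canonical variables `(B_ξ, C_ξ)`, `ξ = t, 1`: the first component is
`ξ ↦ B_ξ`, the second one is `ξ ↦ C_ξ`. -/
abbrev PhaseSpace (n : ℕ) : Type :=
  (Pole → Matrix (Fin n) (Fin n) ℂ) × (Pole → Matrix (Fin n) (Fin n) ℂ)

noncomputable section

namespace Schlesinger

variable {n : ℕ}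

/-! ### The Schlesinger system -/

/-- `A_t, A_1, A_0` solve, on `U`,
`A_t' = -[A_t, A_0]/t - [A_t, A_1]/(t-1)`, `A_1' = [A_t, A_1]/(t-1)`, `A_0' = [A_t, A_0]/t`. -/
def IsSolution (U : Set ℂ) (At A1 A0 : ℂ → Matrix (Idx n) (Idx n) ℂ) : Prop :=
  ∀ t ∈ U, ∀ r s : Idx n,
    HasDerivAt (fun z => At z r s)
      ((-((1 / t) • (At t * A0 t - A0 t * At t))
        - (1 / (t - 1)) • (At t * A1 t - A1 t * At t)) r s) t ∧
    HasDerivAt (fun z => A1 z r s)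
      (((1 / (t - 1)) • (At t * A1 t - A1 t * At t)) r s) t ∧
    HasDerivAt (fun z => A0 z r s)
      (((1 / t) • (At t * A0 t - A0 t * At t)) r s) t

/-- Lower triangular with all diagonal entries equal to one. -/
def IsLowerUnitriangular (G : Matrix (Idx n) (Idx n) ℂ) : Prop :=
  (∀ r, G r r = 1) ∧ ∀ r s, r.num < s.num → G r s = 0

/-! ### The normalized residue matrices -/

/-- `[I_n; B] * [θ I_n - C B, C]`. -/
def residue (θ : ℂ) (B C : Matrix (Fin n) (Fin n) ℂ) : Matrix (Idx n) (Idx n) ℂ :=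
  Matrix.fromRows 1 B * Matrix.fromCols (θ • (1 : Matrix (Fin n) (Fin n) ℂ) - C * B) C

/-- First row `(θ₀, a_2, …, a_{2n})`, all the other rows zero. -/
def residueZero [NeZero n] (θ0 : ℂ) (a : Idx n → ℂ) : Matrix (Idx n) (Idx n) ℂ :=
  fun r s => if r = Sum.inl 0 then (if s = Sum.inl 0 then θ0 else a s) else 0

/-- Diagonal `(κ_1, …, κ_{2n})`, first column `(κ_1, a_2, …, a_{2n})`, all the other
entries zero. -/
def residueInfty [NeZero n] (κ : ℕ → ℂ) (a : Idx n → ℂ) : Matrix (Idx n) (Idx n) ℂ :=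
  fun r s => if r = s then κ r.num else if s = Sum.inl 0 then a r else 0

/-- `Ã_t + Ã_1` as a function of the canonical variables. -/
def residueSum (θt θ1 : ℂ) (p : PhaseSpace n) : Matrix (Idx n) (Idx n) ℂ :=
  residue θt (p.1 Pole.t) (p.2 Pole.t) + residue θ1 (p.1 Pole.one) (p.2 Pole.one)

/-- `Ã_0` as a function of the canonical variables: the off-diagonal entries of the first row
of `Ã_t + Ã_1 + Ã_0 + Ã_∞ = 0` determine `a^{(0)}`. -/
def residueZeroOf [NeZero n] (θt θ1 θ0 : ℂ) (p : PhaseSpace n) : Matrix (Idx n) (Idx n) ℂ :=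
  residueZero θ0 (fun s => -(residueSum θt θ1 p (Sum.inl 0) s))

/-- The relation `Ã_t + Ã_1 + Ã_0 + Ã_∞ = 0`, for some values of the free entries
`a^{(0)}` of `Ã_0` and `a^{(∞)}` of `Ã_∞`. -/
def ResidueRelation [NeZero n] (θt θ1 θ0 : ℂ) (κ : ℕ → ℂ) (p : PhaseSpace n) : Prop :=
  ∃ a0 aInf : Idx n → ℂ,
    residueSum θt θ1 p + residueZero θ0 a0 + residueInfty κ aInf = 0

/-- `K = tr(Ã_t Ã_1)/(t-1) + tr(Ã_t Ã_0)/t` as a function of the canonical variables. -/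
def hamiltonianK [NeZero n] (θt θ1 θ0 t : ℂ) (p : PhaseSpace n) : ℂ :=
  (residue θt (p.1 Pole.t) (p.2 Pole.t) *
      residue θ1 (p.1 Pole.one) (p.2 Pole.one)).trace / (t - 1) +
  (residue θt (p.1 Pole.t) (p.2 Pole.t) * residueZeroOf θt θ1 θ0 p).trace / t

/-! ### The Poisson bracket -/

/-- `∂F/∂b^{(ξ)}_{i,j}` -/
def partialB (F : PhaseSpace n → ℂ) (ξ : Pole) (i j : Fin n) (p : PhaseSpace n) : ℂ :=
  lineDeriv ℂ F p (Pi.single ξ (Matrix.single i j 1), 0)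

/-- `∂F/∂c^{(ξ)}_{i,j}` -/
def partialC (F : PhaseSpace n → ℂ) (ξ : Pole) (i j : Fin n) (p : PhaseSpace n) : ℂ :=
  lineDeriv ℂ F p (0, Pi.single ξ (Matrix.single i j 1))

/-- The Poisson bracket with `{b^{(ξ)}_{i,j}, c^{(ξ)}_{j,i}} = -1`, all the other brackets of
the coordinates `b`, `c` being zero. -/
def bracket (F G : PhaseSpace n → ℂ) (p : PhaseSpace n) : ℂ :=
  ∑ i : Fin n, ∑ j : Fin n,
    ((partialC F Pole.t j i p * partialB G Pole.t i j p
        - partialB F Pole.t i j p * partialC G Pole.t j i p) +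
     (partialC F Pole.one j i p * partialB G Pole.one i j p
        - partialB F Pole.one i j p * partialC G Pole.one j i p))

/-- On `U` the canonical variables evolve by `∂f/∂t = {K, f}`, `f = b^{(ξ)}_{i,j}, c^{(ξ)}_{i,j}`. -/
def IsHamiltonianSolution [NeZero n] (θt θ1 θ0 : ℂ) (U : Set ℂ) (X : ℂ → PhaseSpace n) : Prop :=
  ∀ t ∈ U, ∀ (ξ : Pole) (i j : Fin n),
    HasDerivAt (fun z => (X z).1 ξ i j)
      (bracket (hamiltonianK θt θ1 θ0 t) (fun p => p.1 ξ i j) (X t)) t ∧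
    HasDerivAt (fun z => (X z).2 ξ i j)
      (bracket (hamiltonianK θt θ1 θ0 t) (fun p => p.2 ξ i j) (X t)) t

/-! ### The coordinates `λ_i`, `μ_i`

Here `i : Fin n` stands for the index `i + 1` among `1, …, n`. -/

/-- The sequence of indices `(k, i+1, …, n)` (as many terms as `i, i+1, …, n`). -/
def headTail (k i : Fin n) : Fin (n - i) → Fin n :=
  fun a => if h : (a : ℕ) = 0 then k else ⟨i + a, by omega⟩

/-- The sequence of indices `(i+1, …, n)`. -/
def tail (i : Fin n) : Fin (n - (i + 1)) → Fin n :=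
  fun a => ⟨i + 1 + a, by omega⟩

/-- The minor `Δ^{k,i+1,…,n}_{l,i+1,…,n}(A)`. -/
def headMinor (A : Matrix (Fin n) (Fin n) ℂ) (i k l : Fin n) : ℂ :=
  (A.submatrix (headTail k i) (headTail l i)).det

/-- The minor `Δ^{i+1,…,n}_{i+1,…,n}(A)`, equal to one for the last index. -/
def tailMinor (A : Matrix (Fin n) (Fin n) ℂ) (i : Fin n) : ℂ :=
  (A.submatrix (tail i) (tail i)).det

/-- `λ_i = (-1)^{n-i+1} t Δ^{1,i+1,…,n}_{i,i+1,…,n}(C_t) / Δ^{1,i+1,…,n}_{i,i+1,…,n}(C_1)`. -/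
def lam [NeZero n] (t : ℂ) (i : Fin n) (p : PhaseSpace n) : ℂ :=
  (-1) ^ (n - (i + 1 : ℕ) + 1) * t *
    (headMinor (p.2 Pole.t) i 0 i / headMinor (p.2 Pole.one) i 0 i)

/-- `μ_i = (-1)^{n-i} t⁻¹ Δ^{1,i+1,…,n}_{i,i+1,…,n}(C_1) / Δ^{i+1,…,n}_{i+1,…,n}(C_t) *
∑_{k ≤ i} Δ^{i,i+1,…,n}_{k,i+1,…,n}(C_t) / Δ^{i,…,n}_{i,…,n}(C_t) * b^{(t)}_{k,1}`. -/
def mu [NeZero n] (t : ℂ) (i : Fin n) (p : PhaseSpace n) : ℂ :=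
  (-1) ^ (n - (i + 1 : ℕ)) * t⁻¹ *
    (headMinor (p.2 Pole.one) i 0 i / tailMinor (p.2 Pole.t) i) *
    ∑ k ∈ Finset.Iic i,
      headMinor (p.2 Pole.t) i i k / headMinor (p.2 Pole.t) i i i * p.1 Pole.t k 0

/-- All the denominators occurring in `λ_i`, `μ_i` are nonzero. -/
def Nondegenerate [NeZero n] (p : PhaseSpace n) : Prop :=
  ∀ i : Fin n, headMinor (p.2 Pole.one) i 0 i ≠ 0 ∧ headMinor (p.2 Pole.t) i i i ≠ 0 ∧
    tailMinor (p.2 Pole.t) i ≠ 0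

/-- The residual gauge freedom: simultaneous conjugation `Ã_ξ ↦ D⁻¹ Ã_ξ D` by an invertible
diagonal matrix `D = diag(d)`, written in the variables `B_ξ`, `C_ξ`. -/
def torusAct (d : Idx n → ℂˣ) (p : PhaseSpace n) : PhaseSpace n :=
  (fun ξ i j => ((d (Sum.inr i))⁻¹ : ℂˣ) * p.1 ξ i j * d (Sum.inl j),
   fun ξ i j => ((d (Sum.inl i))⁻¹ : ℂˣ) * p.2 ξ i j * d (Sum.inr j))

end Schlesinger

namespace Sasano

/-! ### The Sasano system of type `D^{(1)}_{2n+2}` -/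

/-- `κ_{i,s}` -/
def kappaS (α : ℕ → ℂ) (i : ℕ) : ℂ := α 1 + ∑ j ∈ Finset.Ico 1 i, α (2 * j + 1)

/-- `κ_{i,1}` -/
def kappaOne (n : ℕ) (α : ℕ → ℂ) (i : ℕ) : ℂ :=
  ∑ j ∈ Finset.Ico i n, α (2 * j + 1) + ∑ j ∈ Finset.Icc (i + 1) n, 2 * α (2 * j) + α (2 * n + 1)

/-- `κ_{i,0}` -/
def kappaZero (n : ℕ) (α : ℕ → ℂ) (i : ℕ) : ℂ :=
  ∑ j ∈ Finset.Ico i n, α (2 * j + 1) + α (2 * n + 2)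

/-- `κ_{i,∞}` -/
def kappaInf (α : ℕ → ℂ) (i : ℕ) : ℂ :=
  α 0 + ∑ j ∈ Finset.Ico 1 i, 2 * α (2 * j) + ∑ j ∈ Finset.Ico 1 i, α (2 * j + 1)

/-- The Hamiltonian `H_VI[q, p; k_s, k_1, k_0, k_∞; s]` of the sixth Painlevé equation, with
the additional parameter `a` (which is `α_{2i}` in the `i`-th summand below). -/
def hVI (a q p ks k1 k0 kInf s : ℂ) : ℂ :=
  q * (q - 1) * (q - s) * p ^ 2 - (ks - 1) * q * (q - 1) * p - k1 * q * (q - s) * p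
    - k0 * (q - 1) * (q - s) * p + a * (a + kInf) * q

/-- The Hamiltonian `H` of the Sasano system in the variables `t, λ_i, μ_i`
(`l i = λ_{i+1}`, `m i = μ_{i+1}`). -/
def hamiltonian {n : ℕ} (α : ℕ → ℂ) (t : ℂ) (l m : Fin n → ℂ) : ℂ :=
  ∑ i : Fin n, hVI (α (2 * (i + 1))) (l i) (m i) (kappaOne n α (i + 1)) (kappaZero n α (i + 1))
      (kappaS α (i + 1)) (kappaInf α (i + 1)) t
  + ∑ i : Fin n, ∑ j ∈ Finset.Ioi i,
      2 * l i * m i * (l j - 1) * ((l j - t) * m j + α (2 * (j + 1)))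

/-- `t(t-1) dλ_i/dt = ∂H/∂μ_i`, `t(t-1) dμ_i/dt = -∂H/∂λ_i` for all `i`, on `U`. -/
def IsSolution {n : ℕ} (α : ℕ → ℂ) (U : Set ℂ) (l m : ℂ → Fin n → ℂ) : Prop :=
  ∀ t ∈ U, ∀ i : Fin n,
    DifferentiableAt ℂ (fun z => l z i) t ∧ DifferentiableAt ℂ (fun z => m z i) t ∧
    t * (t - 1) * deriv (fun z => l z i) t =
      deriv (fun y => hamiltonian α t (l t) (Function.update (m t) i y)) (m t i) ∧
    t * (t - 1) * deriv (fun z => m z i) t =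
      -deriv (fun y => hamiltonian α t (Function.update (l t) i y) (m t)) (l t i)

/-- The identification of the parameters `α_0, …, α_{2n+2}` with the exponents, together with
the normalization `α_0 + α_1 + 2(α_2 + ⋯ + α_{2n}) + α_{2n+1} + α_{2n+2} = 1`, which
determines `α_0`. -/
structure ParameterIdentification (n : ℕ) (θt θ1 : ℂ) (κ α : ℕ → ℂ) : Prop where
  alpha_one : α 1 = -θt
  alpha_two : α 2 = -κ (n + 1)
  alpha_odd : ∀ i ∈ Finset.Icc 2 n, α (2 * i - 1) = θt + θ1 + κ i + κ (n + i - 1)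
  alpha_even : ∀ i ∈ Finset.Icc 2 n, α (2 * i) = -θt - θ1 - κ i - κ (n + i)
  alpha_penultimate : α (2 * n + 1) = θt + θ1 + κ 1 + κ (2 * n)
  alpha_last : α (2 * n + 2) = -κ 1 + κ (2 * n) + 1
  normalization : α 0 + α 1 + ∑ j ∈ Finset.Icc 2 (2 * n), 2 * α j
    + α (2 * n + 1) + α (2 * n + 2) = 1

end Sasano

end

/-! The relation (R) fixes a moment map, so `λ`, `μ` are coordinates on a symplectic quotient.
Solutions of (R) form the torus fibre: off the first row and column, `Ã_t + Ã_1` is the diagonal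
matrix `-κ`. It is enlarged to the Borel fibre, where that matrix need only be triangular with
diagonal `-κ` for the index order 1, 2n, 2n-1, …, n+1, 2, …, n. Gauge matrices `[[P, 0], [S, Q]]`
that are triangular in this order and decouple the first index act on it. As the `κ_i` are distinct,
a triangular matrix with diagonal `-κ` is diagonalized by a triangular one, unique up to a diagonal
factor. So Borel orbits in the Borel fibre correspond to torus orbits in the torus fibre
(`InBorelFiber.exists_inTorusFiber`, `BorelEquiv.exists_torusAct`).

The minors in `λ`, `μ` are relative invariants of the Borel group whose characters cancel
(`IsGauge.lam_eq`, `IsGauge.mu_eq`), and `K` is invariant too (`IsGauge.hamiltonianK_eq`). Gaussian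
elimination brings a nondegenerate point of the Borel fibre to a normal form: below the first row
`C_t` and `C_1` are the identity and its negative, the first row of `C_1` is all ones, and `B_t` has
only a first column `b`. If `u` is the first row of `C_t`, then `λ_i = -t u_i`, `μ_i = b_i / t`, and
the fibre equations determine `B_1` (`borelEquiv_coordPoint`). Hence `λ`, `μ` are coordinates, and a
computation on this slice gives `t(t-1)K + (t-1) ∑ λ_i μ_i = H + c(t)` on all nondegenerate points
of the Borel fibre (`exists_hamiltonianK_eq`).

The canonical relations are a direct calculation: `λ` does not involve `B`, while `μ` involves only
the first column of `B_t` and is independent of the first row of `C_t`. What is left is a duality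
between two systems of minors (`colMinor_transpose_ratio`).

For the flow, Noether's principle makes the Hamiltonian vector fields of `λ_j`, `μ_j` tangent to the
Borel fibre; even straight lines in these directions stay in it
(`BorelInvariantAt.inBorelFiber_add_smul_hamVec`). The formula for `K` can thus be differentiated
along them, and the canonical relations turn `{K, λ_j}`, `{K, μ_j}` into partial derivatives of `H`.
The term `(t-1) ∑ λ_i μ_i` accounts for the explicit factors `t`, `t⁻¹` in `λ`, `μ`.

For the Schlesinger system, `G₂` differs from the identity only in its first column, and `A_0`, of
rank one, determines its derivative. The transformed residues obey `Ã_ξ' = [Z_ξ, Ã_ξ]` with `Z_ξ`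
the gradient of `K`, and in the variables `B`, `C` this is the Hamiltonian flow of `K`
(`trace_residueDeriv_mul`). -/

instance : Fintype Pole := ⟨{Pole.t, Pole.one}, fun x => by cases x <;> simp⟩

theorem Pole.sum_univ {M : Type*} [AddCommMonoid M] (f : Pole → M) :
    ∑ ξ, f ξ = f Pole.t + f Pole.one :=
  Finset.sum_pair (by simp)

section

attribute [local instance] Matrix.normedAddCommGroup Matrix.normedSpace

namespace Schlesinger

variable {n : ℕ}

/-! ### Differential calculus on the phase space -/

theorem PhaseSpace.eq_sum_single (w : PhaseSpace n) :
    w = ∑ ξ, ∑ i, ∑ j,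
      (w.1 ξ i j • ((Pi.single ξ (Matrix.single i j (1 : ℂ)), 0) : PhaseSpace n)
        + w.2 ξ i j • ((0, Pi.single ξ (Matrix.single i j (1 : ℂ))) : PhaseSpace n)) := by
  have key : ∀ (u : Pole → Matrix (Fin n) (Fin n) ℂ),
      (∑ ξ, ∑ i, ∑ j, u ξ i j • (Pi.single ξ (Matrix.single i j (1 : ℂ)) :
        Pole → Matrix (Fin n) (Fin n) ℂ)) = u := by
    intro u
    funext ξ
    ext a b
    simp only [Finset.sum_apply, Matrix.sum_apply, Pi.smul_apply, Matrix.smul_apply, smul_eq_mul]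
    rw [Finset.sum_eq_single ξ (fun ξ' _ h => ?_) (by simp)]
    · simp [Matrix.single_apply, ite_and]
    · simp [Pi.single_eq_of_ne (Ne.symm h)]
  refine Prod.ext ?_ ?_
  · simp only [Prod.fst_sum, Prod.fst_add, Prod.smul_fst, smul_zero, add_zero]
    exact (key w.1).symm
  · simp only [Prod.snd_sum, Prod.snd_add, Prod.smul_snd, smul_zero, zero_add]
    exact (key w.2).symm

/-- The bracket is defined by line derivatives, which need no norm on the phase space. The local
matrix norm only serves to pass to Fréchet derivatives and the chain rule. -/
theorem partialB_eq_fderiv {F : PhaseSpace n → ℂ} {p : PhaseSpace n}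
    (h : DifferentiableAt ℂ F p) (ξ : Pole) (i j : Fin n) :
    partialB F ξ i j p = fderiv ℂ F p (Pi.single ξ (Matrix.single i j 1), 0) :=
  h.lineDeriv_eq_fderiv

theorem partialC_eq_fderiv {F : PhaseSpace n → ℂ} {p : PhaseSpace n}
    (h : DifferentiableAt ℂ F p) (ξ : Pole) (i j : Fin n) :
    partialC F ξ i j p = fderiv ℂ F p (0, Pi.single ξ (Matrix.single i j 1)) :=
  h.lineDeriv_eq_fderiv

theorem fderiv_eq_sum {F : PhaseSpace n → ℂ} {p : PhaseSpace n}
    (h : DifferentiableAt ℂ F p) (w : PhaseSpace n) :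
    fderiv ℂ F p w = ∑ ξ, ∑ i, ∑ j,
      (w.1 ξ i j * partialB F ξ i j p + w.2 ξ i j * partialC F ξ i j p) := by
  conv_lhs => rw [PhaseSpace.eq_sum_single w]
  simp only [map_sum, map_add, map_smul, smul_eq_mul, partialB_eq_fderiv h, partialC_eq_fderiv h]

/-- The Hamiltonian vector field of `F`. -/
noncomputable def hamVec (F : PhaseSpace n → ℂ) (p : PhaseSpace n) : PhaseSpace n :=
  (fun ξ i j => partialC F ξ j i p, fun ξ i j => -partialB F ξ j i p)

theorem bracket_eq_fderiv (F : PhaseSpace n → ℂ) {G : PhaseSpace n → ℂ} {p : PhaseSpace n}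
    (hG : DifferentiableAt ℂ G p) :
    bracket F G p = fderiv ℂ G p (hamVec F p) := by
  rw [fderiv_eq_sum hG, Pole.sum_univ, bracket]
  simp only [hamVec, Finset.sum_add_distrib, Finset.sum_sub_distrib, neg_mul, Finset.sum_neg_distrib]
  rw [Finset.sum_comm (f := fun i j => partialB F Pole.t j i p * partialC G Pole.t i j p),
    Finset.sum_comm (f := fun i j => partialB F Pole.one j i p * partialC G Pole.one i j p)]
  ring

theorem bracket_antisymm (F G : PhaseSpace n → ℂ) (p : PhaseSpace n) :
    bracket F G p = -bracket G F p := by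
  simp only [bracket, ← Finset.sum_neg_distrib]
  refine Finset.sum_congr rfl fun i _ => Finset.sum_congr rfl fun j _ => ?_
  ring

theorem differentiable_minor (ξ : Pole) {k : ℕ} (f g : Fin k → Fin n) :
    Differentiable ℂ (fun p : PhaseSpace n => ((p.2 ξ).submatrix f g).det) := by
  simp only [Matrix.det_apply, Matrix.submatrix_apply]
  fun_prop

theorem differentiable_headMinor (ξ : Pole) (i k l : Fin n) :
    Differentiable ℂ (fun p : PhaseSpace n => headMinor (p.2 ξ) i k l) :=
  differentiable_minor ξ _ _

theorem differentiable_tailMinor (ξ : Pole) (i : Fin n) :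
    Differentiable ℂ (fun p : PhaseSpace n => tailMinor (p.2 ξ) i) :=
  differentiable_minor ξ _ _

theorem differentiableAt_div {f g : PhaseSpace n → ℂ} {p : PhaseSpace n}
    (hf : Differentiable ℂ f) (hg : Differentiable ℂ g) (h : g p ≠ 0) :
    DifferentiableAt ℂ (fun q => f q / g q) p := by
  simp only [div_eq_mul_inv]
  exact (hf p).mul ((hg p).inv h)

theorem Nondegenerate.differentiableAt_lam [NeZero n] {p : PhaseSpace n} (hp : Nondegenerate p)
    (t : ℂ) (i : Fin n) : DifferentiableAt ℂ (lam t i) p :=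
  (differentiableAt_div (differentiable_headMinor Pole.t i 0 i)
    (differentiable_headMinor Pole.one i 0 i) (hp i).1).const_mul _

theorem Nondegenerate.differentiableAt_mu [NeZero n] {p : PhaseSpace n} (hp : Nondegenerate p)
    (t : ℂ) (i : Fin n) : DifferentiableAt ℂ (mu t i) p := by
  refine ((differentiableAt_div (differentiable_headMinor Pole.one i 0 i)
    (differentiable_tailMinor Pole.t i) (hp i).2.2).const_mul _).mul ?_
  refine DifferentiableAt.fun_sum fun k _ => ?_
  refine (differentiableAt_div (differentiable_headMinor Pole.t i i k)
    (differentiable_headMinor Pole.t i i i) (hp i).2.1).mul ?_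
  fun_prop

theorem eventually_nondegenerate [NeZero n] {p : PhaseSpace n} (hp : Nondegenerate p) :
    ∀ᶠ q in nhds p, Nondegenerate q := by
  unfold Nondegenerate
  rw [Filter.eventually_all]
  intro i
  refine ((differentiable_headMinor Pole.one i 0 i).continuous.continuousAt.eventually_ne
    (hp i).1).and (((differentiable_headMinor Pole.t i i i).continuous.continuousAt.eventually_ne
    (hp i).2.1).and ((differentiable_tailMinor Pole.t i).continuous.continuousAt.eventually_ne
    (hp i).2.2))

theorem differentiable_residue_apply (ξ : Pole) (θ : ℂ) (r s : Idx n) :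
    Differentiable ℂ (fun p : PhaseSpace n => residue θ (p.1 ξ) (p.2 ξ) r s) := by
  unfold residue
  rw [show (fun p : PhaseSpace n => (Matrix.fromRows 1 (p.1 ξ) *
    Matrix.fromCols (θ • (1 : Matrix (Fin n) (Fin n) ℂ) - p.2 ξ * p.1 ξ) (p.2 ξ)) r s) = _ from
    funext fun p => Matrix.mul_apply]
  rcases r with r | r <;> rcases s with s | s <;>
    simp only [Matrix.fromRows_apply_inl, Matrix.fromRows_apply_inr, Matrix.fromCols_apply_inl,
      Matrix.fromCols_apply_inr, Matrix.sub_apply, Matrix.mul_apply] <;> fun_prop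

theorem differentiable_residueZeroOf_apply [NeZero n] (θt θ1 θ0 : ℂ) (r s : Idx n) :
    Differentiable ℂ (fun p : PhaseSpace n => residueZeroOf θt θ1 θ0 p r s) := by
  unfold residueZeroOf residueZero residueSum
  split_ifs
  · fun_prop
  · exact ((differentiable_residue_apply _ _ _ _).add (differentiable_residue_apply _ _ _ _)).neg
  · fun_prop

theorem differentiable_hamiltonianK [NeZero n] (θt θ1 θ0 t : ℂ) :
    Differentiable ℂ (hamiltonianK (n := n) θt θ1 θ0 t) := by
  unfold hamiltonianK
  simp only [Matrix.trace, Matrix.diag, Matrix.mul_apply, div_eq_mul_inv]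
  refine ((Differentiable.fun_sum fun r _ => Differentiable.fun_sum fun s _ => ?_).mul_const _).add
    ((Differentiable.fun_sum fun r _ => Differentiable.fun_sum fun s _ => ?_).mul_const _)
  · exact (differentiable_residue_apply _ _ _ _).mul (differentiable_residue_apply _ _ _ _)
  · exact (differentiable_residue_apply _ _ _ _).mul (differentiable_residueZeroOf_apply _ _ _ _ _)

end Schlesinger

end

namespace Schlesinger

variable {n : ℕ}

/-! ### Minors along a chain of trailing index sets -/

/-- Laplace expansion. The size enters through an equation because `n - i` and `n - (i + 1) + 1` are
equal but not definitionally so. -/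
theorem det_of_first_row {m k : ℕ} (h : m = k + 1) (M : Matrix (Fin m) (Fin m) ℂ)
    (h0 : ∀ c : Fin m, (c : ℕ) ≠ 0 → M ⟨0, by omega⟩ c = 0) :
    M.det = M ⟨0, by omega⟩ ⟨0, by omega⟩ *
      (M.submatrix (fun a : Fin k => (⟨a + 1, by omega⟩ : Fin m))
        (fun a : Fin k => (⟨a + 1, by omega⟩ : Fin m))).det := by
  subst h
  rw [Matrix.det_succ_row_zero, Finset.sum_eq_single 0]
  · simp only [Fin.val_zero, pow_zero, one_mul, Fin.succAbove_zero]
    rfl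
  · intro c _ hc
    have := h0 c (fun h => hc (Fin.ext h))
    rw [show (0 : Fin (k + 1)) = ⟨0, by omega⟩ from rfl, this]
    simp
  · simp

theorem headTail_zero (k i : Fin n) : headTail k i ⟨0, by omega⟩ = k := by
  simp [headTail]

theorem headTail_of_ne_zero (k i : Fin n) {a : Fin (n - i)} (ha : (a : ℕ) ≠ 0) :
    headTail k i a = ⟨i + a, by omega⟩ := by
  simp [headTail, ha]

theorem headTail_self (i : Fin n) (a : Fin (n - i)) : headTail i i a = ⟨i + a, by omega⟩ := by
  unfold headTail
  split_ifs with h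
  · ext; simp [h]
  · rfl

theorem headTail_succ (k i : Fin n) (a : Fin (n - (i + 1))) :
    headTail k i ⟨a + 1, by omega⟩ = tail i a := by
  rw [headTail_of_ne_zero _ _ (by simp)]
  ext
  simp [tail]
  omega

theorem headTail_self_injective (i : Fin n) : Function.Injective (headTail i i) := by
  intro a b h
  rw [headTail_self, headTail_self, Fin.mk.injEq] at h
  ext
  omega

theorem headTail_zero_strictMono [NeZero n] (i : Fin n) : StrictMono (headTail 0 i) := by
  intro a b h
  have hb : (b : ℕ) ≠ 0 := by have := Fin.lt_def.mp h; omega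
  rw [headTail_of_ne_zero _ _ hb]
  by_cases ha : (a : ℕ) = 0
  · have : headTail 0 i a = 0 := by simp [headTail, ha]
    rw [this, Fin.lt_def, Fin.val_zero]
    simp only
    omega
  · rw [headTail_of_ne_zero _ _ ha, Fin.lt_def]
    simpa using h

theorem headTail_self_strictMono (i : Fin n) : StrictMono (headTail i i) := by
  intro a b h
  rw [headTail_self, headTail_self, Fin.lt_def]
  simpa using h

theorem tail_strictMono (i : Fin n) : StrictMono (tail i) := by
  intro a b h
  rw [Fin.lt_def]
  simpa [tail] using h

/-- The minor of `A` with rows `i, …, n` and columns `v, i+1, …, n`, linear in the vector `v`. -/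
noncomputable def colMinor (A : Matrix (Fin n) (Fin n) ℂ) (i : Fin n) : (Fin n → ℂ) →ₗ[ℂ] ℂ :=
  -- Cramer's map is the determinant as a function of one replaced column, so linearity in `v` comes
  -- for free.
  LinearMap.proj ⟨0, by omega⟩ ∘ₗ (A.submatrix (headTail i i) (headTail i i)).cramer ∘ₗ
    LinearMap.funLeft ℂ ℂ (headTail i i)

theorem colMinor_apply (A : Matrix (Fin n) (Fin n) ℂ) (i : Fin n) (v : Fin n → ℂ) :
    colMinor A i v = ((A.submatrix (headTail i i) (headTail i i)).updateCol ⟨0, by omega⟩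
      (fun a => v (headTail i i a))).det := rfl

/-- Column `i` of `A` is overwritten by `v`, so only the columns beyond `i` matter. -/
theorem colMinor_congr {A A' : Matrix (Fin n) (Fin n) ℂ} {i : Fin n}
    (h : ∀ r c, i ≤ r → i < c → A r c = A' r c) : colMinor A i = colMinor A' i := by
  refine LinearMap.ext fun v => ?_
  rw [colMinor_apply, colMinor_apply]
  congr 1
  ext a c
  by_cases hc : c = ⟨0, by omega⟩
  · simp [hc]
  · have hc' : (c : ℕ) ≠ 0 := fun h => hc (Fin.ext h)
    simp only [Matrix.updateCol_ne hc, Matrix.submatrix_apply, headTail_self]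
    refine h _ _ (Fin.le_def.mpr (by simp)) (Fin.lt_def.mpr ?_)
    simp only
    omega

theorem colMinor_col (A : Matrix (Fin n) (Fin n) ℂ) (i k : Fin n) :
    colMinor A i (fun r => A r k) = headMinor A i i k := by
  rw [colMinor_apply, headMinor]
  congr 1
  ext a c
  by_cases hc : c = ⟨0, by omega⟩
  · simp [hc, headTail_zero]
  · have hc' : (c : ℕ) ≠ 0 := fun h => hc (Fin.ext h)
    rw [Matrix.updateCol_ne hc, Matrix.submatrix_apply, Matrix.submatrix_apply,
      headTail_of_ne_zero k i hc', headTail_self i c]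

theorem headMinor_transpose (A : Matrix (Fin n) (Fin n) ℂ) (i k l : Fin n) :
    headMinor A.transpose i k l = headMinor A i l k := by
  rw [headMinor, headMinor, ← Matrix.det_transpose]
  rfl

theorem tailMinor_transpose (A : Matrix (Fin n) (Fin n) ℂ) (i : Fin n) :
    tailMinor A.transpose i = tailMinor A i := by
  rw [tailMinor, tailMinor, ← Matrix.det_transpose]
  rfl

/-- Column `k` already occurs among the columns after `i`, so it occurs twice. -/
theorem headMinor_eq_zero_of_lt (A : Matrix (Fin n) (Fin n) ℂ) {i k : Fin n} (h : i < k) :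
    headMinor A i i k = 0 := by
  have hlt := Fin.lt_def.mp h
  refine Matrix.det_zero_of_column_eq (i := ⟨0, by omega⟩) (j := ⟨k - i, by omega⟩) ?_ ?_
  · simp only [ne_eq, Fin.mk.injEq]
    omega
  · intro a
    rw [Matrix.submatrix_apply, Matrix.submatrix_apply, headTail_zero,
      headTail_of_ne_zero k i (by simp only; omega)]
    congr 1
    ext
    simp only
    omega

theorem colMinor_eq_zero (A : Matrix (Fin n) (Fin n) ℂ) {i : Fin n} {v : Fin n → ℂ}
    (h : ∀ r, i ≤ r → v r = 0) : colMinor A i v = 0 := by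
  rw [colMinor_apply]
  refine Matrix.det_eq_zero_of_column_eq_zero ⟨0, by omega⟩ fun a => ?_
  rw [Matrix.updateCol_self, headTail_self]
  exact h _ (Fin.le_def.mpr (by simp))

theorem colMinor_of_zero_above (A : Matrix (Fin n) (Fin n) ℂ) {i : Fin n} {v : Fin n → ℂ}
    (h : ∀ r, i < r → v r = 0) : colMinor A i v = v i * tailMinor A i := by
  rw [colMinor_apply, ← Matrix.det_transpose,
    det_of_first_row (k := n - (i + 1)) (by omega)]
  · rw [Matrix.transpose_apply, Matrix.updateCol_self, headTail_zero, tailMinor,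
      ← Matrix.det_transpose (A.submatrix _ _)]
    congr 2
    ext a b
    simp only [Matrix.submatrix_apply, Matrix.transpose_apply]
    rw [Matrix.updateCol_ne (by simp), Matrix.submatrix_apply, headTail_succ, headTail_succ]
  · intro c hc
    rw [Matrix.transpose_apply, Matrix.updateCol_self, headTail_self]
    exact h _ (Fin.lt_def.mpr (by simp only; omega))

theorem colMinor_eq_sum (A : Matrix (Fin n) (Fin n) ℂ) (i : Fin n) (v : Fin n → ℂ) :
    colMinor A i v = ∑ r, v r * colMinor A i (Pi.single r 1) := by
  conv_lhs => rw [pi_eq_sum_univ' v]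
  simp only [map_sum, map_smul, smul_eq_mul]

theorem colMinor_mulVec (A : Matrix (Fin n) (Fin n) ℂ) (i : Fin n) (b : Fin n → ℂ) :
    colMinor A i (A.mulVec b) = ∑ k, headMinor A i i k * b k := by
  have : A.mulVec b = ∑ k, b k • (fun r => A r k) := by
    ext r
    simp [Matrix.mulVec, dotProduct, mul_comm]
  rw [this, map_sum]
  refine Finset.sum_congr rfl fun k _ => ?_
  rw [map_smul, colMinor_col, smul_eq_mul, mul_comm]

/-- The terms with `k > i` vanish, so the sum in `μ_i` is a single minor with a column replaced by
`A b`. This form shows how it transforms under gauge. -/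
theorem sum_Iic_headMinor (A : Matrix (Fin n) (Fin n) ℂ) (i : Fin n) (b : Fin n → ℂ) :
    ∑ k ∈ Finset.Iic i, headMinor A i i k / headMinor A i i i * b k
      = colMinor A i (A.mulVec b) / headMinor A i i i := by
  rw [colMinor_mulVec, Finset.sum_div, ← Finset.sum_subset (Finset.subset_univ (Finset.Iic i))]
  · refine Finset.sum_congr rfl fun k _ => ?_
    ring
  · intro k _ hk
    rw [headMinor_eq_zero_of_lt A (by simpa using hk)]
    simp

theorem mu_eq [NeZero n] (t : ℂ) (i : Fin n) (p : PhaseSpace n) :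
    mu t i p = (-1) ^ (n - (i + 1 : ℕ)) * t⁻¹ *
    (headMinor (p.2 Pole.one) i 0 i / tailMinor (p.2 Pole.t) i) *
    (colMinor (p.2 Pole.t) i ((p.2 Pole.t).mulVec fun k => p.1 Pole.t k 0) /
      headMinor (p.2 Pole.t) i i i) := by
  rw [← sum_Iic_headMinor, mu]

/-- The minors of `A` with rows `v, j+1, …, n` and columns `j, …, n`, evaluated on the row vector
of ratios of minors `Δ^{i,…,n}_{k,i+1,…,n}(A) / Δ^{i,…,n}_{i,…,n}(A)`. -/
theorem colMinor_transpose_ratio (A : Matrix (Fin n) (Fin n) ℂ) (i j : Fin n)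
    (hi : headMinor A i i i ≠ 0) :
    colMinor A.transpose j (fun k => headMinor A i i k / headMinor A i i i)
      = if i = j then tailMinor A i else 0 := by
  rcases lt_trichotomy i j with h | h | h
  · rw [if_neg h.ne]
    refine colMinor_eq_zero _ fun r hr => ?_
    rw [headMinor_eq_zero_of_lt A (h.trans_le hr), zero_div]
  · subst h
    rw [if_pos rfl, colMinor_of_zero_above, div_self hi, one_mul, tailMinor_transpose]
    intro r hr
    rw [headMinor_eq_zero_of_lt A hr, zero_div]
  · rw [if_neg h.ne']
    -- For `j < i` the vector of ratios is a combination of rows of `A`. Rows `r < i` have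
    -- coefficient zero, and a row `r ≥ i > j` repeats a row of the minor.
    have : (fun k => headMinor A i i k / headMinor A i i i)
        = ∑ r, (colMinor A i (Pi.single r 1) / headMinor A i i i) • A r := by
      ext k
      rw [← colMinor_col, colMinor_eq_sum, Finset.sum_div, Finset.sum_apply]
      refine Finset.sum_congr rfl fun r _ => ?_
      simp only [Pi.smul_apply, smul_eq_mul]
      ring
    rw [this, map_sum]
    refine Finset.sum_eq_zero fun r _ => ?_
    rw [map_smul, smul_eq_mul]
    by_cases hr : i ≤ r
    · have : colMinor A.transpose j (A r) = headMinor A.transpose j j r := colMinor_col A.transpose j r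
      rw [this, headMinor_eq_zero_of_lt _ (h.trans_le hr), mul_zero]
    · rw [colMinor_eq_zero, zero_div, zero_mul]
      intro a ha
      rw [Pi.single_eq_of_ne]
      rintro rfl
      exact hr ha

/-- Apart from its first row, the minor uses only rows with index above `j`, hence never row `0`; so
it is affine in the entries of that row. -/
theorem headMinor_add_single [NeZero n] (A : Matrix (Fin n) (Fin n) ℂ) (j k : Fin n) (s : ℂ) :
    headMinor (A + s • Matrix.single 0 k 1) j 0 j
      = headMinor A j 0 j + s * colMinor A.transpose j (Pi.single k 1) := by
  have key (M : Matrix (Fin n) (Fin n) ℂ) :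
      headMinor M j 0 j = colMinor M.transpose j (M 0) := by
    rw [← headMinor_transpose, ← colMinor_col]
    rfl
  rw [key, key, colMinor_congr (A' := A.transpose), ← smul_eq_mul, ← map_smul, ← map_add]
  · congr 1
    ext c
    simp [Matrix.single_apply, Pi.single_apply, eq_comm]
  · intro r c _ hc
    have : c ≠ 0 := (lt_of_le_of_lt (Fin.zero_le _) hc).ne'
    simp [this.symm]

/-! ### The canonical Poisson relations -/

theorem lineDeriv_const_line {f : PhaseSpace n → ℂ} {p v : PhaseSpace n}
    (h : ∀ s : ℂ, f (p + s • v) = f p) : lineDeriv ℂ f p v = 0 := by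
  rw [lineDeriv]
  simp only [h, deriv_const]

theorem lineDeriv_affine_line {f : PhaseSpace n → ℂ} {p v : PhaseSpace n} {c : ℂ}
    (h : ∀ s : ℂ, f (p + s • v) = f p + s * c) : lineDeriv ℂ f p v = c := by
  rw [lineDeriv]
  simp only [h]
  simp

theorem partialB_lam [NeZero n] (t : ℂ) (i : Fin n) (ξ : Pole) (a b : Fin n) (p : PhaseSpace n) :
    partialB (lam t i) ξ a b p = 0 :=
  lineDeriv_const_line fun s => by simp [lam]

theorem partialC_lam_t [NeZero n] (t : ℂ) (i : Fin n) (k : Fin n) (p : PhaseSpace n) :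
    partialC (lam t i) Pole.t 0 k p = (-1) ^ (n - (i + 1 : ℕ) + 1) * t *
      (colMinor (p.2 Pole.t).transpose i (Pi.single k 1) / headMinor (p.2 Pole.one) i 0 i) := by
  refine lineDeriv_affine_line fun s => ?_
  simp only [lam, Prod.snd_add, Prod.smul_snd, Pi.add_apply, Pi.smul_apply, Pi.single_eq_same,
    headMinor_add_single, ne_eq, reduceCtorEq, not_false_eq_true, Pi.single_eq_of_ne, smul_zero,
    add_zero]
  ring

theorem partialB_mu_one [NeZero n] (t : ℂ) (i : Fin n) (a b : Fin n) (p : PhaseSpace n) :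
    partialB (mu t i) Pole.one a b p = 0 :=
  lineDeriv_const_line fun s => by simp [mu]

theorem partialB_mu_t_of_ne [NeZero n] (t : ℂ) (i : Fin n) (a : Fin n) {b : Fin n} (hb : b ≠ 0)
    (p : PhaseSpace n) : partialB (mu t i) Pole.t a b p = 0 :=
  lineDeriv_const_line fun s => by simp [mu, hb]

theorem partialB_mu_t [NeZero n] (t : ℂ) (i : Fin n) (k : Fin n) (p : PhaseSpace n) :
    partialB (mu t i) Pole.t k 0 p = (-1) ^ (n - (i + 1 : ℕ)) * t⁻¹ *
      (headMinor (p.2 Pole.one) i 0 i / tailMinor (p.2 Pole.t) i) *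
      (headMinor (p.2 Pole.t) i i k / headMinor (p.2 Pole.t) i i i) := by
  refine lineDeriv_affine_line fun s => ?_
  have : (fun a => (p.1 Pole.t + s • Matrix.single k 0 (1 : ℂ) : Matrix (Fin n) (Fin n) ℂ) a 0)
      = (fun a => p.1 Pole.t a 0) + s • Pi.single k 1 := by
    ext a
    simp [Matrix.single_apply, Pi.single_apply, eq_comm]
  simp only [mu_eq, Prod.fst_add, Prod.smul_fst, Prod.snd_add, Prod.smul_snd, smul_zero,
    Pi.add_apply, Pi.smul_apply, Pi.single_eq_same, this, Pi.zero_apply, add_zero]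
  rw [Matrix.mulVec_add, map_add, Matrix.mulVec_smul, map_smul, Matrix.mulVec_single_one]
  have : colMinor (p.2 Pole.t) i ((p.2 Pole.t).col k) = _ := colMinor_col (p.2 Pole.t) i k
  rw [this, smul_eq_mul]
  ring

theorem mu_zero_eq [NeZero n] (t : ℂ) {p : PhaseSpace n} (hp : headMinor (p.2 Pole.t) 0 0 0 ≠ 0) :
    mu t 0 p = (-1) ^ (n - ((0 : Fin n) + 1 : ℕ)) * t⁻¹ *
      (headMinor (p.2 Pole.one) 0 0 0 / tailMinor (p.2 Pole.t) 0) * p.1 Pole.t 0 0 := by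
  have : Finset.Iic (0 : Fin n) = {0} := by
    ext a
    simp
  rw [mu, this, Finset.sum_singleton, div_self hp, one_mul]

/-- For `i ≠ 0` the minors of `C_t` in `μ_i` avoid the first row. For `i = 0` the minors containing
it appear only as the ratio with `k = i`, which is one. -/
theorem partialC_mu_t [NeZero n] (t : ℂ) (i : Fin n) (k : Fin n) {p : PhaseSpace n}
    (hp : Nondegenerate p) : partialC (mu t i) Pole.t 0 k p = 0 := by
  have htail (s : ℂ) :
      tailMinor (p.2 Pole.t + s • Matrix.single 0 k 1) i = tailMinor (p.2 Pole.t) i := by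
    unfold tailMinor
    congr 1
    ext a b
    have : (0 : Fin n) ≠ tail i a := by
      intro h
      have := congrArg Fin.val h
      simp only [tail, Fin.val_zero] at this
      omega
    simp [this]
  rcases eq_or_ne i 0 with rfl | hi
  -- The ratio equals one only where the minor is nonzero, so the function is constant only near `s
  -- = 0`.
  · have hev : ∀ᶠ s : ℂ in nhds 0,
        mu t 0 (p + s • (0, Pi.single Pole.t (Matrix.single 0 k 1))) = mu t 0 p := by
      have hc : Continuous fun s : ℂ =>
          headMinor ((p + s • (0, Pi.single Pole.t (Matrix.single 0 k 1)) : PhaseSpace n).2 Pole.t)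
            0 0 0 :=
        (differentiable_headMinor Pole.t 0 0 0).continuous.comp (by fun_prop)
      filter_upwards [hc.continuousAt.eventually_ne (by simpa using (hp 0).2.1)] with s hs
      rw [mu_zero_eq t hs, mu_zero_eq t (hp 0).2.1]
      simp [htail, -Matrix.smul_single]
    rw [partialC, lineDeriv, Filter.EventuallyEq.deriv_eq hev, deriv_const]
  · refine lineDeriv_const_line fun s => ?_
    have (l : Fin n) : headMinor (p.2 Pole.t + s • Matrix.single 0 k 1) i i l
        = headMinor (p.2 Pole.t) i i l := by
      unfold headMinor
      congr 1
      ext a b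
      have : (0 : Fin n) ≠ headTail i i a := by
        intro h
        rw [headTail_self] at h
        have := congrArg Fin.val h
        simp only [Fin.val_zero] at this
        exact hi (Fin.ext (by simp only [Fin.val_zero]; omega))
      simp [this]
    simp [mu, htail, this, -Matrix.smul_single]

/-- Only the pairs `b^{(t)}_{k,1}`, `c^{(t)}_{1,k}` contribute. The sum over `k` applies a minor
that is linear in one row to the vector of ratios in `μ_i`, so `colMinor_transpose_ratio` evaluates
it. -/
theorem bracket_mu_lam [NeZero n] {t : ℂ} (ht : t ≠ 0) (i j : Fin n) {p : PhaseSpace n}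
    (hp : Nondegenerate p) : bracket (mu t i) (lam t j) p = if i = j then 1 else 0 := by
  have hsum : bracket (mu t i) (lam t j) p
      = -∑ k, partialB (mu t i) Pole.t k 0 p * partialC (lam t j) Pole.t 0 k p := by
    simp only [bracket, partialB_lam, partialB_mu_one, mul_zero, zero_mul, sub_zero, add_zero,
      zero_sub, ← Finset.sum_neg_distrib]
    refine Finset.sum_congr rfl fun k _ => ?_
    rw [Finset.sum_eq_single 0 (fun b _ hb => ?_) (by simp)]
    rw [partialB_mu_t_of_ne t i k hb, zero_mul, neg_zero]
  have hk : ∀ k, partialB (mu t i) Pole.t k 0 p * partialC (lam t j) Pole.t 0 k p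
      = ((-1) ^ (n - (i + 1 : ℕ)) * (-1) ^ (n - (j + 1 : ℕ) + 1) *
        (headMinor (p.2 Pole.one) i 0 i / tailMinor (p.2 Pole.t) i /
          headMinor (p.2 Pole.one) j 0 j)) *
        (headMinor (p.2 Pole.t) i i k / headMinor (p.2 Pole.t) i i i *
          colMinor (p.2 Pole.t).transpose j (Pi.single k 1)) := by
    intro k
    rw [partialB_mu_t, partialC_lam_t]
    field_simp
  rw [hsum, Finset.sum_congr rfl fun k _ => hk k, ← Finset.mul_sum, ← colMinor_eq_sum,
    colMinor_transpose_ratio _ _ _ (hp i).2.1]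
  split_ifs with h
  · subst h
    have h1 := (hp i).1
    have h2 := (hp i).2.2
    have h3 : ((-1 : ℂ) ^ (n - (i + 1 : ℕ))) * (-1) ^ (n - (i + 1 : ℕ) + 1) = -1 := by
      rw [pow_succ, ← mul_assoc, ← mul_pow]
      simp
    rw [h3]
    field_simp
  · simp

/-- The variables conjugate to the `b^{(t)}_{k,1}` are the entries of the first row of `C_t`, along
which every `μ_j` has zero derivative. -/
theorem bracket_mu_mu [NeZero n] (t : ℂ) (i j : Fin n) {p : PhaseSpace n}
    (hp : Nondegenerate p) : bracket (mu t i) (mu t j) p = 0 := by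
  refine Finset.sum_eq_zero fun a _ => Finset.sum_eq_zero fun b _ => ?_
  rcases eq_or_ne b 0 with rfl | hb
  · simp [partialB_mu_one, partialC_mu_t t _ _ hp]
  · simp [partialB_mu_one, partialB_mu_t_of_ne t _ _ hb]

theorem bracket_lam_lam [NeZero n] (t : ℂ) (i j : Fin n) (p : PhaseSpace n) :
    bracket (lam t i) (lam t j) p = 0 := by
  simp [bracket, partialB_lam]

end Schlesinger

namespace Schlesinger

variable {n : ℕ}

/-! ### The Borel gauge group -/

theorem fin_pos_of_ne_zero [NeZero n] {j : Fin n} (hj : j ≠ 0) : 0 < j :=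
  lt_of_le_of_ne (Fin.zero_le j) hj.symm

/-- The block matrix `[[P, 0], [S, Q]]` belongs to the Borel subgroup that preserves the chain of
index sets used in the definition of `λ_i`, `μ_i`. -/
structure IsBorel [NeZero n] (P Q S : Matrix (Fin n) (Fin n) ℂ) : Prop where
  detP : IsUnit P.det
  detQ : IsUnit Q.det
  upper : ∀ i j, j < i → P i j = 0
  row : ∀ j, j ≠ 0 → P 0 j = 0
  lower : ∀ i j, i < j → Q i j = 0
  col : ∀ i, S i 0 = 0

/-- `q` is obtained from `p` by the gauge transformation `[[P, 0], [S, Q]]`. -/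
structure IsGauge (P Q S : Matrix (Fin n) (Fin n) ℂ) (p q : PhaseSpace n) : Prop where
  c : ∀ ξ, P * q.2 ξ = p.2 ξ * Q
  b : ∀ ξ, Q * q.1 ξ = p.1 ξ * P - S

/-- Equivalence under the Borel gauge group. -/
def BorelEquiv [NeZero n] (p q : PhaseSpace n) : Prop :=
  ∃ P Q S, IsBorel P Q S ∧ IsGauge P Q S p q

/-- The action of a gauge transformation. -/
noncomputable def gaugeAct (P Q S : Matrix (Fin n) (Fin n) ℂ) (p : PhaseSpace n) : PhaseSpace n :=
  (fun ξ => Q⁻¹ * (p.1 ξ * P - S), fun ξ => P⁻¹ * (p.2 ξ * Q))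

theorem isGauge_gaugeAct [NeZero n] {P Q S : Matrix (Fin n) (Fin n) ℂ} (h : IsBorel P Q S)
    (p : PhaseSpace n) : IsGauge P Q S p (gaugeAct P Q S p) :=
  ⟨fun _ => Matrix.mul_nonsing_inv_cancel_left _ _ h.detP,
    fun _ => Matrix.mul_nonsing_inv_cancel_left _ _ h.detQ⟩

theorem IsBorel.blockP [NeZero n] {P Q S : Matrix (Fin n) (Fin n) ℂ} (h : IsBorel P Q S) :
    P.BlockTriangular id :=
  fun _ _ hij => h.upper _ _ hij

theorem IsBorel.blockRow [NeZero n] {P Q S : Matrix (Fin n) (Fin n) ℂ} (h : IsBorel P Q S) :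
    P.BlockTriangular (fun i => if i = 0 then 1 else 0) := by
  intro i j hij
  dsimp only at hij
  split_ifs at hij with hj hi hi <;> simp_all
  exact h.row j hj

theorem IsBorel.blockQ [NeZero n] {P Q S : Matrix (Fin n) (Fin n) ℂ} (h : IsBorel P Q S) :
    Q.BlockTriangular OrderDual.toDual :=
  fun _ _ hij => h.lower _ _ hij

theorem IsBorel.of_block [NeZero n] {P Q S : Matrix (Fin n) (Fin n) ℂ} (hP : IsUnit P.det)
    (hQ : IsUnit Q.det) (h1 : P.BlockTriangular id)
    (h2 : P.BlockTriangular (fun i : Fin n => if i = 0 then 1 else 0))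
    (h3 : Q.BlockTriangular OrderDual.toDual) (h4 : ∀ i, S i 0 = 0) : IsBorel P Q S where
  detP := hP
  detQ := hQ
  upper _ _ hij := h1 hij
  row j hj := h2 (by simp [hj])
  lower _ _ hij := h3 hij
  col := h4

theorem IsBorel.mul [NeZero n] {P Q S P' Q' S' : Matrix (Fin n) (Fin n) ℂ} (h : IsBorel P Q S)
    (h' : IsBorel P' Q' S') : IsBorel (P * P') (Q * Q') (S * P' + Q * S') := by
  refine IsBorel.of_block ?_ ?_ (h.blockP.mul h'.blockP) (h.blockRow.mul h'.blockRow)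
    (h.blockQ.mul h'.blockQ) fun i => ?_
  · rw [Matrix.det_mul]
    exact h.detP.mul h'.detP
  · rw [Matrix.det_mul]
    exact h.detQ.mul h'.detQ
  · rw [Matrix.add_apply, Matrix.mul_apply, Matrix.mul_apply, Finset.sum_eq_zero, Finset.sum_eq_zero,
      add_zero]
    · intro j _
      rw [h'.col, mul_zero]
    · intro j _
      rcases eq_or_ne j 0 with rfl | hj
      · rw [h.col, zero_mul]
      · rw [h'.upper j 0 (fin_pos_of_ne_zero hj), mul_zero]

theorem IsBorel.inv [NeZero n] {P Q S : Matrix (Fin n) (Fin n) ℂ} (h : IsBorel P Q S) :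
    IsBorel P⁻¹ Q⁻¹ (-(Q⁻¹ * S * P⁻¹)) := by
  have := P.invertibleOfIsUnitDet h.detP
  have := Q.invertibleOfIsUnitDet h.detQ
  have hP := Matrix.blockTriangular_inv_of_blockTriangular h.blockP
  refine IsBorel.of_block ?_ ?_ hP (Matrix.blockTriangular_inv_of_blockTriangular h.blockRow)
    (Matrix.blockTriangular_inv_of_blockTriangular h.blockQ) fun i => ?_
  · exact (Matrix.isUnit_nonsing_inv_det_iff).mpr h.detP
  · exact (Matrix.isUnit_nonsing_inv_det_iff).mpr h.detQ
  · rw [Matrix.neg_apply, Matrix.mul_apply, Finset.sum_eq_zero, neg_zero]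
    intro j _
    rcases eq_or_ne j 0 with rfl | hj
    · rw [Matrix.mul_apply, Finset.sum_eq_zero, zero_mul]
      intro k _
      rw [h.col, mul_zero]
    · rw [hP (i := j) (j := 0) (fin_pos_of_ne_zero hj), mul_zero]

theorem IsGauge.trans {P Q S P' Q' S' : Matrix (Fin n) (Fin n) ℂ} {p q r : PhaseSpace n}
    (h : IsGauge P Q S p q) (h' : IsGauge P' Q' S' q r) :
    IsGauge (P * P') (Q * Q') (S * P' + Q * S') p r where
  c ξ := by rw [Matrix.mul_assoc, h'.c, ← Matrix.mul_assoc, h.c, Matrix.mul_assoc]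
  b ξ := by
    rw [Matrix.mul_assoc, h'.b, Matrix.mul_sub, ← Matrix.mul_assoc, h.b, Matrix.sub_mul,
      Matrix.mul_assoc, sub_sub]

theorem IsGauge.symm [NeZero n] {P Q S : Matrix (Fin n) (Fin n) ℂ} (hB : IsBorel P Q S)
    {p q : PhaseSpace n} (h : IsGauge P Q S p q) :
    IsGauge P⁻¹ Q⁻¹ (-(Q⁻¹ * S * P⁻¹)) q p where
  c ξ := by
    have := congrArg (fun M => P⁻¹ * M * Q⁻¹) (h.c ξ)
    simp only [← Matrix.mul_assoc] at this
    rw [Matrix.nonsing_inv_mul _ hB.detP, Matrix.one_mul, Matrix.mul_nonsing_inv_cancel_right _ _ hB.detQ] at this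
    exact this.symm
  b ξ := by
    have := congrArg (fun M => Q⁻¹ * M * P⁻¹) (h.b ξ)
    simp only [Matrix.mul_sub, Matrix.sub_mul, ← Matrix.mul_assoc] at this
    rw [Matrix.nonsing_inv_mul _ hB.detQ, Matrix.one_mul, Matrix.mul_nonsing_inv_cancel_right _ _ hB.detP] at this
    rw [this]
    abel

theorem BorelEquiv.trans [NeZero n] {p q r : PhaseSpace n} (h : BorelEquiv p q)
    (h' : BorelEquiv q r) : BorelEquiv p r := by
  obtain ⟨P, Q, S, hB, hG⟩ := h
  obtain ⟨P', Q', S', hB', hG'⟩ := h'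
  exact ⟨_, _, _, hB.mul hB', hG.trans hG'⟩

theorem BorelEquiv.symm [NeZero n] {p q : PhaseSpace n} (h : BorelEquiv p q) : BorelEquiv q p := by
  obtain ⟨P, Q, S, hB, hG⟩ := h
  exact ⟨_, _, _, hB.inv, hG.symm hB⟩

/-! ### Invariance of `λ_i`, `μ_i` -/

/-- The rows of `R` selected by `h` are supported on the image of `h`; after taking determinants,
Cauchy–Binet has a single term. -/
theorem submatrix_mul_left {R M : Matrix (Fin n) (Fin n) ℂ} {k l : ℕ} {h : Fin k → Fin n}
    (hinj : Function.Injective h) (hR : ∀ a r, (∀ b, h b ≠ r) → R (h a) r = 0)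
    (g : Fin l → Fin n) :
    (R * M).submatrix h g = R.submatrix h h * M.submatrix h g := by
  ext a c
  rw [Matrix.submatrix_apply, Matrix.mul_apply, Matrix.mul_apply]
  symm
  refine (Finset.sum_map Finset.univ ⟨h, hinj⟩ fun r => R (h a) r * M r (g c)).symm.trans ?_
  refine Finset.sum_subset (Finset.subset_univ _) fun r _ hr => ?_
  rw [hR, zero_mul]
  intro b hb
  exact hr (by simp [← hb])

theorem submatrix_mul_right {R M : Matrix (Fin n) (Fin n) ℂ} {k l : ℕ} {h : Fin k → Fin n}
    (hinj : Function.Injective h) (hR : ∀ a r, (∀ b, h b ≠ r) → R r (h a) = 0)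
    (g : Fin l → Fin n) :
    (M * R).submatrix g h = M.submatrix g h * R.submatrix h h := by
  have := submatrix_mul_left (R := R.transpose) (M := M.transpose) hinj hR g
  simpa [← Matrix.transpose_mul, ← Matrix.transpose_submatrix] using congrArg Matrix.transpose this

theorem exists_tail_eq {i r : Fin n} (h : i < r) : ∃ b, tail i b = r := by
  have := Fin.lt_def.mp h
  refine ⟨⟨r - (i + 1), by omega⟩, Fin.ext ?_⟩
  simp only [tail]
  omega

theorem exists_headTail_self_eq {i r : Fin n} (h : i ≤ r) : ∃ b, headTail i i b = r := by
  have := Fin.le_def.mp h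
  refine ⟨⟨r - i, by omega⟩, ?_⟩
  rw [headTail_self]
  ext
  simp only
  omega

theorem exists_headTail_eq (k : Fin n) {i r : Fin n} (h : i < r) : ∃ b, headTail k i b = r := by
  obtain ⟨b, hb⟩ := exists_tail_eq h
  exact ⟨⟨b + 1, by omega⟩, by rw [headTail_succ, hb]⟩

theorem lt_tail (i : Fin n) (a) : i < tail i a := Fin.lt_def.mpr (by simp only [tail]; omega)

theorem le_headTail_self (i : Fin n) (a) : i ≤ headTail i i a := by
  rw [headTail_self]
  exact Fin.le_def.mpr (by simp)

section

variable [NeZero n] {P Q S : Matrix (Fin n) (Fin n) ℂ} {p q : PhaseSpace n}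

theorem IsBorel.diagP_ne_zero (h : IsBorel P Q S) (i : Fin n) : P i i ≠ 0 := by
  have := h.detP
  rw [Matrix.det_of_isUpperTriangular h.blockP, isUnit_iff_ne_zero, Finset.prod_ne_zero_iff] at this
  exact this i (Finset.mem_univ i)

theorem IsBorel.diagQ_ne_zero (h : IsBorel P Q S) (i : Fin n) : Q i i ≠ 0 := by
  have := h.detQ
  rw [Matrix.det_of_isLowerTriangular Q h.blockQ, isUnit_iff_ne_zero, Finset.prod_ne_zero_iff] at this
  exact this i (Finset.mem_univ i)

theorem IsBorel.det_submatrixP_ne_zero (h : IsBorel P Q S) {k : ℕ} {f : Fin k → Fin n}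
    (hf : StrictMono f) : (P.submatrix f f).det ≠ 0 := by
  rw [Matrix.det_of_isUpperTriangular (M := P.submatrix f f) (fun i j hij => h.upper _ _ (hf hij)),
    Finset.prod_ne_zero_iff]
  exact fun i _ => h.diagP_ne_zero _

theorem IsBorel.det_submatrixQ_ne_zero (h : IsBorel P Q S) {k : ℕ} {f : Fin k → Fin n}
    (hf : StrictMono f) : (Q.submatrix f f).det ≠ 0 := by
  rw [Matrix.det_of_isLowerTriangular (M := Q.submatrix f f) (fun i j hij => h.lower _ _ (hf hij)),
    Finset.prod_ne_zero_iff]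
  exact fun i _ => h.diagQ_ne_zero _

/-- The index set `0, i+1, …` is not an interval: besides triangularity this needs the diagonal
first row of `P`. -/
theorem IsBorel.rowP_headTail_zero (h : IsBorel P Q S) (i : Fin n) (a : Fin (n - i)) (r : Fin n)
    (hr : ∀ b, headTail 0 i b ≠ r) : P (headTail 0 i a) r = 0 := by
  by_cases ha : (a : ℕ) = 0
  · have h0 : headTail 0 i a = 0 := by simp [headTail, ha]
    rw [h0]
    refine h.row r ?_
    rintro rfl
    exact hr a h0
  · refine h.upper _ _ (lt_of_le_of_lt (not_lt.mp fun hir => ?_) (b := i) ?_)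
    · obtain ⟨b, hb⟩ := exists_headTail_eq 0 hir
      exact hr b hb
    · rw [headTail_of_ne_zero _ _ ha]
      exact Fin.lt_def.mpr (by simp only; omega)

theorem IsBorel.rowP_headTail_self (h : IsBorel P Q S) (i : Fin n) (a : Fin (n - i)) (r : Fin n)
    (hr : ∀ b, headTail i i b ≠ r) : P (headTail i i a) r = 0 := by
  refine h.upper _ _ (lt_of_lt_of_le (not_le.mp fun hir => ?_) (le_headTail_self i a))
  obtain ⟨b, hb⟩ := exists_headTail_self_eq hir
  exact hr b hb

theorem IsBorel.colQ_headTail_self (h : IsBorel P Q S) (i : Fin n) (a : Fin (n - i)) (r : Fin n)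
    (hr : ∀ b, headTail i i b ≠ r) : Q r (headTail i i a) = 0 := by
  refine h.lower _ _ (lt_of_lt_of_le (not_le.mp fun hir => ?_) (le_headTail_self i a))
  obtain ⟨b, hb⟩ := exists_headTail_self_eq hir
  exact hr b hb

theorem IsBorel.rowP_tail (h : IsBorel P Q S) (i : Fin n) (a) (r : Fin n)
    (hr : ∀ b, tail i b ≠ r) : P (tail i a) r = 0 := by
  refine h.upper _ _ (lt_of_le_of_lt (not_lt.mp fun hir => ?_) (lt_tail i a))
  obtain ⟨b, hb⟩ := exists_tail_eq hir
  exact hr b hb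

theorem IsBorel.colQ_tail (h : IsBorel P Q S) (i : Fin n) (a) (r : Fin n)
    (hr : ∀ b, tail i b ≠ r) : Q r (tail i a) = 0 := by
  refine h.lower _ _ (lt_of_le_of_lt (not_lt.mp fun hir => ?_) (lt_tail i a))
  obtain ⟨b, hb⟩ := exists_tail_eq hir
  exact hr b hb

/-- The row set is stable under `P` and the column set under `Q`, so the minor is a relative
invariant with characters given by the corresponding principal minors of `P` and `Q`. The next two
lemmas have the same reason. -/
theorem IsGauge.headMinor_zero (hB : IsBorel P Q S) (h : IsGauge P Q S p q) (ξ : Pole)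
    (i : Fin n) :
    (P.submatrix (headTail 0 i) (headTail 0 i)).det * headMinor (q.2 ξ) i 0 i
      = headMinor (p.2 ξ) i 0 i * (Q.submatrix (headTail i i) (headTail i i)).det := by
  rw [headMinor, headMinor, ← Matrix.det_mul, ← Matrix.det_mul,
    ← submatrix_mul_left (headTail_zero_strictMono i).injective (hB.rowP_headTail_zero i),
    ← submatrix_mul_right (headTail_self_injective i) (hB.colQ_headTail_self i), h.c]

theorem IsGauge.headMinor_self (hB : IsBorel P Q S) (h : IsGauge P Q S p q) (ξ : Pole)
    (i : Fin n) :
    (P.submatrix (headTail i i) (headTail i i)).det * headMinor (q.2 ξ) i i i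
      = headMinor (p.2 ξ) i i i * (Q.submatrix (headTail i i) (headTail i i)).det := by
  rw [headMinor, headMinor, ← Matrix.det_mul, ← Matrix.det_mul,
    ← submatrix_mul_left (headTail_self_injective i) (hB.rowP_headTail_self i),
    ← submatrix_mul_right (headTail_self_injective i) (hB.colQ_headTail_self i), h.c]

theorem IsGauge.tailMinor (hB : IsBorel P Q S) (h : IsGauge P Q S p q) (ξ : Pole)
    (i : Fin n) :
    (P.submatrix (tail i) (tail i)).det * tailMinor (q.2 ξ) i
      = tailMinor (p.2 ξ) i * (Q.submatrix (tail i) (tail i)).det := by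
  rw [Schlesinger.tailMinor, Schlesinger.tailMinor, ← Matrix.det_mul, ← Matrix.det_mul,
    ← submatrix_mul_left (tail_strictMono i).injective (hB.rowP_tail i),
    ← submatrix_mul_right (tail_strictMono i).injective (hB.colQ_tail i), h.c]

theorem IsGauge.nondegenerate (hB : IsBorel P Q S) (h : IsGauge P Q S p q)
    (hp : Nondegenerate p) : Nondegenerate q := by
  intro i
  refine ⟨fun h0 => ?_, fun h0 => ?_, fun h0 => ?_⟩
  · have := h.headMinor_zero hB Pole.one i
    rw [h0, mul_zero] at this
    exact mul_ne_zero (hp i).1 (hB.det_submatrixQ_ne_zero (headTail_self_strictMono i)) this.symm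
  · have := h.headMinor_self hB Pole.t i
    rw [h0, mul_zero] at this
    exact mul_ne_zero (hp i).2.1 (hB.det_submatrixQ_ne_zero (headTail_self_strictMono i)) this.symm
  · have := h.tailMinor hB Pole.t i
    rw [h0, mul_zero] at this
    exact mul_ne_zero (hp i).2.2 (hB.det_submatrixQ_ne_zero (tail_strictMono i)) this.symm

/-- Numerator and denominator are the same minor at the two poles, so they scale by the same factor.
-/
theorem IsGauge.lam_eq (hB : IsBorel P Q S) (h : IsGauge P Q S p q) (t : ℂ) (i : Fin n) :
    lam t i q = lam t i p := by
  have h1 := h.headMinor_zero hB Pole.t i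
  have h2 := h.headMinor_zero hB Pole.one i
  have hP := hB.det_submatrixP_ne_zero (headTail_zero_strictMono i)
  have hQ := hB.det_submatrixQ_ne_zero (headTail_self_strictMono i)
  rw [lam, lam, ← mul_div_mul_left (headMinor (q.2 Pole.t) i 0 i) _ hP, h1, h2,
    mul_div_mul_right _ _ hQ]

theorem IsBorel.colMinor_mul_left (hB : IsBorel P Q S) (A : Matrix (Fin n) (Fin n) ℂ) (i : Fin n)
    (v : Fin n → ℂ) : colMinor (P * A) i (P.mulVec v)
      = (P.submatrix (headTail i i) (headTail i i)).det * colMinor A i v := by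
  rw [colMinor_apply, colMinor_apply, ← Matrix.det_mul]
  congr 1
  have hmul {l : ℕ} (g : Fin l → Fin n) (M : Matrix (Fin n) (Fin n) ℂ) :=
    submatrix_mul_left (M := M) (headTail_self_injective i) (hB.rowP_headTail_self i) g
  ext a c
  by_cases hc : c = ⟨0, by omega⟩
  · subst hc
    have := congrFun (congrFun (hmul (l := 1) (fun _ => 0) (Matrix.of fun r _ => v r)) a) 0
    simpa [Matrix.mul_apply, Matrix.mulVec, dotProduct] using this
  · rw [Matrix.updateCol_ne hc, hmul, Matrix.mul_apply, Matrix.mul_apply]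
    simp only [Matrix.updateCol_ne hc]

theorem IsBorel.colMinor_mul_right (hB : IsBorel P Q S) (A : Matrix (Fin n) (Fin n) ℂ)
    (i : Fin n) (v : Fin n → ℂ) : colMinor (A * Q) i v
      = colMinor A i v * (Q.submatrix (tail i) (tail i)).det := by
  -- The replaced column is not acted on by `Q`. Putting a unit vector in the first column of the
  -- `Q`-block makes the matrix of the left-hand minor an actual product.
  have hQ : (Q.submatrix (tail i) (tail i)).det
      = ((Q.submatrix (headTail i i) (headTail i i)).updateCol ⟨0, by omega⟩
        (Pi.single ⟨0, by omega⟩ 1)).det := by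
    rw [det_of_first_row (m := n - i) (k := n - (i + 1)) (by omega)]
    · simp only [Matrix.updateCol_self, Pi.single_eq_same, one_mul]
      congr 1
      ext a b
      rw [Matrix.submatrix_apply, Matrix.submatrix_apply, Matrix.updateCol_ne (by simp),
        Matrix.submatrix_apply, headTail_succ, headTail_succ]
    · intro c hc
      rw [Matrix.updateCol_ne (fun h => hc (by rw [h])), Matrix.submatrix_apply, headTail_zero]
      refine hB.lower _ _ ?_
      rw [headTail_self, Fin.lt_def]
      simp only
      omega
  rw [hQ, colMinor_apply, colMinor_apply, ← Matrix.det_mul]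
  congr 1
  ext a c
  by_cases hc : c = ⟨0, by omega⟩
  · subst hc
    simp [Matrix.mul_apply, Pi.single_apply]
  · rw [Matrix.updateCol_ne hc,
      submatrix_mul_right (headTail_self_injective i) (hB.colQ_headTail_self i),
      Matrix.mul_apply, Matrix.mul_apply]
    refine Finset.sum_congr rfl fun b _ => ?_
    rw [Matrix.updateCol_ne (M := Q.submatrix _ _) hc]
    by_cases hb : b = ⟨0, by omega⟩
    · rw [Matrix.submatrix_apply (A := Q), hB.lower, mul_zero, mul_zero]
      refine headTail_self_strictMono i (Fin.lt_def.mpr ?_)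
      have : (c : ℕ) ≠ 0 := fun h => hc (Fin.ext h)
      rw [hb]
      simp only
      omega
    · rw [Matrix.updateCol_ne hb]

/-- The first column of `S` is zero and that of `P` is `P 0 0` times a unit vector, so the first
column of `B` is transformed by `Q⁻¹` and a scalar, and `Q⁻¹` is absorbed by `C`. -/
theorem IsGauge.colMinor (hB : IsBorel P Q S) (h : IsGauge P Q S p q) (ξ : Pole) (i : Fin n) :
    (P.submatrix (headTail i i) (headTail i i)).det *
        colMinor (q.2 ξ) i ((q.2 ξ).mulVec fun k => q.1 ξ k 0)
      = P 0 0 * colMinor (p.2 ξ) i ((p.2 ξ).mulVec fun k => p.1 ξ k 0) *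
        (Q.submatrix (tail i) (tail i)).det := by
  have hq : Q.mulVec (fun k => q.1 ξ k 0) = P 0 0 • fun k => p.1 ξ k 0 := by
    ext a
    have := congrFun (congrFun (h.b ξ) a) 0
    rw [Matrix.sub_apply, hB.col, sub_zero, Matrix.mul_apply, Matrix.mul_apply,
      Finset.sum_eq_single (f := fun j => p.1 ξ a j * P j 0) 0 (fun j _ hj => by
        rw [hB.upper j 0 (fin_pos_of_ne_zero hj), mul_zero]) (by simp)] at this
    exact this.trans (mul_comm _ _)
  rw [← hB.colMinor_mul_left, Matrix.mulVec_mulVec, h.c, ← Matrix.mulVec_mulVec, hq,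
    Matrix.mulVec_smul, map_smul, hB.colMinor_mul_right, smul_eq_mul, mul_assoc]

theorem IsGauge.mu_eq (hB : IsBorel P Q S) (h : IsGauge P Q S p q) (hp : Nondegenerate p)
    (t : ℂ) (i : Fin n) : mu t i q = mu t i p := by
  have hq := h.nondegenerate hB hp
  -- The factor `P 0 0` split off here cancels against the one that the first column of `B_t`
  -- acquires.
  have hP : (P.submatrix (headTail 0 i) (headTail 0 i)).det
      = P 0 0 * (P.submatrix (tail i) (tail i)).det := by
    rw [det_of_first_row (k := n - (i + 1)) (by omega)]
    · rw [Matrix.submatrix_apply, headTail_zero]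
      congr 2
      ext a b
      simp only [Matrix.submatrix_apply, headTail_succ]
    · intro c hc
      rw [Matrix.submatrix_apply, headTail_zero]
      refine hB.row _ fun h0 => ?_
      rw [headTail_of_ne_zero _ _ hc] at h0
      have := congrArg Fin.val h0
      simp only [Fin.val_zero] at this
      omega
  have h1 := h.headMinor_zero hB Pole.one i
  have h2 := h.headMinor_self hB Pole.t i
  have h3 := h.tailMinor hB Pole.t i
  have h4 := h.colMinor hB Pole.t i
  have hP0 := hB.diagP_ne_zero 0
  have hPt := hB.det_submatrixP_ne_zero (tail_strictMono i)
  have hPh := hB.det_submatrixP_ne_zero (headTail_self_strictMono i)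
  have hQt := hB.det_submatrixQ_ne_zero (tail_strictMono i)
  have hQh := hB.det_submatrixQ_ne_zero (headTail_self_strictMono i)
  have hp2 := (hp i).2.1
  have hp3 := (hp i).2.2
  rw [hP] at h1
  rw [mul_comm] at h1 h2 h3 h4
  rw [Schlesinger.mu_eq, Schlesinger.mu_eq, eq_div_of_mul_eq (mul_ne_zero hP0 hPt) h1,
    eq_div_of_mul_eq hPh h2, eq_div_of_mul_eq hPt h3, eq_div_of_mul_eq hPh h4]
  field_simp

end

end Schlesinger

namespace Schlesinger

variable {n : ℕ}

/-! ### The moment map and its Borel fibre -/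

theorem residue_eq_fromBlocks (θ : ℂ) (B C : Matrix (Fin n) (Fin n) ℂ) :
    residue θ B C = Matrix.fromBlocks (θ • 1 - C * B) C (B * (θ • 1 - C * B)) (B * C) := by
  rw [residue, Matrix.fromRows_mul_fromCols, Matrix.one_mul, Matrix.one_mul]

/-- The matrix `[[P, 0], [S, Q]]`. -/
def gaugeMatrix (P Q S : Matrix (Fin n) (Fin n) ℂ) : Matrix (Idx n) (Idx n) ℂ :=
  Matrix.fromBlocks P 0 S Q

/-- With `g = [[P, 0], [S, Q]]`, the gauge equations say that `g [I; B'] = [I; B] P`, and that the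
row factors `[θ - C B, C]` are intertwined by `P` and `g`. -/
theorem IsGauge.gaugeMatrix_mul_residue {P Q S : Matrix (Fin n) (Fin n) ℂ} {p q : PhaseSpace n}
    (h : IsGauge P Q S p q) (θ : ℂ) (ξ : Pole) :
    gaugeMatrix P Q S * residue θ (q.1 ξ) (q.2 ξ)
      = residue θ (p.1 ξ) (p.2 ξ) * gaugeMatrix P Q S := by
  have h1 : P * (θ • 1 - q.2 ξ * q.1 ξ) = (θ • 1 - p.2 ξ * p.1 ξ) * P + p.2 ξ * S := by
    rw [Matrix.mul_sub, ← Matrix.mul_assoc, h.c, Matrix.mul_assoc, h.b, Matrix.mul_sub,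
      Matrix.sub_mul, Matrix.mul_assoc]
    simp only [Matrix.mul_smul, Matrix.smul_mul, Matrix.mul_one, Matrix.one_mul]
    abel
  have h2 : S + Q * q.1 ξ = p.1 ξ * P := by
    rw [h.b]
    abel
  rw [residue_eq_fromBlocks, residue_eq_fromBlocks, gaugeMatrix, Matrix.fromBlocks_multiply,
    Matrix.fromBlocks_multiply]
  congr 1
  · rw [Matrix.zero_mul, add_zero, h1]
  · rw [Matrix.zero_mul, add_zero, h.c, Matrix.mul_zero, zero_add]
  · rw [← Matrix.mul_assoc, ← Matrix.add_mul, h2, Matrix.mul_assoc, h1, Matrix.mul_add,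
      Matrix.mul_assoc, Matrix.mul_assoc]
  · rw [← Matrix.mul_assoc, ← Matrix.add_mul, h2, Matrix.mul_assoc, h.c, Matrix.mul_zero, zero_add,
      Matrix.mul_assoc]

theorem IsGauge.gaugeMatrix_mul_residueSum {P Q S : Matrix (Fin n) (Fin n) ℂ} {p q : PhaseSpace n}
    (h : IsGauge P Q S p q) (θt θ1 : ℂ) :
    gaugeMatrix P Q S * residueSum θt θ1 q = residueSum θt θ1 p * gaugeMatrix P Q S := by
  rw [residueSum, residueSum, Matrix.mul_add, Matrix.add_mul, h.gaugeMatrix_mul_residue,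
    h.gaugeMatrix_mul_residue]

/-- The order of the indices in which the Borel gauge group is triangular. -/
def borelOrder [NeZero n] : Idx n → ℕ :=
  Sum.elim (fun i => if i = 0 then 0 else n + i) (fun i => n - i)

theorem borelOrder_injective [NeZero n] : Function.Injective (borelOrder (n := n)) := by
  rintro (i | i) (j | j) h <;> simp only [borelOrder, Sum.elim_inl, Sum.elim_inr] at h
  · split_ifs at h with h1 h2 h2
    · rw [h1, h2]
    · omega
    · omega
    · rw [Fin.ext (a := i) (b := j) (by omega)]
  · split_ifs at h with h1
    · omega
    · have := Fin.val_ne_of_ne h1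
      simp only [Fin.val_zero] at this
      omega
  · split_ifs at h with h1
    · omega
    · have := Fin.val_ne_of_ne h1
      simp only [Fin.val_zero] at this
      omega
  · rw [Fin.ext (a := i) (b := j) (by omega)]

theorem borelOrder_inl_zero [NeZero n] : borelOrder (n := n) (Sum.inl 0) = 0 := by
  simp [borelOrder]

theorem borelOrder_pos [NeZero n] {r : Idx n} (hr : r ≠ Sum.inl 0) : 0 < borelOrder r := by
  rw [Nat.pos_iff_ne_zero, ← borelOrder_inl_zero (n := n)]
  exact fun h => hr (borelOrder_injective h)

theorem borelOrder_inl [NeZero n] {i : Fin n} (hi : i ≠ 0) :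
    borelOrder (Sum.inl i : Idx n) = n + i := by
  simp [borelOrder, hi]

theorem borelOrder_inr [NeZero n] (i : Fin n) : borelOrder (Sum.inr i : Idx n) = n - i := rfl

theorem borelOrder_inr_lt_inl [NeZero n] {i : Fin n} (hi : i ≠ 0) (j : Fin n) :
    borelOrder (Sum.inr j : Idx n) < borelOrder (Sum.inl i : Idx n) := by
  rw [borelOrder_inl hi, borelOrder_inr]
  have := Fin.val_ne_of_ne hi
  simp only [Fin.val_zero] at this
  omega

theorem IsBorel.blockTriangular [NeZero n] {P Q S : Matrix (Fin n) (Fin n) ℂ}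
    (h : IsBorel P Q S) : (gaugeMatrix P Q S).BlockTriangular borelOrder := by
  rintro (i | i) (j | j) hij <;> simp only [borelOrder, Sum.elim_inl, Sum.elim_inr] at hij
  · refine h.upper i j (Fin.lt_def.mpr ?_)
    split_ifs at hij with h1 h2 h2
    · omega
    · subst h1
      have := Fin.val_ne_of_ne h2
      simp only [Fin.val_zero] at *
      omega
    · omega
    · omega
  · rfl
  · split_ifs at hij with h1
    · subst h1
      exact h.col i
    · omega
  · exact h.lower i j (Fin.lt_def.mpr (by omega))

/-- A matrix with the first row and the first column replaced by those of a diagonal matrix. -/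
def stripFirst [NeZero n] (d : ℂ) (M : Matrix (Idx n) (Idx n) ℂ) : Matrix (Idx n) (Idx n) ℂ :=
  fun r s => if r = Sum.inl 0 ∨ s = Sum.inl 0 then (if r = s then d else 0) else M r s

/-- `N` is block diagonal for the splitting into the first index and the others, so the blocks are
intertwined separately and the corner may be any scalar. -/
theorem stripFirst_intertwine [NeZero n] (d : ℂ) {N M M' : Matrix (Idx n) (Idx n) ℂ}
    (h : N * M' = M * N) (hr : ∀ s, s ≠ Sum.inl 0 → N (Sum.inl 0) s = 0)
    (hc : ∀ r, r ≠ Sum.inl 0 → N r (Sum.inl 0) = 0) :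
    N * stripFirst d M' = stripFirst d M * N := by
  ext r s
  rw [Matrix.mul_apply, Matrix.mul_apply]
  by_cases hr0 : r = Sum.inl 0
  · subst hr0
    rw [Finset.sum_eq_single (Sum.inl 0) (fun k _ hk => by rw [hr k hk, zero_mul]) (by simp),
      Finset.sum_eq_single (Sum.inl 0)
        (fun k _ hk => by rw [stripFirst, if_pos (Or.inl rfl), if_neg hk.symm, zero_mul]) (by simp)]
    by_cases hs : Sum.inl 0 = s
    · subst hs
      simp [stripFirst, mul_comm]
    · rw [hr s (Ne.symm hs)]
      simp [stripFirst, hs]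
  · by_cases hs0 : s = Sum.inl 0
    · subst hs0
      rw [Finset.sum_eq_single (Sum.inl 0)
          (fun k _ hk => by rw [stripFirst, if_pos (Or.inr rfl), if_neg hk, mul_zero]) (by simp),
        Finset.sum_eq_single (Sum.inl 0) (fun k _ hk => by rw [hc k hk, mul_zero]) (by simp),
        hc r hr0]
      simp [stripFirst, hr0]
    · have h' := congrFun (congrFun h r) s
      rw [Matrix.mul_apply, Matrix.mul_apply] at h'
      refine Eq.trans (Finset.sum_congr rfl fun k _ => ?_) (h'.trans
        (Finset.sum_congr rfl fun k _ => ?_))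
      · by_cases hk : k = Sum.inl 0
        · rw [hk, hc r hr0, zero_mul, zero_mul]
        · simp [stripFirst, hk, hs0]
      · by_cases hk : k = Sum.inl 0
        · rw [hk, hr s hs0, mul_zero, mul_zero]
        · simp [stripFirst, hk, hr0]

/-- The residues sum to a triangular matrix with diagonal `-κ`, outside of the first row and the
first column. -/
def InBorelFiber [NeZero n] (θt θ1 : ℂ) (κ : ℕ → ℂ) (p : PhaseSpace n) : Prop :=
  ∀ r s : Idx n, r ≠ Sum.inl 0 → s ≠ Sum.inl 0 → borelOrder s ≤ borelOrder r →
    residueSum θt θ1 p r s = if r = s then -κ r.num else 0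

/-- The residues sum to the diagonal matrix `-κ`, outside of the first row and the
first column. -/
def InTorusFiber [NeZero n] (θt θ1 : ℂ) (κ : ℕ → ℂ) (p : PhaseSpace n) : Prop :=
  ∀ r s : Idx n, r ≠ Sum.inl 0 → s ≠ Sum.inl 0 →
    residueSum θt θ1 p r s = if r = s then -κ r.num else 0

theorem InTorusFiber.inBorelFiber [NeZero n] {θt θ1 : ℂ} {κ : ℕ → ℂ} {p : PhaseSpace n}
    (h : InTorusFiber θt θ1 κ p) : InBorelFiber θt θ1 κ p :=
  fun r s hr hs _ => h r s hr hs

theorem Idx.num_inl_zero [NeZero n] : Idx.num (Sum.inl 0 : Idx n) = 1 := by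
  simp [Idx.num]

/-- The value `-κ 1` in the overwritten corner completes the diagonal to all the `-κ_i`, so the
fibre becomes a statement on full triangular matrices. -/
theorem inBorelFiber_iff [NeZero n] {θt θ1 : ℂ} {κ : ℕ → ℂ} {p : PhaseSpace n} :
    InBorelFiber θt θ1 κ p ↔
      (stripFirst (-κ 1) (residueSum θt θ1 p)).BlockTriangular borelOrder ∧
      ∀ r, stripFirst (-κ 1) (residueSum θt θ1 p) r r = -κ r.num := by
  constructor
  · intro h
    refine ⟨fun r s hrs => ?_, fun r => ?_⟩
    · have hne : r ≠ s := by
        rintro rfl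
        exact lt_irrefl _ hrs
      unfold stripFirst
      split_ifs with h0
      · rfl
      · rw [not_or] at h0
        rw [h r s h0.1 h0.2 hrs.le, if_neg hne]
    · by_cases h0 : r = Sum.inl 0
      · simp [stripFirst, h0, Idx.num_inl_zero]
      · simp [stripFirst, h0, h r r h0 h0 le_rfl]
  · rintro ⟨h1, h2⟩ r s hr hs hrs
    rcases hrs.lt_or_eq with hlt | heq
    · have := h1 hlt
      have hne : r ≠ s := by
        rintro rfl
        exact lt_irrefl _ hlt
      rw [if_neg hne]
      simpa [stripFirst, hr, hs] using this
    · have := borelOrder_injective heq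
      subst this
      have := h2 s
      rw [if_pos rfl]
      simpa [stripFirst, hs] using this

theorem inTorusFiber_iff [NeZero n] {θt θ1 : ℂ} {κ : ℕ → ℂ} {p : PhaseSpace n} :
    InTorusFiber θt θ1 κ p ↔
      stripFirst (-κ 1) (residueSum θt θ1 p) = Matrix.diagonal (fun r => -κ r.num) := by
  constructor
  · intro h
    ext r s
    rw [Matrix.diagonal_apply]
    unfold stripFirst
    split_ifs with h0 h1 h1
    · subst h1
      rw [or_self] at h0
      rw [h0, Idx.num_inl_zero]
    · rfl
    · subst h1
      rw [or_self] at h0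
      rw [h _ _ h0 h0, if_pos rfl]
    · rw [not_or] at h0
      rw [h _ _ h0.1 h0.2, if_neg h1]
  · intro h r s hr hs
    have := congrFun (congrFun h r) s
    simpa [stripFirst, hr, hs, Matrix.diagonal_apply] using this

theorem blockTriangular_mul_diag {ι : Type*} [Fintype ι] {b : ι → ℕ} (hb : Function.Injective b)
    {M N : Matrix ι ι ℂ} (hM : M.BlockTriangular b) (hN : N.BlockTriangular b) (r : ι) :
    (M * N) r r = M r r * N r r := by
  rw [Matrix.mul_apply, Finset.sum_eq_single r]
  · intro k _ hk
    rcases lt_or_gt_of_ne (hb.ne hk) with h | h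
    · rw [hM h, zero_mul]
    · rw [hN h, mul_zero]
  · simp

section

variable [NeZero n] {P Q S : Matrix (Fin n) (Fin n) ℂ} {p q : PhaseSpace n}

theorem IsBorel.gaugeMatrix_row (h : IsBorel P Q S) (s : Idx n) (hs : s ≠ Sum.inl 0) :
    gaugeMatrix P Q S (Sum.inl 0) s = 0 := by
  rcases s with s | s
  · exact h.row s (fun h0 => hs (by rw [h0]))
  · rfl

theorem IsBorel.gaugeMatrix_col (h : IsBorel P Q S) (r : Idx n) (hr : r ≠ Sum.inl 0) :
    gaugeMatrix P Q S r (Sum.inl 0) = 0 :=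
  h.blockTriangular (by rw [borelOrder_inl_zero]; exact borelOrder_pos hr)

theorem IsBorel.isUnit_det_gaugeMatrix (h : IsBorel P Q S) :
    IsUnit (gaugeMatrix P Q S).det := by
  rw [gaugeMatrix, Matrix.det_fromBlocks_zero₁₂]
  exact h.detP.mul h.detQ

theorem IsBorel.gaugeMatrix_diag_ne_zero (h : IsBorel P Q S) (r : Idx n) :
    gaugeMatrix P Q S r r ≠ 0 := by
  rcases r with r | r
  · exact h.diagP_ne_zero r
  · exact h.diagQ_ne_zero r

theorem IsGauge.gaugeMatrix_mul_stripFirst (hB : IsBorel P Q S) (h : IsGauge P Q S p q)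
    (θt θ1 d : ℂ) : gaugeMatrix P Q S * stripFirst d (residueSum θt θ1 q)
      = stripFirst d (residueSum θt θ1 p) * gaugeMatrix P Q S :=
  stripFirst_intertwine d (h.gaugeMatrix_mul_residueSum θt θ1) hB.gaugeMatrix_row
    hB.gaugeMatrix_col

/-- Conjugation by a triangular matrix preserves both triangularity and the diagonal. -/
theorem IsGauge.inBorelFiber (hB : IsBorel P Q S) (h : IsGauge P Q S p q) {θt θ1 : ℂ} {κ : ℕ → ℂ}
    (hp : InBorelFiber θt θ1 κ p) : InBorelFiber θt θ1 κ q := by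
  rw [inBorelFiber_iff] at hp ⊢
  have hint := h.gaugeMatrix_mul_stripFirst hB θt θ1 (-κ 1)
  have hN := hB.blockTriangular
  have htri : (stripFirst (-κ 1) (residueSum θt θ1 q)).BlockTriangular borelOrder := by
    have := (gaugeMatrix P Q S).invertibleOfIsUnitDet hB.isUnit_det_gaugeMatrix
    have hq : stripFirst (-κ 1) (residueSum θt θ1 q)
        = (gaugeMatrix P Q S)⁻¹ * (stripFirst (-κ 1) (residueSum θt θ1 p) * gaugeMatrix P Q S) := by
      rw [← hint, Matrix.nonsing_inv_mul_cancel_left _ _ hB.isUnit_det_gaugeMatrix]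
    rw [hq]
    exact (Matrix.blockTriangular_inv_of_blockTriangular hN).mul (hp.1.mul hN)
  refine ⟨htri, fun r => ?_⟩
  have := congrFun (congrFun hint r) r
  rw [blockTriangular_mul_diag borelOrder_injective hN htri,
    blockTriangular_mul_diag borelOrder_injective hp.1 hN, hp.2, mul_comm] at this
  exact mul_right_cancel₀ (hB.gaugeMatrix_diag_ne_zero r) this

/-! ### Invariance of the Hamiltonian -/

/-- As `Ã_0` has a single nonzero row, the second trace reduces to corner entries of matrices
covariant under gauge. A gauge that decouples the first index leaves corner entries unchanged. -/
theorem hamiltonianK_eq (θt θ1 θ0 t : ℂ) (p : PhaseSpace n) :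
    hamiltonianK θt θ1 θ0 t p =
      (residue θt (p.1 Pole.t) (p.2 Pole.t) * residue θ1 (p.1 Pole.one) (p.2 Pole.one)).trace
          / (t - 1) +
        ((θ0 + residueSum θt θ1 p (Sum.inl 0) (Sum.inl 0)) *
            residue θt (p.1 Pole.t) (p.2 Pole.t) (Sum.inl 0) (Sum.inl 0) -
          (residueSum θt θ1 p * residue θt (p.1 Pole.t) (p.2 Pole.t)) (Sum.inl 0) (Sum.inl 0)) / t := by
  rw [hamiltonianK]
  congr 2
  generalize residue θt (p.1 Pole.t) (p.2 Pole.t) = A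
  rw [Matrix.trace_mul_comm, Matrix.trace, Finset.sum_eq_single (Sum.inl 0)]
  · rw [Matrix.diag_apply, Matrix.mul_apply, Matrix.mul_apply, eq_sub_iff_add_eq,
      ← Finset.sum_add_distrib, Finset.sum_eq_single (Sum.inl 0)]
    · simp only [residueZeroOf, residueZero, if_true]
      ring
    · intro s _ hs
      simp only [residueZeroOf, residueZero, if_true, if_neg hs]
      ring
    · simp
  · intro r _ hr
    rw [Matrix.diag_apply, Matrix.mul_apply]
    refine Finset.sum_eq_zero fun s _ => ?_
    rw [residueZeroOf, residueZero, if_neg hr, zero_mul]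
  · simp

theorem IsBorel.apply_zero_of_intertwine (hB : IsBorel P Q S) {M M' : Matrix (Idx n) (Idx n) ℂ}
    (h : gaugeMatrix P Q S * M' = M * gaugeMatrix P Q S) :
    M' (Sum.inl 0) (Sum.inl 0) = M (Sum.inl 0) (Sum.inl 0) := by
  have := congrFun (congrFun h (Sum.inl 0)) (Sum.inl 0)
  rw [Matrix.mul_apply, Matrix.mul_apply, Finset.sum_eq_single (Sum.inl 0)
      (fun k _ hk => by rw [hB.gaugeMatrix_row k hk, zero_mul]) (by simp),
    Finset.sum_eq_single (Sum.inl 0)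
      (fun k _ hk => by rw [hB.gaugeMatrix_col k hk, mul_zero]) (by simp), mul_comm] at this
  exact mul_right_cancel₀ (hB.gaugeMatrix_diag_ne_zero _) this

theorem IsGauge.hamiltonianK_eq (hB : IsBorel P Q S) (h : IsGauge P Q S p q) (θt θ1 θ0 t : ℂ) :
    hamiltonianK θt θ1 θ0 t q = hamiltonianK θt θ1 θ0 t p := by
  have ht := h.gaugeMatrix_mul_residue θt Pole.t
  have h1 := h.gaugeMatrix_mul_residue θ1 Pole.one
  have hs := h.gaugeMatrix_mul_residueSum θt θ1
  have hmul {M M' L L' : Matrix (Idx n) (Idx n) ℂ}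
      (hM : gaugeMatrix P Q S * M' = M * gaugeMatrix P Q S)
      (hL : gaugeMatrix P Q S * L' = L * gaugeMatrix P Q S) :
      gaugeMatrix P Q S * (M' * L') = M * L * gaugeMatrix P Q S := by
    rw [← Matrix.mul_assoc, hM, Matrix.mul_assoc, hL, Matrix.mul_assoc]
  have htr := hmul ht h1
  rw [Schlesinger.hamiltonianK_eq, Schlesinger.hamiltonianK_eq, hB.apply_zero_of_intertwine ht,
    hB.apply_zero_of_intertwine hs, hB.apply_zero_of_intertwine (hmul hs ht)]
  congr 2
  have hdet := hB.isUnit_det_gaugeMatrix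
  rw [← Matrix.nonsing_inv_mul_cancel_left (gaugeMatrix P Q S)
    (residue θt (q.1 Pole.t) (q.2 Pole.t) * _) hdet, htr, Matrix.trace_mul_comm,
    Matrix.mul_nonsing_inv_cancel_right _ _ hdet]

end

end Schlesinger

namespace Schlesinger

variable {n : ℕ}

/-! ### Normal forms under the Borel gauge group -/

/-- The factorization of a matrix with nonvanishing trailing principal minors. -/
theorem exists_upper_mul_eq_lower {C : Matrix (Fin n) (Fin n) ℂ}
    (h1 : ∀ i, headMinor C i i i ≠ 0) (h2 : ∀ i, tailMinor C i ≠ 0) :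
    ∃ W L : Matrix (Fin n) (Fin n) ℂ, (∀ i j, j < i → W i j = 0) ∧ (∀ i, W i i = 1) ∧
      (∀ i j, i < j → L i j = 0) ∧ (∀ i, L i i ≠ 0) ∧ W * C = L := by
  -- Row `i` of `W` is the replaced-column minor as a linear form. Applied to column `k > i` of `C`
  -- it gives a minor with a repeated column, so `W * C` is lower triangular.
  refine ⟨Matrix.of fun i r => colMinor C i (Pi.single r 1) / tailMinor C i,
    Matrix.of fun i k => headMinor C i i k / tailMinor C i, fun i j hij => ?_, fun i => ?_, fun i j hij => ?_,
    fun i => div_ne_zero (h1 i) (h2 i), ?_⟩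
  · rw [Matrix.of_apply, colMinor_eq_zero, zero_div]
    intro r hr
    rw [Pi.single_eq_of_ne (lt_of_lt_of_le hij hr).ne']
  · rw [Matrix.of_apply, colMinor_of_zero_above, Pi.single_eq_same, one_mul, div_self (h2 i)]
    intro r hr
    rw [Pi.single_eq_of_ne hr.ne']
  · rw [Matrix.of_apply, headMinor_eq_zero_of_lt C hij, zero_div]
  · ext i k
    rw [Matrix.mul_apply, Matrix.of_apply, ← colMinor_col, colMinor_eq_sum, Finset.sum_div]
    refine Finset.sum_congr rfl fun r _ => ?_
    rw [Matrix.of_apply]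
    ring

section

variable [NeZero n]

/-- First row `u`, the other rows those of the scalar matrix `c`. -/
def rowScalar (c : ℂ) (u : Fin n → ℂ) : Matrix (Fin n) (Fin n) ℂ :=
  fun i j => if i = 0 then u j else if i = j then c else 0

/-- First column `b`, the other columns zero. -/
def firstCol (b : Fin n → ℂ) : Matrix (Fin n) (Fin n) ℂ :=
  fun i j => if j = 0 then b i else 0

/-- The point with `C_t = [u; 0 1]`, `C_1 = [w; 0 -1]`, `B_t = [b 0]`, `B_t - B_1 = D`. -/
def normalPoint (u w b : Fin n → ℂ) (D : Matrix (Fin n) (Fin n) ℂ) : PhaseSpace n :=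
  (fun ξ => match ξ with
    | Pole.t => firstCol b
    | Pole.one => firstCol b - D,
   fun ξ => match ξ with
    | Pole.t => rowScalar 1 u
    | Pole.one => rowScalar (-1) w)

theorem eq_normalPoint {q : PhaseSpace n} {u w b : Fin n → ℂ}
    (h1 : q.1 Pole.t = firstCol b) (h2 : q.2 Pole.t = rowScalar 1 u)
    (h3 : q.2 Pole.one = rowScalar (-1) w) :
    q = normalPoint u w b (q.1 Pole.t - q.1 Pole.one) := by
  refine Prod.ext (funext fun ξ => ?_) (funext fun ξ => ?_) <;> cases ξ
  · exact h1
  · simp [normalPoint, h1]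
  · exact h2
  · exact h3

theorem ne_zero_of_lt {i j : Fin n} (h : i < j) : j ≠ 0 :=
  (lt_of_le_of_lt (Fin.zero_le i) h).ne'

theorem tailMinor_rowScalar (c : ℂ) (u : Fin n → ℂ) (i : Fin n) :
    tailMinor (rowScalar c u) i = c ^ (n - (i + 1 : ℕ)) := by
  have : (rowScalar c u).submatrix (tail i) (tail i) = Matrix.scalar _ c := by
    ext a b
    have ha := ne_zero_of_lt (lt_tail i a)
    simp only [Matrix.submatrix_apply, rowScalar, ha, if_false, Matrix.scalar_apply,
      Matrix.diagonal_apply, (tail_strictMono i).injective.eq_iff]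
  rw [tailMinor, this]
  simp

theorem headMinor_rowScalar_zero (c : ℂ) (u : Fin n → ℂ) (i : Fin n) :
    headMinor (rowScalar c u) i 0 i = u i * c ^ (n - (i + 1 : ℕ)) := by
  rw [← tailMinor_rowScalar c u, ← headMinor_transpose, headMinor,
    det_of_first_row (k := n - (i + 1)) (by omega)]
  · rw [Matrix.submatrix_apply, headTail_zero, headTail_zero, ← tailMinor_transpose, tailMinor]
    congr 2
    ext a b
    simp only [Matrix.submatrix_apply, headTail_succ]
  · intro c hc
    have h0 : headTail 0 i c ≠ i := by
      rw [headTail_of_ne_zero _ _ hc]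
      intro h
      have := congrArg Fin.val h
      simp only at this
      omega
    have h1 : headTail 0 i c ≠ 0 := by
      rw [headTail_of_ne_zero _ _ hc]
      intro h
      have := congrArg Fin.val h
      simp only [Fin.val_zero] at this
      omega
    rw [Matrix.submatrix_apply, Matrix.transpose_apply, headTail_zero, rowScalar, if_neg h1,
      if_neg h0]

theorem headMinor_rowScalar_self (u : Fin n → ℂ) {i : Fin n} (hi : i ≠ 0) (k : Fin n) :
    headMinor (rowScalar 1 u) i i k = if i = k then 1 else 0 := by
  have hne (a) : headTail i i a ≠ 0 :=
    ne_zero_of_lt (lt_of_lt_of_le (fin_pos_of_ne_zero hi) (le_headTail_self i a))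
  rw [← colMinor_col]
  split_ifs with h
  · subst h
    rw [colMinor_of_zero_above, tailMinor_rowScalar]
    · simp [rowScalar, hi]
    · intro r hr
      simp [rowScalar, ne_zero_of_lt hr, hr.ne']
  · rcases lt_or_gt_of_ne h with h | h
    · rw [colMinor_col, headMinor_eq_zero_of_lt _ h]
    · refine colMinor_eq_zero _ fun r hr => ?_
      simp [rowScalar, ne_zero_of_lt (h.trans_le hr), (h.trans_le hr).ne']

theorem nondegenerate_normalPoint_iff {u w b : Fin n → ℂ} {D : Matrix (Fin n) (Fin n) ℂ} :
    Nondegenerate (normalPoint u w b D) ↔ u 0 ≠ 0 ∧ ∀ i, w i ≠ 0 := by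
  have h1 (i : Fin n) : headMinor ((normalPoint u w b D).2 Pole.one) i 0 i ≠ 0 ↔ w i ≠ 0 := by
    rw [normalPoint]
    dsimp only
    rw [headMinor_rowScalar_zero]
    simp
  constructor
  · intro h
    refine ⟨?_, fun i => (h1 i).mp (h i).1⟩
    have := (h 0).2.1
    rw [normalPoint] at this
    dsimp only at this
    rw [headMinor_rowScalar_zero] at this
    exact left_ne_zero_of_mul this
  · rintro ⟨hu, hw⟩ i
    refine ⟨(h1 i).mpr (hw i), ?_, ?_⟩
    · rcases eq_or_ne i 0 with rfl | hi
      · rw [normalPoint]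
        dsimp only
        rw [headMinor_rowScalar_zero]
        simpa using hu
      · rw [normalPoint]
        dsimp only
        rw [headMinor_rowScalar_self _ hi, if_pos rfl]
        exact one_ne_zero
    · rw [normalPoint]
      dsimp only
      rw [tailMinor_rowScalar, one_pow]
      exact one_ne_zero

theorem neg_one_pow_mul_self (k : ℕ) : (-1 : ℂ) ^ k * (-1) ^ k = 1 := by
  rw [← mul_pow]
  simp

theorem lam_normalPoint (t : ℂ) (u w b : Fin n → ℂ) (D : Matrix (Fin n) (Fin n) ℂ)
    (i : Fin n) : lam t i (normalPoint u w b D) = -(t * u i / w i) := by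
  rw [lam, normalPoint]
  dsimp only
  rw [headMinor_rowScalar_zero, headMinor_rowScalar_zero, pow_succ]
  have h := neg_one_pow_mul_self (n - (i + 1 : ℕ))
  have h0 : (-1 : ℂ) ^ (n - (i + 1 : ℕ)) ≠ 0 := left_ne_zero_of_mul_eq_one h
  rw [one_pow, mul_one]
  field_simp

theorem mu_normalPoint (t : ℂ) {u w b : Fin n → ℂ} {D : Matrix (Fin n) (Fin n) ℂ}
    (hp : Nondegenerate (normalPoint u w b D)) (i : Fin n) :
    mu t i (normalPoint u w b D) = t⁻¹ * w i * b i := by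
  have h := neg_one_pow_mul_self (n - (i + 1 : ℕ))
  rcases eq_or_ne i 0 with rfl | hi
  · rw [mu_zero_eq t (hp 0).2.1, normalPoint]
    dsimp only
    rw [headMinor_rowScalar_zero, tailMinor_rowScalar, one_pow, div_one, firstCol, if_pos rfl]
    linear_combination (t⁻¹ * w 0 * b 0) * h
  · rw [mu, normalPoint]
    dsimp only
    rw [headMinor_rowScalar_zero, tailMinor_rowScalar, one_pow, div_one,
      Finset.sum_eq_single i]
    · rw [headMinor_rowScalar_self _ hi, if_pos rfl, div_one, one_mul, firstCol, if_pos rfl]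
      linear_combination (t⁻¹ * w i * b i) * h
    · intro k _ hk
      rw [headMinor_rowScalar_self _ hi, if_neg hk.symm]
      simp
    · simp

theorem InBorelFiber.c_eq_neg {θt θ1 : ℂ} {κ : ℕ → ℂ} {p : PhaseSpace n}
    (h : InBorelFiber θt θ1 κ p) {i : Fin n} (hi : i ≠ 0) (j : Fin n) :
    p.2 Pole.one i j = -p.2 Pole.t i j := by
  have := h (Sum.inl i) (Sum.inr j) (fun h => hi (Sum.inl.inj h)) (by simp)
    (borelOrder_inr_lt_inl hi j).le
  rw [if_neg (by simp), residueSum, residue_eq_fromBlocks, residue_eq_fromBlocks, Matrix.add_apply,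
    Matrix.fromBlocks_apply₁₂, Matrix.fromBlocks_apply₁₂] at this
  linear_combination this

/-- Gaussian elimination on `C_t` uses up `P` and `Q`, and `S` clears `B_t` outside its first
column. The lower rows of `C_1` then follow from the fibre equations. -/
theorem exists_borelEquiv_normalPoint_aux {θt θ1 : ℂ} {κ : ℕ → ℂ} {p : PhaseSpace n}
    (hp : InBorelFiber θt θ1 κ p) (hn : Nondegenerate p) :
    ∃ u w b D, BorelEquiv p (normalPoint u w b D) := by
  obtain ⟨W, L, hW, hW1, hL, hL1, hWL⟩ :=
    exists_upper_mul_eq_lower (fun i => (hn i).2.1) (fun i => (hn i).2.2)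
  -- The Borel group requires a diagonal first row, so that row of `W` is discarded; this is why the
  -- first row of `C_t` survives in the normal form.
  set R : Matrix (Fin n) (Fin n) ℂ :=
    Matrix.of fun i j => if i = 0 then (if j = 0 then 1 else 0) else W i j with hR
  have hRu : R.BlockTriangular id := by
    intro i j hij
    have hi : i ≠ 0 := ne_zero_of_lt hij
    simp only [hR, Matrix.of_apply, hi, if_false]
    exact hW i j hij
  have hRdet : IsUnit R.det := by
    rw [Matrix.det_of_isUpperTriangular hRu, isUnit_iff_ne_zero, Finset.prod_ne_zero_iff]
    intro i _
    rcases eq_or_ne i 0 with rfl | hi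
    · simp [hR]
    · simp [hR, hi, hW1]
  have hLdet : IsUnit L.det := by
    rw [Matrix.det_of_isLowerTriangular L (fun i j hij => hL i j hij), isUnit_iff_ne_zero,
      Finset.prod_ne_zero_iff]
    exact fun i _ => hL1 i
  have hB0 : IsBorel R L 0 :=
    ⟨hRdet, hLdet, fun i j hij => hRu hij, fun j hj => by simp [hR, hj], hL, fun _ => rfl⟩
  have hB1 := hB0.inv
  -- `S` cancels all columns of `B_t P` except the first, which its own zero first column cannot
  -- reach.
  have hB : IsBorel R⁻¹ L⁻¹ (p.1 Pole.t * R⁻¹ - firstCol fun i => (p.1 Pole.t * R⁻¹) i 0) :=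
    ⟨hB1.detP, hB1.detQ, hB1.upper, hB1.row, hB1.lower, fun i => by simp [firstCol]⟩
  have hG := isGauge_gaugeAct hB p
  set q := gaugeAct R⁻¹ L⁻¹ (p.1 Pole.t * R⁻¹ - firstCol fun i => (p.1 Pole.t * R⁻¹) i 0) p
  have hq := hG.inBorelFiber hB hp
  have hqt : q.2 Pole.t = R * p.2 Pole.t * L⁻¹ := by
    rw [Matrix.mul_assoc, ← hG.c, Matrix.mul_nonsing_inv_cancel_left _ _ hRdet]
  have hc : q.2 Pole.t = rowScalar 1 (q.2 Pole.t 0) := by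
    ext i j
    rw [rowScalar]
    split_ifs with h1 h2
    · rw [h1]
    all_goals
      have hrow : (R * p.2 Pole.t) i = L i := by
        rw [← hWL]
        ext k
        simp [Matrix.mul_apply, hR, h1]
      have : q.2 Pole.t i j = (L * L⁻¹) i j := by
        rw [hqt, Matrix.mul_apply, Matrix.mul_apply]
        exact Finset.sum_congr rfl fun k _ => by rw [congrFun hrow k]
      rw [this, Matrix.mul_nonsing_inv _ hLdet, Matrix.one_apply]
      simp [h2]
  have hb : q.1 Pole.t = firstCol (fun i => q.1 Pole.t i 0) := by
    have h1 := hG.b Pole.t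
    rw [sub_sub_cancel] at h1
    have h2 : q.1 Pole.t = L * firstCol fun i => (p.1 Pole.t * R⁻¹) i 0 := by
      rw [← h1, Matrix.mul_nonsing_inv_cancel_left _ _ hLdet]
    ext i j
    rw [firstCol]
    split_ifs with hj
    · rw [hj]
    · rw [h2, Matrix.mul_apply]
      simp [firstCol, hj]
  have hc1 : q.2 Pole.one = rowScalar (-1) (q.2 Pole.one 0) := by
    ext i j
    by_cases hi : i = 0
    · simp [rowScalar, hi]
    · rw [hq.c_eq_neg hi, hc]
      simp only [rowScalar, if_neg hi]
      split_ifs <;> simp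
  have hG' := hG
  rw [eq_normalPoint hb hc hc1] at hG'
  exact ⟨_, _, _, _, R⁻¹, L⁻¹, _, hB, hG'⟩

theorem borelEquiv_normalPoint_one {u w b : Fin n → ℂ} {D : Matrix (Fin n) (Fin n) ℂ}
    (hw : ∀ i, w i ≠ 0) :
    ∃ u' b' D', BorelEquiv (normalPoint u w b D) (normalPoint u' (fun _ => 1) b' D') := by
  -- To keep the lower rows of `C_ξ` scalar, the diagonal matrices `P` and `Q` must agree away from
  -- index `0`; `Q = diag(w⁻¹)` normalizes the first row of `C_1` to ones.
  set e : Fin n → ℂ := fun i => if i = 0 then 1 else (w i)⁻¹ with he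
  have he0 (i : Fin n) : e i ≠ 0 := by
    simp only [he]
    split_ifs
    · exact one_ne_zero
    · exact inv_ne_zero (hw i)
  have hQ0 (i : Fin n) : (w i)⁻¹ ≠ 0 := inv_ne_zero (hw i)
  have hB : IsBorel (Matrix.diagonal e) (Matrix.diagonal fun i => (w i)⁻¹) 0 := by
    refine ⟨?_, ?_, fun i j h => Matrix.diagonal_apply_ne _ h.ne',
      fun j h => Matrix.diagonal_apply_ne _ h.symm, fun i j h => Matrix.diagonal_apply_ne _ h.ne,
      fun _ => rfl⟩
    · rw [Matrix.det_diagonal, isUnit_iff_ne_zero, Finset.prod_ne_zero_iff]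
      exact fun i _ => he0 i
    · rw [Matrix.det_diagonal, isUnit_iff_ne_zero, Finset.prod_ne_zero_iff]
      exact fun i _ => hQ0 i
  have hscal (c : ℂ) (v : Fin n → ℂ) : Matrix.diagonal e * rowScalar c (fun j => v j * (w j)⁻¹)
      = rowScalar c v * Matrix.diagonal fun i => (w i)⁻¹ := by
    ext i j
    rw [Matrix.diagonal_mul, Matrix.mul_diagonal]
    simp only [rowScalar, he]
    split_ifs with h1 h2
    · rw [one_mul]
    · rw [h2, mul_comm]
    · simp
  have hcol : Matrix.diagonal (fun i => (w i)⁻¹) * firstCol (fun i => w i * b i)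
      = firstCol b * Matrix.diagonal e := by
    ext i j
    rw [Matrix.diagonal_mul, Matrix.mul_diagonal]
    simp only [firstCol, he]
    split_ifs
    · rw [mul_one, inv_mul_cancel_left₀ (hw i)]
    · simp
  have hD : Matrix.diagonal (fun i => (w i)⁻¹) * (Matrix.diagonal w * D * Matrix.diagonal e)
      = D * Matrix.diagonal e := by
    rw [← Matrix.mul_assoc, ← Matrix.mul_assoc, Matrix.diagonal_mul_diagonal]
    simp [hw]
  refine ⟨fun j => u j * (w j)⁻¹, fun i => w i * b i, Matrix.diagonal w * D * Matrix.diagonal e,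
    _, _, _, hB, ⟨fun ξ => ?_, fun ξ => ?_⟩⟩
  · cases ξ
    · exact hscal 1 u
    · have := hscal (-1) w
      simp only [mul_inv_cancel₀ (hw _)] at this
      exact this
  · cases ξ
    · simp only [normalPoint, sub_zero]
      exact hcol
    · simp only [normalPoint, sub_zero]
      rw [Matrix.mul_sub, hcol, hD, Matrix.sub_mul]

end

end Schlesinger

/-! ### The equations of the Borel fibre on the normal form, and the slice by `λ`, `μ`. -/

namespace Schlesinger

variable {n : ℕ}

theorem residueSum_inl_inl (θt θ1 : ℂ) (p : PhaseSpace n) (i j : Fin n) :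
    residueSum θt θ1 p (Sum.inl i) (Sum.inl j) = (if i = j then θt + θ1 else 0) -
      ((p.2 Pole.t * p.1 Pole.t) i j + (p.2 Pole.one * p.1 Pole.one) i j) := by
  rw [residueSum, residue_eq_fromBlocks, residue_eq_fromBlocks, Matrix.add_apply,
    Matrix.fromBlocks_apply₁₁, Matrix.fromBlocks_apply₁₁, Matrix.sub_apply, Matrix.sub_apply,
    Matrix.smul_apply, Matrix.smul_apply, Matrix.one_apply, smul_eq_mul, smul_eq_mul]
  split_ifs <;> ring

theorem residueSum_inl_inr (θt θ1 : ℂ) (p : PhaseSpace n) (i j : Fin n) :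
    residueSum θt θ1 p (Sum.inl i) (Sum.inr j) = p.2 Pole.t i j + p.2 Pole.one i j := by
  rw [residueSum, residue_eq_fromBlocks, residue_eq_fromBlocks, Matrix.add_apply,
    Matrix.fromBlocks_apply₁₂, Matrix.fromBlocks_apply₁₂]

theorem residueSum_inr_inr (θt θ1 : ℂ) (p : PhaseSpace n) (i j : Fin n) :
    residueSum θt θ1 p (Sum.inr i) (Sum.inr j) =
      (p.1 Pole.t * p.2 Pole.t) i j + (p.1 Pole.one * p.2 Pole.one) i j := by
  rw [residueSum, residue_eq_fromBlocks, residue_eq_fromBlocks, Matrix.add_apply,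
    Matrix.fromBlocks_apply₂₂, Matrix.fromBlocks_apply₂₂]

section

variable [NeZero n]

/-- The diagonal entries of `C_t (B_t - B_1)` in the normal form. -/
def dPar (θ : ℂ) (κ : ℕ → ℂ) (i : Fin n) : ℂ := if i = 0 then 0 else θ + κ (i + 1)

/-- The parameters `α_{2i}` in terms of the exponents. -/
def aPar (θ : ℂ) (κ : ℕ → ℂ) (i : Fin n) : ℂ := -dPar θ κ i - κ (n + i + 1)

/-- The difference `B_t - B_1` in the normal form. -/
def diffMatrix (θ : ℂ) (κ : ℕ → ℂ) (u b : Fin n → ℂ) : Matrix (Fin n) (Fin n) ℂ :=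
  fun i j => if j = 0 then b i * (1 + u i) - aPar θ κ i else
    if i < j then b i * (u i - u j) - aPar θ κ i else if i = j then dPar θ κ j else 0

/-- The equations of the Borel fibre, block by block. -/
theorem inBorelFiber_iff_blocks {θt θ1 : ℂ} {κ : ℕ → ℂ} {p : PhaseSpace n} :
    InBorelFiber θt θ1 κ p ↔
      (∀ i j : Fin n, i ≠ 0 → j ≠ 0 → j ≤ i →
        (p.2 Pole.t * p.1 Pole.t) i j + (p.2 Pole.one * p.1 Pole.one) i j
          = if i = j then θt + θ1 + κ (i + 1) else 0) ∧
      (∀ i j : Fin n, i ≠ 0 → p.2 Pole.t i j + p.2 Pole.one i j = 0) ∧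
      (∀ i j : Fin n, i ≤ j →
        (p.1 Pole.t * p.2 Pole.t) i j + (p.1 Pole.one * p.2 Pole.one) i j
          = if i = j then -κ (n + i + 1) else 0) := by
  constructor
  · intro h
    refine ⟨fun i j hi hj hij => ?_, fun i j hi => ?_, fun i j hij => ?_⟩
    · have := h (Sum.inl i) (Sum.inl j) (fun h => hi (Sum.inl.inj h)) (fun h => hj (Sum.inl.inj h))
        (by rw [borelOrder_inl hi, borelOrder_inl hj]; have := Fin.le_def.mp hij; omega)
      rw [residueSum_inl_inl] at this
      simp only [Sum.inl.injEq, Idx.num, Sum.elim_inl] at this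
      split_ifs at this ⊢
      · linear_combination -this
      · linear_combination -this
    · have := h (Sum.inl i) (Sum.inr j) (fun h => hi (Sum.inl.inj h)) (by simp)
        (borelOrder_inr_lt_inl hi j).le
      rwa [residueSum_inl_inr, if_neg (by simp)] at this
    · have := h (Sum.inr i) (Sum.inr j) (by simp) (by simp)
        (by rw [borelOrder_inr, borelOrder_inr]; have := Fin.le_def.mp hij; omega)
      rw [residueSum_inr_inr] at this
      simpa only [Sum.inr.injEq, Idx.num, Sum.elim_inr] using this
  · rintro ⟨h1, h2, h3⟩ (i | i) (j | j) hr hs hrs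
    · have hi : i ≠ 0 := fun h => hr (by rw [h])
      have hj : j ≠ 0 := fun h => hs (by rw [h])
      rw [borelOrder_inl hi, borelOrder_inl hj] at hrs
      have := h1 i j hi hj (Fin.le_def.mpr (by omega))
      rw [residueSum_inl_inl, this]
      simp only [Sum.inl.injEq, Idx.num, Sum.elim_inl]
      split_ifs
      · ring
      · ring
    · have hi : i ≠ 0 := fun h => hr (by rw [h])
      rw [residueSum_inl_inr, if_neg (by simp), h2 i j hi]
    · have hj : j ≠ 0 := fun h => hs (by rw [h])
      exact absurd hrs (not_le.mpr (borelOrder_inr_lt_inl hj i))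
    · rw [borelOrder_inr, borelOrder_inr] at hrs
      rw [residueSum_inr_inr, h3 i j (Fin.le_def.mpr (by omega))]
      simp only [Sum.inr.injEq, Idx.num, Sum.elim_inr]

theorem rowScalar_mul_apply_ne (c : ℂ) (u : Fin n → ℂ) (M : Matrix (Fin n) (Fin n) ℂ) {i : Fin n}
    (hi : i ≠ 0) (j : Fin n) : (rowScalar c u * M) i j = c * M i j := by
  simp [Matrix.mul_apply, rowScalar, hi]

theorem rowScalar_mul_apply_zero (c : ℂ) (u : Fin n → ℂ) (M : Matrix (Fin n) (Fin n) ℂ)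
    (j : Fin n) : (rowScalar c u * M) 0 j = ∑ k, u k * M k j := by
  simp [Matrix.mul_apply, rowScalar]

theorem mul_rowScalar_apply (c : ℂ) (u : Fin n → ℂ) (M : Matrix (Fin n) (Fin n) ℂ) (i j : Fin n) :
    (M * rowScalar c u) i j = M i 0 * u j + if j = 0 then 0 else c * M i j := by
  have : ∀ k, M i k * rowScalar c u k j = (if k = 0 then M i 0 * u j else 0) +
      if k = j then (if j = 0 then 0 else c * M i j) else 0 := by
    intro k
    rw [rowScalar]
    split_ifs with h1 h2 h3 h3 h3 <;> simp_all [mul_comm]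
  rw [Matrix.mul_apply, Finset.sum_congr rfl fun k _ => this k, Finset.sum_add_distrib,
    Finset.sum_ite_eq', Finset.sum_ite_eq', if_pos (Finset.mem_univ _), if_pos (Finset.mem_univ _)]

theorem firstCol_mul_rowScalar_apply (c : ℂ) (u b : Fin n → ℂ) (i j : Fin n) :
    (firstCol b * rowScalar c u) i j = b i * u j := by
  rw [mul_rowScalar_apply]
  simp only [firstCol, if_true]
  split_ifs <;> simp

/-- For given `u`, `b` the equations are linear in `D` and determine it: the upper left block gives
the entries on and below the diagonal outside the first row and column, the diagonal of the lower
right block the first column, and its entries above the diagonal the rest. -/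
theorem inBorelFiber_normalPoint_iff {θt θ1 : ℂ} {κ : ℕ → ℂ} {u b : Fin n → ℂ}
    {D : Matrix (Fin n) (Fin n) ℂ} :
    InBorelFiber θt θ1 κ (normalPoint u (fun _ => 1) b D) ↔ D = diffMatrix (θt + θ1) κ u b := by
  have h1 (i j : Fin n) (hi : i ≠ 0) (hj : j ≠ 0) :
      (rowScalar 1 u * firstCol b) i j +
        (rowScalar (-1) (fun _ => 1) * (firstCol b - D) : Matrix (Fin n) (Fin n) ℂ) i j
        = D i j := by
    rw [rowScalar_mul_apply_ne _ _ _ hi, rowScalar_mul_apply_ne _ _ _ hi, Matrix.sub_apply,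
      firstCol, if_neg hj]
    ring
  have h2 (i j : Fin n) (hi : i ≠ 0) :
      rowScalar 1 u i j + rowScalar (-1) (fun _ => 1) i j = 0 := by
    rw [rowScalar, rowScalar, if_neg hi, if_neg hi]
    split_ifs <;> ring
  have h3 (i j : Fin n) :
      (firstCol b * rowScalar 1 u) i j +
        ((firstCol b - D) * rowScalar (-1) (fun _ => 1) : Matrix (Fin n) (Fin n) ℂ) i j
        = b i * (1 + u j) - D i 0 + if j = 0 then 0 else D i j := by
    rw [firstCol_mul_rowScalar_apply, Matrix.sub_mul, Matrix.sub_apply,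
      firstCol_mul_rowScalar_apply, mul_rowScalar_apply]
    split_ifs <;> ring
  rw [inBorelFiber_iff_blocks]
  simp only [normalPoint]
  constructor
  · rintro ⟨e1, -, e3⟩
    have hdiag (j : Fin n) (hj : j ≠ 0) : D j j = dPar (θt + θ1) κ j := by
      have := e1 j j hj hj le_rfl
      rw [dPar, if_neg hj]
      rwa [h1 j j hj hj, if_pos rfl] at this
    have hcol (i : Fin n) : D i 0 = b i * (1 + u i) - aPar (θt + θ1) κ i := by
      have := e3 i i le_rfl
      rw [h3, if_pos rfl] at this
      rcases eq_or_ne i 0 with rfl | hi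
      · rw [if_pos rfl] at this
        rw [aPar, dPar, if_pos rfl]
        linear_combination -this
      · rw [if_neg hi, hdiag i hi] at this
        rw [aPar]
        linear_combination -this
    ext i j
    rw [diffMatrix]
    split_ifs with hj hij hij'
    · rw [hj, hcol]
    · have := e3 i j hij.le
      rw [h3, if_neg hj, if_neg hij.ne, hcol] at this
      linear_combination this
    · rw [hij', hdiag j hj]
    · have hlt : j < i := lt_of_le_of_ne (not_lt.mp hij) (Ne.symm hij')
      have := e1 i j (ne_zero_of_lt hlt) hj hlt.le
      rwa [h1 i j (ne_zero_of_lt hlt) hj, if_neg hij'] at this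
  · intro hD
    have hcol (i : Fin n) : D i 0 = b i * (1 + u i) - aPar (θt + θ1) κ i := by
      rw [hD, diffMatrix, if_pos rfl]
    refine ⟨fun i j hi hj hij => ?_, fun i j hi => h2 i j hi, fun i j hij => ?_⟩
    · rw [h1 i j hi hj, hD, diffMatrix, if_neg hj, if_neg hij.not_gt]
      split_ifs with h
      · rw [dPar, if_neg hj, h]
      · rfl
    · rw [h3, hcol]
      rcases eq_or_ne j 0 with rfl | hj
      · obtain rfl : i = 0 := le_antisymm hij (Fin.zero_le i)
        simp only [if_true, aPar, dPar]
        ring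
      · rw [if_neg hj, hD, diffMatrix, if_neg hj]
        rcases hij.lt_or_eq with hlt | rfl
        · rw [if_pos hlt, if_neg hlt.ne]
          ring
        · rw [if_neg (lt_irrefl i), if_pos rfl, if_pos rfl, aPar]
          ring

/-- The normal form with prescribed values of `λ`, `μ`. -/
noncomputable def coordPoint (θ : ℂ) (κ : ℕ → ℂ) (t : ℂ) (l m : Fin n → ℂ) : PhaseSpace n :=
  normalPoint (fun i => -(l i / t)) (fun _ => 1) (fun i => t * m i)
    (diffMatrix θ κ (fun i => -(l i / t)) (fun i => t * m i))

theorem coordPoint_inBorelFiber (θt θ1 : ℂ) (κ : ℕ → ℂ) (t : ℂ) (l m : Fin n → ℂ) :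
    InBorelFiber θt θ1 κ (coordPoint (θt + θ1) κ t l m) :=
  inBorelFiber_normalPoint_iff.mpr rfl

theorem coordPoint_nondegenerate (θ : ℂ) (κ : ℕ → ℂ) {t : ℂ} (ht : t ≠ 0) {l : Fin n → ℂ}
    (hl : l 0 ≠ 0) (m : Fin n → ℂ) : Nondegenerate (coordPoint θ κ t l m) :=
  nondegenerate_normalPoint_iff.mpr ⟨neg_ne_zero.mpr (div_ne_zero hl ht), fun _ => one_ne_zero⟩

theorem lam_coordPoint (θ : ℂ) (κ : ℕ → ℂ) {t : ℂ} (ht : t ≠ 0) (l m : Fin n → ℂ) (i : Fin n) :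
    lam t i (coordPoint θ κ t l m) = l i := by
  rw [coordPoint, lam_normalPoint]
  field_simp

theorem mu_coordPoint (θ : ℂ) (κ : ℕ → ℂ) {t : ℂ} (ht : t ≠ 0) {l : Fin n → ℂ} (hl : l 0 ≠ 0)
    (m : Fin n → ℂ) (i : Fin n) : mu t i (coordPoint θ κ t l m) = m i := by
  rw [coordPoint, mu_normalPoint _ (coordPoint_nondegenerate θ κ ht hl m)]
  field_simp

/-- Up to sign and the factor `t`, the first `λ` is the quotient of the full determinants of `C_t`
and `C_1`, both nonzero by nondegeneracy. -/
theorem lam_zero_ne_zero {t : ℂ} (ht : t ≠ 0) {p : PhaseSpace n} (hn : Nondegenerate p) :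
    lam t 0 p ≠ 0 := by
  rw [lam]
  exact mul_ne_zero (mul_ne_zero (pow_ne_zero _ (by norm_num)) ht)
    (div_ne_zero (hn 0).2.1 (hn 0).1)

/-- A nondegenerate point of the Borel fibre is equivalent to the normal form with the same
values of `λ`, `μ`. -/
theorem borelEquiv_coordPoint {θt θ1 : ℂ} {κ : ℕ → ℂ} {t : ℂ} (ht : t ≠ 0) {p : PhaseSpace n}
    (hp : InBorelFiber θt θ1 κ p) (hn : Nondegenerate p) :
    BorelEquiv p (coordPoint (θt + θ1) κ t (fun i => lam t i p) fun i => mu t i p) := by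
  obtain ⟨u, w, b, D, h1⟩ := exists_borelEquiv_normalPoint_aux hp hn
  have hw : ∀ i, w i ≠ 0 := by
    obtain ⟨P, Q, S, hB, hG⟩ := h1
    exact (nondegenerate_normalPoint_iff.mp (hG.nondegenerate hB hn)).2
  obtain ⟨u', b', D', h2⟩ := borelEquiv_normalPoint_one (u := u) (b := b) (D := D) hw
  have h := h1.trans h2
  obtain ⟨P, Q, S, hB, hG⟩ := h
  have hD := inBorelFiber_normalPoint_iff.mp (hG.inBorelFiber hB hp)
  have hu : u' = fun i => -(lam t i p / t) := by
    ext i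
    rw [← hG.lam_eq hB, lam_normalPoint]
    field_simp
  have hb : b' = fun i => t * mu t i p := by
    ext i
    rw [← hG.mu_eq hB hn, mu_normalPoint _ (hG.nondegenerate hB hn)]
    field_simp
  rw [hD, hu, hb] at hG
  exact ⟨P, Q, S, hB, hG⟩

end

end Schlesinger

namespace Sasano

variable {n : ℕ} {θt θ1 : ℂ} {κ α : ℕ → ℂ}

/-! ### The parameters of the Sasano system -/

theorem sum_Icc_two_mul (f : ℕ → ℂ) {m : ℕ} (hm : 1 ≤ m) :
    ∑ j ∈ Finset.Icc 2 (2 * m), f j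
      = ∑ k ∈ Finset.Ico 1 (m + 1), f (2 * k) + ∑ k ∈ Finset.Ico 1 m, f (2 * k + 1) := by
  induction m, hm using Nat.le_induction with
  | base => simp
  | succ m hm ih =>
    rw [show 2 * (m + 1) = 2 * m + 1 + 1 by ring, Finset.sum_Icc_succ_top (by omega),
      Finset.sum_Icc_succ_top (by omega), ih, Finset.sum_Ico_succ_top (b := m + 1) (by omega),
      Finset.sum_Ico_succ_top (f := fun k => f (2 * k + 1)) (by omega)]
    rw [show 2 * (m + 1) = 2 * m + 1 + 1 by ring]
    ring

namespace ParameterIdentification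

/-- `α_{2k} + α_{2k+1}` equals `κ_{k+1} - κ_k` for `k ≥ 2`, so the sum telescopes; the exceptional
`α_2` turns the `k = 1` term into `θ_t + θ_1 + κ_2`. -/
theorem sum_odd (hα : ParameterIdentification n θt θ1 κ α) {i : ℕ} (hi : 1 ≤ i) (hin : i ≤ n) :
    ∑ k ∈ Finset.Ico 1 i, α (2 * k + 1)
      = (if i = 1 then 0 else θt + θ1 + κ i) - ∑ k ∈ Finset.Ico 1 i, α (2 * k) := by
  induction i, hi using Nat.le_induction with
  | base => simp
  | succ i hi ih =>
    rw [Finset.sum_Ico_succ_top hi, Finset.sum_Ico_succ_top hi, ih (by omega)]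
    have h1 := hα.alpha_odd (i + 1) (Finset.mem_Icc.mpr ⟨by omega, hin⟩)
    rw [show 2 * (i + 1) - 1 = 2 * i + 1 by omega, show n + (i + 1) - 1 = n + i by omega] at h1
    rw [h1, if_neg (show i + 1 ≠ 1 by omega)]
    split_ifs with h
    · subst h
      rw [mul_one, hα.alpha_two]
      ring
    · rw [hα.alpha_even i (Finset.mem_Icc.mpr ⟨by omega, by omega⟩)]
      ring

variable [NeZero n]

theorem alpha_eq_aPar (hα : ParameterIdentification n θt θ1 κ α) (i : Fin n) :
    α (2 * (i + 1)) = Schlesinger.aPar (θt + θ1) κ i := by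
  rw [Schlesinger.aPar, Schlesinger.dPar]
  split_ifs with h
  · subst h
    simp [hα.alpha_two]
  · have h0 := Fin.val_ne_of_ne h
    simp only [Fin.val_zero] at h0
    rw [hα.alpha_even _ (Finset.mem_Icc.mpr ⟨by omega, by omega⟩)]
    rw [show n + (i + 1 : ℕ) = n + i + 1 by ring]
    ring

theorem sum_odd_top (hα : ParameterIdentification n θt θ1 κ α) :
    ∑ k ∈ Finset.Ico 1 n, α (2 * k + 1)
      = -κ (2 * n) - ∑ k ∈ Finset.Ico 1 (n + 1), α (2 * k) := by
  have hn : 1 ≤ n := NeZero.one_le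
  rw [hα.sum_odd hn le_rfl, Finset.sum_Ico_succ_top hn]
  split_ifs with h
  · have := hα.alpha_two
    subst h
    rw [this]
    ring_nf
  · rw [hα.alpha_even n (Finset.mem_Icc.mpr ⟨by omega, le_rfl⟩), ← two_mul]
    ring

theorem alpha_zero (hα : ParameterIdentification n θt θ1 κ α) : α 0 = -θ1 := by
  have h := hα.normalization
  rw [← Finset.mul_sum, sum_Icc_two_mul α NeZero.one_le, hα.sum_odd_top, hα.alpha_one,
    hα.alpha_penultimate, hα.alpha_last] at h
  linear_combination h

theorem sum_Ico_one (hα : ParameterIdentification n θt θ1 κ α) (i : Fin n) :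
    ∑ k ∈ Finset.Ico 1 (i + 1 : ℕ), α (2 * k)
      = ∑ k ∈ Finset.Iio i, Schlesinger.aPar (θt + θ1) κ k := by
  have h : ∑ k ∈ Finset.Iio i, Schlesinger.aPar (θt + θ1) κ k
      = ∑ k ∈ (Finset.Iio i).map Fin.valEmbedding, α (2 * (k + 1)) := by
    rw [Finset.sum_map]
    exact Finset.sum_congr rfl fun k _ => (hα.alpha_eq_aPar k).symm
  rw [h, Fin.map_valEmbedding_Iio, Finset.sum_Ico_eq_sum_range]
  refine Finset.sum_congr (by ext; simp) fun k _ => ?_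
  rw [add_comm 1 k]

theorem sum_Icc_top (hα : ParameterIdentification n θt θ1 κ α) (i : Fin n) :
    ∑ k ∈ Finset.Icc (i + 1 + 1 : ℕ) n, α (2 * k)
      = ∑ k ∈ Finset.Ioi i, Schlesinger.aPar (θt + θ1) κ k := by
  have h : ∑ k ∈ Finset.Ioi i, Schlesinger.aPar (θt + θ1) κ k
      = ∑ k ∈ (Finset.Ioi i).map Fin.valEmbedding, α (2 * (k + 1)) := by
    rw [Finset.sum_map]
    exact Finset.sum_congr rfl fun k _ => (hα.alpha_eq_aPar k).symm
  rw [h, Fin.map_valEmbedding_Ioi]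
  refine (Finset.sum_bij (fun k _ => k + 1) ?_ ?_ ?_ ?_).symm
  · intro k hk
    simp only [Finset.mem_Ioo, Finset.mem_Icc] at hk ⊢
    omega
  · intro a _ b _ hab
    omega
  · intro k hk
    simp only [Finset.mem_Icc] at hk
    exact ⟨k - 1, by simp only [Finset.mem_Ioo]; omega, by omega⟩
  · intro k _
    rfl

theorem sum_odd_eq (hα : ParameterIdentification n θt θ1 κ α) (i : Fin n) :
    ∑ k ∈ Finset.Ico 1 (i + 1 : ℕ), α (2 * k + 1)
      = Schlesinger.dPar (θt + θ1) κ i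
        - ∑ k ∈ Finset.Iio i, Schlesinger.aPar (θt + θ1) κ k := by
  rw [hα.sum_odd (by omega) (by omega), hα.sum_Ico_one, Schlesinger.dPar]
  congr 1
  have : ((i : ℕ) + 1 = 1) ↔ i = 0 := by
    rw [Fin.ext_iff, Fin.val_zero]
    omega
  simp only [this]

theorem sum_odd_top_eq (hα : ParameterIdentification n θt θ1 κ α) (i : Fin n) :
    ∑ k ∈ Finset.Ico (i + 1 : ℕ) n, α (2 * k + 1)
      = -κ (2 * n) - Schlesinger.dPar (θt + θ1) κ i - Schlesinger.aPar (θt + θ1) κ i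
        - ∑ k ∈ Finset.Ioi i, Schlesinger.aPar (θt + θ1) κ k := by
  have h1 := Finset.sum_Ico_consecutive (fun k => α (2 * k + 1)) (m := 1) (n := i + 1) (k := n)
    (by omega) (by omega)
  have h2 := Finset.sum_Ico_consecutive (fun k => α (2 * k)) (m := 1) (n := i + 1) (k := n + 1)
    (by omega) (by omega)
  have h3 := Finset.sum_eq_sum_Ico_succ_bot (a := i + 1) (b := n + 1) (by omega)
    (fun k => α (2 * k))
  have h4 : Finset.Ico (i + 1 + 1 : ℕ) (n + 1) = Finset.Icc (i + 1 + 1 : ℕ) n := by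
    ext
    simp only [Finset.mem_Ico, Finset.mem_Icc]
    omega
  rw [h4, hα.sum_Icc_top, hα.alpha_eq_aPar] at h3
  rw [hα.sum_odd_eq, hα.sum_odd_top, ← h2, h3, hα.sum_Ico_one] at h1
  linear_combination h1

theorem kappaS_eq (hα : ParameterIdentification n θt θ1 κ α) (i : Fin n) :
    kappaS α (i + 1) = -θt + Schlesinger.dPar (θt + θ1) κ i
      - ∑ k ∈ Finset.Iio i, Schlesinger.aPar (θt + θ1) κ k := by
  rw [kappaS, hα.sum_odd_eq, hα.alpha_one]
  ring

theorem kappaOne_eq (hα : ParameterIdentification n θt θ1 κ α) (i : Fin n) :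
    kappaOne n α (i + 1) = ∑ k ∈ Finset.Ioi i, Schlesinger.aPar (θt + θ1) κ k
      - Schlesinger.aPar (θt + θ1) κ i - Schlesinger.dPar (θt + θ1) κ i + θt + θ1 + κ 1 := by
  rw [kappaOne, hα.sum_odd_top_eq, ← Finset.mul_sum, hα.sum_Icc_top, hα.alpha_penultimate]
  ring

theorem kappaZero_eq (hα : ParameterIdentification n θt θ1 κ α) (i : Fin n) :
    kappaZero n α (i + 1) = -∑ k ∈ Finset.Ioi i, Schlesinger.aPar (θt + θ1) κ k
      - Schlesinger.aPar (θt + θ1) κ i - Schlesinger.dPar (θt + θ1) κ i - κ 1 + 1 := by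
  rw [kappaZero, hα.sum_odd_top_eq, hα.alpha_last]
  ring

theorem kappaInf_eq (hα : ParameterIdentification n θt θ1 κ α) (i : Fin n) :
    kappaInf α (i + 1) = -θ1 + Schlesinger.dPar (θt + θ1) κ i
      + ∑ k ∈ Finset.Iio i, Schlesinger.aPar (θt + θ1) κ k := by
  rw [kappaInf, hα.sum_odd_eq, ← Finset.mul_sum, hα.sum_Ico_one, hα.alpha_zero]
  ring

end ParameterIdentification

end Sasano

namespace Schlesinger

variable {n : ℕ}

/-! ### The Hamiltonian on the normal form -/

/-- Cyclicity of the trace reduces to `n × n` matrices, since `[θ - C B, C] [I; B'] = θ - C (B -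
B')`. Only the difference of the `B`s enters. -/
theorem trace_residue_mul_residue (θt θ1 : ℂ) (Bt Ct B1 C1 : Matrix (Fin n) (Fin n) ℂ) :
    (residue θt Bt Ct * residue θ1 B1 C1).trace
      = ((θt • 1 - Ct * (Bt - B1)) * (θ1 • 1 + C1 * (Bt - B1))).trace := by
  rw [residue, residue, Matrix.mul_assoc, Matrix.trace_mul_comm, Matrix.mul_assoc, Matrix.mul_assoc,
    ← Matrix.mul_assoc (Matrix.fromCols _ Ct), Matrix.fromCols_mul_fromRows,
    Matrix.fromCols_mul_fromRows]
  congr 2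
  · rw [Matrix.mul_one, Matrix.mul_sub]
    abel
  · rw [Matrix.mul_one, Matrix.mul_sub]
    abel

theorem residueSum_mul_residue_apply (θt θ1 : ℂ) (p : PhaseSpace n) (i j : Fin n) :
    (residueSum θt θ1 p * residue θt (p.1 Pole.t) (p.2 Pole.t)) (Sum.inl i) (Sum.inl j)
      = (((θt + θ1) • 1 + p.2 Pole.one * (p.1 Pole.t - p.1 Pole.one)) *
          (θt • 1 - p.2 Pole.t * p.1 Pole.t)) i j := by
  rw [residueSum, residue_eq_fromBlocks, residue_eq_fromBlocks, Matrix.fromBlocks_add,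
    Matrix.fromBlocks_multiply, Matrix.fromBlocks_apply₁₁,
    ← Matrix.mul_assoc (p.2 Pole.t + p.2 Pole.one), ← Matrix.add_mul]
  have h : θt • 1 - p.2 Pole.t * p.1 Pole.t + (θ1 • 1 - p.2 Pole.one * p.1 Pole.one)
      + (p.2 Pole.t + p.2 Pole.one) * p.1 Pole.t
      = (θt + θ1) • 1 + p.2 Pole.one * (p.1 Pole.t - p.1 Pole.one) := by
    rw [Matrix.add_mul, Matrix.mul_sub, add_smul]
    abel
  rw [h]

theorem sum_num (f : ℕ → ℂ) : ∑ r : Idx n, f r.num = ∑ i ∈ Finset.Icc 1 (2 * n), f i := by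
  rw [Fintype.sum_sum_type]
  simp only [Idx.num, Sum.elim_inl, Sum.elim_inr]
  rw [Fin.sum_univ_eq_sum_range (fun i => f (i + 1)), Fin.sum_univ_eq_sum_range (fun i => f (n + i + 1)),
    ← Finset.sum_range_add (fun i => f (i + 1)), ← two_mul, Finset.range_eq_Ico,
    Finset.sum_Ico_add' f 0 (2 * n) 1]
  rfl

theorem trace_residue (θ : ℂ) (B C : Matrix (Fin n) (Fin n) ℂ) :
    (residue θ B C).trace = n * θ := by
  rw [residue, Matrix.trace_mul_comm, Matrix.fromCols_mul_fromRows]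
  simp [mul_comm]

section

variable [NeZero n]

/-- The first diagonal entry of the sum of the residues is determined by the Fuchs relation. -/
theorem InBorelFiber.residueSum_zero_zero {θt θ1 θ0 : ℂ} {κ : ℕ → ℂ} {p : PhaseSpace n}
    (h : InBorelFiber θt θ1 κ p)
    (hFuchs : n * θt + n * θ1 + θ0 + ∑ i ∈ Finset.Icc 1 (2 * n), κ i = 0) :
    θ0 + residueSum θt θ1 p (Sum.inl 0) (Sum.inl 0) = -κ 1 := by
  have htr : (residueSum θt θ1 p).trace = n * θt + n * θ1 := by
    rw [residueSum, Matrix.trace_add, trace_residue, trace_residue]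
  have hsum : (residueSum θt θ1 p).trace + ∑ r : Idx n, κ r.num
      = residueSum θt θ1 p (Sum.inl 0) (Sum.inl 0) + κ 1 := by
    rw [Matrix.trace, ← Finset.sum_add_distrib, Finset.sum_eq_single (Sum.inl 0)]
    · rw [Matrix.diag_apply, Idx.num_inl_zero]
    · intro r _ hr
      rw [Matrix.diag_apply, h r r hr hr le_rfl, if_pos rfl, neg_add_cancel]
    · simp
  rw [sum_num, htr] at hsum
  linear_combination hFuchs - hsum

variable (θ : ℂ) (κ : ℕ → ℂ) (u b : Fin n → ℂ)

theorem dPar_zero : dPar (n := n) θ κ 0 = 0 := by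
  simp [dPar]

theorem diffMatrix_self {i : Fin n} (hi : i ≠ 0) : diffMatrix θ κ u b i i = dPar θ κ i := by
  simp [diffMatrix, hi]

theorem diffMatrix_zero (i : Fin n) :
    diffMatrix θ κ u b i 0 = b i * (1 + u i) - aPar θ κ i := by
  simp [diffMatrix]

/-- Outside its first row and column the difference matrix is upper triangular, so these products
drop out of the trace of a square. -/
theorem diffMatrix_mul_swap {i j : Fin n} (hi : i ≠ 0) (hj : j ≠ 0) (hij : i ≠ j) :
    diffMatrix θ κ u b i j * diffMatrix θ κ u b j i = 0 := by
  rcases lt_or_gt_of_ne hij with h | h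
  · rw [diffMatrix, diffMatrix, if_neg hi, if_neg h.not_gt, if_neg h.ne', mul_zero]
  · rw [diffMatrix, if_neg hj, if_neg h.not_gt, if_neg h.ne', zero_mul]

theorem sum_mul_diffMatrix (v : Fin n → ℂ) {j : Fin n} (hj : j ≠ 0) :
    ∑ k, v k * diffMatrix θ κ u b k j
      = v j * dPar θ κ j + ∑ k ∈ Finset.Iio j, v k * (b k * (u k - u j) - aPar θ κ k) := by
  have : ∀ k, v k * diffMatrix θ κ u b k j = (if k = j then v j * dPar θ κ j else 0) +
      if k ∈ Finset.Iio j then v k * (b k * (u k - u j) - aPar θ κ k) else 0 := by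
    intro k
    rw [diffMatrix, if_neg hj]
    simp only [Finset.mem_Iio]
    rcases lt_trichotomy k j with h | h | h
    · simp [h, h.ne]
    · simp [h]
    · simp [h.not_gt, h.ne']
  rw [Finset.sum_congr rfl fun k _ => this k, Finset.sum_add_distrib, Finset.sum_ite_eq',
    if_pos (Finset.mem_univ _), Finset.sum_ite_mem, Finset.univ_inter]

theorem trace_rowScalar_mul (c : ℂ) (v : Fin n → ℂ) :
    (rowScalar c v * diffMatrix θ κ u b).trace
      = ∑ k, v k * (b k * (1 + u k) - aPar θ κ k) + c * ∑ k : Fin n, dPar θ κ k := by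
  have : ∀ i : Fin n, (rowScalar c v * diffMatrix θ κ u b : Matrix (Fin n) (Fin n) ℂ) i i
      = (if i = 0 then ∑ k, v k * (b k * (1 + u k) - aPar θ κ k) else 0) + c * dPar θ κ i := by
    intro i
    split_ifs with hi
    · subst hi
      rw [rowScalar_mul_apply_zero, dPar_zero, mul_zero, add_zero]
      simp only [diffMatrix_zero]
    · rw [rowScalar_mul_apply_ne _ _ _ hi, diffMatrix_self _ _ _ _ hi, zero_add]
  simp only [Matrix.trace, Matrix.diag_apply, this, Finset.sum_add_distrib, Finset.sum_ite_eq',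
    Finset.mem_univ, if_true, Finset.mul_sum]

theorem trace_rowScalar_mul_rowScalar_mul :
    (rowScalar 1 u * diffMatrix θ κ u b *
        (rowScalar (-1) (fun _ => 1) * diffMatrix θ κ u b)).trace
      = (∑ k, u k * (b k * (1 + u k) - aPar θ κ k)) * ∑ k, (b k * (1 + u k) - aPar θ κ k)
        + ∑ j, (b j * (1 + u j) - aPar θ κ j) * ((1 - u j) * dPar θ κ j
            + ∑ k ∈ Finset.Iio j, (1 - u k) * (b k * (u k - u j) - aPar θ κ k))
        - ∑ j : Fin n, dPar θ κ j ^ 2 := by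
  set D := diffMatrix θ κ u b with hD
  set X := rowScalar 1 u * D with hX
  set Y : Matrix (Fin n) (Fin n) ℂ := rowScalar (-1) (fun _ => 1) * D with hY
  -- Off the first row, `X` and `Y` are `D` and `-D`. So only pairs involving index `0` and the
  -- diagonal pairs survive, the latter giving `-d_i²`.
  have hterm : ∀ i j : Fin n, X i j * Y j i
      = (if i = 0 then (if j = 0 then X 0 0 * Y 0 0 else -(X 0 j * D j 0)) else 0)
        + (if j = 0 then (if i = 0 then 0 else D i 0 * Y 0 i) else 0)
        + (if j = i then -(dPar θ κ i ^ 2) else 0) := by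
    intro i j
    by_cases hi : i = 0
    · subst hi
      by_cases hj : j = 0
      · subst hj
        simp [dPar_zero]
      · rw [hY, rowScalar_mul_apply_ne _ _ _ hj]
        simp [hj]
    · rw [hX, rowScalar_mul_apply_ne _ _ _ hi]
      by_cases hj : j = 0
      · subst hj
        simp [hi, Ne.symm hi]
      · rw [hY, rowScalar_mul_apply_ne _ _ _ hj]
        by_cases hij : j = i
        · subst hij
          rw [hD, diffMatrix_self _ _ _ _ hj]
          simp [hj]
          ring
        · have := diffMatrix_mul_swap θ κ u b hi hj (Ne.symm hij)
          simp only [if_neg hi, if_neg hj, if_neg hij]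
          linear_combination -this
  have hX0 : X 0 0 = ∑ k, u k * (b k * (1 + u k) - aPar θ κ k) := by
    rw [hX, rowScalar_mul_apply_zero]
    simp only [hD, diffMatrix_zero]
  have hY0 : Y 0 0 = ∑ k, (b k * (1 + u k) - aPar θ κ k) := by
    rw [hY, rowScalar_mul_apply_zero]
    simp only [hD, diffMatrix_zero, one_mul]
  have hYX {j : Fin n} (hj : j ≠ 0) : Y 0 j - X 0 j = (1 - u j) * dPar θ κ j
      + ∑ k ∈ Finset.Iio j, (1 - u k) * (b k * (u k - u j) - aPar θ κ k) := by
    rw [← sum_mul_diffMatrix θ κ u b (fun k => 1 - u k) hj, hX, hY, rowScalar_mul_apply_zero,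
      rowScalar_mul_apply_zero, ← Finset.sum_sub_distrib]
    refine Finset.sum_congr rfl fun k _ => ?_
    ring
  rw [← hX0, ← hY0]
  have htr : (X * Y).trace = _ := Finset.sum_congr rfl fun i _ =>
    (Matrix.mul_apply (M := X) (N := Y)).trans (Finset.sum_congr rfl fun j _ => hterm i j)
  rw [htr]
  simp only [Finset.sum_add_distrib, Finset.sum_ite_eq', Finset.mem_univ, if_true]
  have h1 : ∑ i : Fin n, ∑ j : Fin n, (if i = 0 then (if j = 0 then X 0 0 * Y 0 0 else -(X 0 j * D j 0)) else 0)
      = ∑ j : Fin n, (if j = 0 then X 0 0 * Y 0 0 else -(X 0 j * D j 0)) := by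
    rw [Finset.sum_comm]
    simp
  rw [h1, Finset.sum_neg_distrib, ← sub_eq_add_neg, ← Finset.sum_add_distrib]
  congr 1
  have h2 : X 0 0 * Y 0 0 = ∑ j : Fin n, if j = 0 then X 0 0 * Y 0 0 else 0 := by simp
  conv_rhs => rw [h2]
  rw [← Finset.sum_add_distrib]
  refine Finset.sum_congr rfl fun j _ => ?_
  by_cases hj : j = 0
  · subst hj
    have : Finset.Iio (0 : Fin n) = ∅ := by
      ext a
      simp
    simp [dPar_zero, this]
  · rw [if_neg hj, if_neg hj, if_neg hj, ← hYX hj, hD, diffMatrix_zero]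
    ring

variable {θ κ u b} in
/-- The Hamiltonian on the normal form, up to the contributions of the poles. -/
theorem hamiltonianK_normalPoint {θt θ1 θ0 t : ℂ}
    (hFuchs : n * θt + n * θ1 + θ0 + ∑ i ∈ Finset.Icc 1 (2 * n), κ i = 0)
    {e : Fin n → ℂ} (he : ∀ i, e i = b i * (1 + u i) - aPar (θt + θ1) κ i) :
    hamiltonianK θt θ1 θ0 t (normalPoint u (fun _ => 1) b (diffMatrix (θt + θ1) κ u b)) =
      (n * (θt * θ1) + θt * (∑ k, e k - ∑ k : Fin n, dPar (θt + θ1) κ k)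
        - θ1 * (∑ k, u k * e k + ∑ k : Fin n, dPar (θt + θ1) κ k)
        - ((∑ k, u k * e k) * ∑ k, e k
          + ∑ j, e j * ((1 - u j) * dPar (θt + θ1) κ j
            + ∑ k ∈ Finset.Iio j, (1 - u k) * (b k * (u k - u j) - aPar (θt + θ1) κ k))
          - ∑ j : Fin n, dPar (θt + θ1) κ j ^ 2)) / (t - 1)
      + (-κ 1 * (θt - ∑ k, u k * b k) - (θt + θ1 + ∑ k, e k) * (θt - ∑ k, u k * b k)
        + ∑ j, (dPar (θt + θ1) κ j
          + ∑ k ∈ Finset.Iio j, (b k * (u k - u j) - aPar (θt + θ1) κ k)) * b j) / t := by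
  set D := diffMatrix (θt + θ1) κ u b with hD
  set p := normalPoint u (fun _ => 1) b D with hp
  have hfib : InBorelFiber θt θ1 κ p := inBorelFiber_normalPoint_iff.mpr hD
  have hpd : p.1 Pole.t - p.1 Pole.one = D := by simp [hp, normalPoint]
  have ht : p.2 Pole.t = rowScalar 1 u := rfl
  have h1 : p.2 Pole.one = rowScalar (-1) (fun _ => 1) := rfl
  have hb : p.1 Pole.t = firstCol b := rfl
  have hCb : ∀ j, (rowScalar 1 u * firstCol b) j 0 = if j = 0 then ∑ k, u k * b k else b j := by
    intro j
    split_ifs with hj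
    · rw [hj, rowScalar_mul_apply_zero]
      simp [firstCol]
    · rw [rowScalar_mul_apply_ne _ _ _ hj]
      simp [firstCol]
  have h00 : residue θt (p.1 Pole.t) (p.2 Pole.t) (Sum.inl 0) (Sum.inl 0)
      = θt - ∑ k, u k * b k := by
    rw [residue_eq_fromBlocks, Matrix.fromBlocks_apply₁₁, Matrix.sub_apply, ht, hb, hCb, if_pos rfl]
    simp
  have hY : ∀ j, ((θt + θ1) • (1 : Matrix (Fin n) (Fin n) ℂ) +
      rowScalar (-1) (fun _ => 1) * D : Matrix (Fin n) (Fin n) ℂ) 0 j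
      = if j = 0 then θt + θ1 + ∑ k, e k else dPar (θt + θ1) κ j
        + ∑ k ∈ Finset.Iio j, (b k * (u k - u j) - aPar (θt + θ1) κ k) := by
    intro j
    rw [Matrix.add_apply, Matrix.smul_apply, rowScalar_mul_apply_zero]
    split_ifs with hj
    · subst hj
      simp [hD, diffMatrix_zero, he]
    · rw [hD, sum_mul_diffMatrix _ _ _ _ (fun _ => 1) hj, Matrix.one_apply_ne (Ne.symm hj)]
      simp
  have hX : ∀ j, (θt • (1 : Matrix (Fin n) (Fin n) ℂ) - rowScalar 1 u * firstCol b) j 0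
      = if j = 0 then θt - ∑ k, u k * b k else -b j := by
    intro j
    rw [Matrix.sub_apply, hCb, Matrix.smul_apply]
    split_ifs with hj
    · subst hj
      simp
    · rw [Matrix.one_apply_ne hj]
      simp
  have hYX : (residueSum θt θ1 p * residue θt (p.1 Pole.t) (p.2 Pole.t)) (Sum.inl 0) (Sum.inl 0)
      = (θt + θ1 + ∑ k, e k) * (θt - ∑ k, u k * b k) - ∑ j, (dPar (θt + θ1) κ j
          + ∑ k ∈ Finset.Iio j, (b k * (u k - u j) - aPar (θt + θ1) κ k)) * b j := by
    rw [residueSum_mul_residue_apply, hpd, ht, h1, hb, Matrix.mul_apply]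
    have h0 : (θt + θ1 + ∑ k, e k) * (θt - ∑ k, u k * b k) = ∑ j : Fin n,
        if j = 0 then (θt + θ1 + ∑ k, e k) * (θt - ∑ k, u k * b k) else 0 := by simp
    rw [h0, ← Finset.sum_sub_distrib]
    refine Finset.sum_congr rfl fun j _ => ?_
    rw [hY, hX]
    split_ifs with hj
    · subst hj
      have : Finset.Iio (0 : Fin n) = ∅ := by
        ext a
        simp
      simp [dPar_zero, this]
    · ring
  have htr : (residue θt (p.1 Pole.t) (p.2 Pole.t) * residue θ1 (p.1 Pole.one) (p.2 Pole.one)).trace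
      = n * (θt * θ1) + θt * (rowScalar (-1) (fun _ => 1) * D).trace
        - θ1 * (rowScalar 1 u * D).trace
        - (rowScalar 1 u * D * (rowScalar (-1) (fun _ => 1) * D)).trace := by
    rw [trace_residue_mul_residue, hpd, ht, h1]
    simp only [Matrix.sub_mul, Matrix.mul_add, Matrix.smul_mul, Matrix.mul_smul, Matrix.one_mul,
      Matrix.mul_one, Matrix.trace_sub, Matrix.trace_add, Matrix.trace_smul, Matrix.trace_one,
      Fintype.card_fin, smul_eq_mul]
    ring
  rw [hamiltonianK_eq, hfib.residueSum_zero_zero hFuchs, htr, h00, hYX, hD, trace_rowScalar_mul,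
    trace_rowScalar_mul, trace_rowScalar_mul_rowScalar_mul]
  simp only [← he, one_mul]
  ring

end

end Schlesinger

/-! ### Comparison of `K` on the slice with the Sasano Hamiltonian. -/

namespace Schlesinger

variable {n : ℕ}

/-- Products of sums are folded onto `k ≤ j`, the shape of the coupling terms of the Sasano
Hamiltonian, so that the comparison can be made summand by summand. -/
theorem sum_mul_sum_eq_sum_add_sum_Iio (f g : Fin n → ℂ) :
    (∑ j, f j) * ∑ j, g j = ∑ j, (f j * g j + ∑ k ∈ Finset.Iio j, (f j * g k + f k * g j)) := by
  have hsplit (j : Fin n) (F : Fin n → ℂ) :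
      ∑ k, F k = F j + ∑ k ∈ Finset.Iio j, F k + ∑ k ∈ Finset.Ioi j, F k := by
    have : ∀ k, F k = (if k = j then F k else 0) + (if k ∈ Finset.Iio j then F k else 0)
        + (if k ∈ Finset.Ioi j then F k else 0) := by
      intro k
      simp only [Finset.mem_Iio, Finset.mem_Ioi]
      rcases lt_trichotomy k j with h | h | h
      · simp [h, h.ne, h.not_gt]
      · simp [h]
      · simp [h, h.ne', h.not_gt]
    rw [Finset.sum_congr rfl fun k _ => this k, Finset.sum_add_distrib, Finset.sum_add_distrib,
      Finset.sum_ite_eq', if_pos (Finset.mem_univ _), Finset.sum_ite_mem, Finset.univ_inter,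
      Finset.sum_ite_mem, Finset.univ_inter]
  have hswap : ∑ j : Fin n, ∑ k ∈ Finset.Ioi j, f j * g k
      = ∑ j : Fin n, ∑ k ∈ Finset.Iio j, f k * g j :=
    Finset.sum_comm' (by simp)
  rw [Finset.sum_mul]
  simp_rw [Finset.mul_sum]
  rw [Finset.sum_congr rfl fun j _ => hsplit j fun k => f j * g k]
  simp only [Finset.sum_add_distrib]
  rw [hswap]
  ring

theorem sum_Ioi_eq_sum_Iio (F : Fin n → Fin n → ℂ) :
    ∑ i : Fin n, ∑ j ∈ Finset.Ioi i, F i j = ∑ j : Fin n, ∑ i ∈ Finset.Iio j, F i j :=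
  Finset.sum_comm' (by simp)

section

variable {a d l m e : Fin n → ℂ} {θt θ1 κ₁ t : ℂ}

/-- The comparison of the Hamiltonian `K` on the normal form with the Sasano Hamiltonian. -/
theorem sasano_sum_identity (he : ∀ j, e j = m j * (t - l j) - a j) (A : ℂ) :
    t * (A + θt * (∑ k, e k - ∑ k, d k))
        + θ1 * (∑ k, l k * e k - t * ∑ k, d k)
        + ((∑ k, l k * e k) * ∑ k, e k
          - ∑ j, e j * ((t + l j) * d j
            + ∑ k ∈ Finset.Iio j, (t + l k) * (m k * (l j - l k) - a k))
          + t * ∑ j, d j ^ 2)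
      + (t - 1) * (-κ₁ * (θt + ∑ k, l k * m k)
        - (θt + θ1 + ∑ k, e k) * (θt + ∑ k, l k * m k)
        + ∑ j, (d j + ∑ k ∈ Finset.Iio j, (m k * (l j - l k) - a k)) * (t * m j))
      + (t - 1) * ∑ k, l k * m k
    = ∑ j, Sasano.hVI (a j) (l j) (m j)
        (∑ k ∈ Finset.Ioi j, a k - a j - d j + (θt + θ1) + κ₁)
        (-∑ k ∈ Finset.Ioi j, a k - a j - d j - κ₁ + 1)
        (-θt + d j - ∑ k ∈ Finset.Iio j, a k)
        (-θ1 + d j + ∑ k ∈ Finset.Iio j, a k) t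
      + ∑ i : Fin n, ∑ j ∈ Finset.Ioi i, 2 * l i * m i * (l j - 1) * ((l j - t) * m j + a j)
      + (t * (A - (θt + θ1) * ∑ k, d k + ∑ k, d k ^ 2) - (t - 1) * (κ₁ + θt + θ1) * θt
        - ∑ j, (θt * a j - t * a j * d j + t * ∑ k ∈ Finset.Iio j, a k * a j)) := by
  have h1 : (∑ k, l k * e k) * ∑ k, e k = _ := sum_mul_sum_eq_sum_add_sum_Iio _ _
  have h2 : (∑ k, e k) * ∑ k, l k * m k = _ := sum_mul_sum_eq_sum_add_sum_Iio _ _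
  have h3 : ∑ j, (∑ k ∈ Finset.Ioi j, a k) * (l j * m j)
      = ∑ j, ∑ k ∈ Finset.Iio j, a j * (l k * m k) := by
    rw [← sum_Ioi_eq_sum_Iio fun k j => a j * (l k * m k)]
    simp only [Finset.sum_mul]
  -- `hVI` is affine in its four exponents, so the partial sums of `a` hidden in them split off.
  have h4 : ∑ j, Sasano.hVI (a j) (l j) (m j)
        (∑ k ∈ Finset.Ioi j, a k - a j - d j + (θt + θ1) + κ₁)
        (-∑ k ∈ Finset.Ioi j, a k - a j - d j - κ₁ + 1)
        (-θt + d j - ∑ k ∈ Finset.Iio j, a k)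
        (-θ1 + d j + ∑ k ∈ Finset.Iio j, a k) t
      = ∑ j, (Sasano.hVI (a j) (l j) (m j) (-a j - d j + (θt + θ1) + κ₁) (-a j - d j - κ₁ + 1)
          (-θt + d j) (-θ1 + d j) t
          + (∑ k ∈ Finset.Iio j, a k) * (l j * a j + (l j - 1) * (l j - t) * m j))
        - (t - 1) * ∑ j, (∑ k ∈ Finset.Ioi j, a k) * (l j * m j) := by
    rw [Finset.mul_sum, ← Finset.sum_sub_distrib]
    refine Finset.sum_congr rfl fun j _ => ?_
    simp only [Sasano.hVI]
    ring
  -- An identity valid for each `j` is summed over `j`. The summands are opaque functions here, so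
  -- only their linear combination is manipulated.
  have hgen : ∀ le lm dd P Q PP T V X Y Z : Fin n → ℂ, (∀ j, t * θt * (e j - d j)
      + θ1 * (le j - t * d j) + P j - Q j + t * dd j + (t - 1) * (-(κ₁ + θt + θ1) * lm j
        - θt * e j - PP j + T j) + (t - 1) * lm j - V j + (t - 1) * X j - Y j
        + t * (θt + θ1) * d j - t * dd j + Z j = 0) →
      t * θt * (∑ j, e j - ∑ j, d j)
      + θ1 * (∑ j, le j - t * ∑ j, d j) + ∑ j, P j - ∑ j, Q j + t * ∑ j, dd j
      + (t - 1) * (-(κ₁ + θt + θ1) * ∑ j, lm j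
        - θt * ∑ j, e j - ∑ j, PP j + ∑ j, T j) + (t - 1) * ∑ j, lm j - ∑ j, V j
        + (t - 1) * ∑ j, X j - ∑ j, Y j
        + t * (θt + θ1) * ∑ j, d j - t * ∑ j, dd j + ∑ j, Z j = 0 := by
    intro le lm dd P Q PP T V X Y Z h
    have := Finset.sum_eq_zero fun j (_ : j ∈ Finset.univ) => h j
    simp only [Finset.sum_add_distrib, Finset.sum_sub_distrib, ← Finset.mul_sum] at this
    linear_combination this
  rw [h4, h3, sum_Ioi_eq_sum_Iio]
  linear_combination h1 - (t - 1) * h2 + hgen (fun j => l j * e j) (fun j => l j * m j)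
    (fun j => d j ^ 2)
    (fun j => l j * e j * e j + ∑ k ∈ Finset.Iio j, (l j * e j * e k + l k * e k * e j))
    (fun j => e j * ((t + l j) * d j
            + ∑ k ∈ Finset.Iio j, (t + l k) * (m k * (l j - l k) - a k)))
    (fun j => e j * (l j * m j) + ∑ k ∈ Finset.Iio j, (e j * (l k * m k) + e k * (l j * m j)))
    (fun j => (d j + ∑ k ∈ Finset.Iio j, (m k * (l j - l k) - a k)) * (t * m j))
    (fun j => Sasano.hVI (a j) (l j) (m j) (-a j - d j + (θt + θ1) + κ₁) (-a j - d j - κ₁ + 1)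
          (-θt + d j) (-θ1 + d j) t
          + (∑ k ∈ Finset.Iio j, a k) * (l j * a j + (l j - 1) * (l j - t) * m j))
    (fun j => ∑ k ∈ Finset.Iio j, a j * (l k * m k))
    (fun j => ∑ i ∈ Finset.Iio j, 2 * l i * m i * (l j - 1) * ((l j - t) * m j + a j))
    (fun j => θt * a j - t * a j * d j + t * ∑ k ∈ Finset.Iio j, a k * a j) fun j => by
      -- The terms coupling `j` to smaller indices cancel for each pair `k < j` separately.
      have hp : ∑ k ∈ Finset.Iio j, (l j * e j * e k + l k * e k * e j)
          - e j * ∑ k ∈ Finset.Iio j, (t + l k) * (m k * (l j - l k) - a k)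
          - (t - 1) * ∑ k ∈ Finset.Iio j, (e j * (l k * m k) + e k * (l j * m j))
          + (t - 1) * (t * m j) * ∑ k ∈ Finset.Iio j, (m k * (l j - l k) - a k)
          - (l j * a j + (l j - 1) * (l j - t) * m j) * ∑ k ∈ Finset.Iio j, a k
          + (t - 1) * ∑ k ∈ Finset.Iio j, a j * (l k * m k)
          - ∑ i ∈ Finset.Iio j, 2 * l i * m i * (l j - 1) * ((l j - t) * m j + a j)
          + t * ∑ k ∈ Finset.Iio j, a k * a j = 0 := by
        simp only [Finset.mul_sum, ← Finset.sum_add_distrib, ← Finset.sum_sub_distrib]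
        refine Finset.sum_eq_zero fun k _ => ?_
        rw [he, he]
        ring
      simp only [Sasano.hVI]
      have hej := he j
      linear_combination (norm := skip) hp
      rw [hej]
      ring

end

section

variable [NeZero n] {θt θ1 θ0 : ℂ} {κ α : ℕ → ℂ}

/-- The constant depends on `t` and the exponents but not on `l`, `m`, hence disappears from
Hamilton's equations. -/
theorem exists_hamiltonianK_coordPoint
    (hFuchs : n * θt + n * θ1 + θ0 + ∑ i ∈ Finset.Icc 1 (2 * n), κ i = 0)
    (hα : Sasano.ParameterIdentification n θt θ1 κ α) {t : ℂ} (ht : t ≠ 0) (ht1 : t - 1 ≠ 0) :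
    ∃ c : ℂ, ∀ l m : Fin n → ℂ,
      t * (t - 1) * hamiltonianK θt θ1 θ0 t (coordPoint (θt + θ1) κ t l m)
        + (t - 1) * ∑ i, l i * m i = Sasano.hamiltonian α t l m + c := by
  refine ⟨t * (n * (θt * θ1) - (θt + θ1) * ∑ k : Fin n, dPar (θt + θ1) κ k
      + ∑ k : Fin n, dPar (θt + θ1) κ k ^ 2) - (t - 1) * (κ 1 + θt + θ1) * θt
    - ∑ j : Fin n, (θt * aPar (θt + θ1) κ j - t * aPar (θt + θ1) κ j * dPar (θt + θ1) κ j
      + t * ∑ k ∈ Finset.Iio j, aPar (θt + θ1) κ k * aPar (θt + θ1) κ j), fun l m => ?_⟩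
  have he (i : Fin n) : m i * (t - l i) - aPar (θt + θ1) κ i
      = t * m i * (1 + -(l i / t)) - aPar (θt + θ1) κ i := by
    field_simp
    ring
  set e : Fin n → ℂ := fun i => m i * (t - l i) - aPar (θt + θ1) κ i with hedef
  have hlb : ∑ i, -(l i / t) * (t * m i) = -∑ i, l i * m i := by
    rw [← Finset.sum_neg_distrib]
    refine Finset.sum_congr rfl fun i _ => ?_
    field_simp
  have hle : ∑ i, -(l i / t) * e i = -(t⁻¹ * ∑ i, l i * e i) := by
    rw [Finset.mul_sum, ← Finset.sum_neg_distrib]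
    refine Finset.sum_congr rfl fun i _ => ?_
    field_simp
  have hD (i : Fin n) (j : Fin n) : t * m i * (-(l i / t) - -(l j / t)) = m i * (l j - l i) := by
    field_simp
    ring
  have h1u : ∑ j, e j * ((1 - -(l j / t)) * dPar (θt + θ1) κ j
        + ∑ k ∈ Finset.Iio j, (1 - -(l k / t)) * (m k * (l j - l k) - aPar (θt + θ1) κ k))
      = t⁻¹ * ∑ j, e j * ((t + l j) * dPar (θt + θ1) κ j
        + ∑ k ∈ Finset.Iio j, (t + l k) * (m k * (l j - l k) - aPar (θt + θ1) κ k)) := by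
    have h (i : Fin n) (x : ℂ) : (1 - -(l i / t)) * x = t⁻¹ * ((t + l i) * x) := by
      field_simp
      ring
    simp only [h, ← Finset.mul_sum, ← mul_add, mul_left_comm _ t⁻¹]
  have key := sasano_sum_identity (a := fun i => aPar (θt + θ1) κ i) (d := fun i => dPar (θt + θ1) κ i)
    (l := l) (m := m) (θt := θt) (θ1 := θ1) (κ₁ := κ 1) (t := t) (e := e) (fun i => rfl)
    (n * (θt * θ1))
  have hH : Sasano.hamiltonian α t l m = _ :=
    congrArg₂ (· + ·) (Finset.sum_congr rfl fun i _ => by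
      rw [hα.kappaOne_eq, hα.kappaZero_eq, hα.kappaS_eq, hα.kappaInf_eq, hα.alpha_eq_aPar,
        add_assoc (_ - _ - _) θt θ1])
      (Finset.sum_congr rfl fun i _ => Finset.sum_congr rfl fun j _ => by rw [hα.alpha_eq_aPar])
  rw [hH]
  refine Eq.trans ?_ key
  rw [coordPoint, hamiltonianK_normalPoint hFuchs he]
  simp only [hD]
  rw [hlb, hle, h1u]
  generalize ∑ i, l i * m i = s1
  generalize ∑ i, l i * e i = s2
  generalize ∑ i, e i = s3
  generalize ∑ j, e j * _ = s4
  generalize ∑ j, _ * (t * m j) = s5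
  generalize ∑ j : Fin n, dPar (θt + θ1) κ j = s6
  generalize ∑ j : Fin n, dPar (θt + θ1) κ j ^ 2 = s7
  field_simp
  ring

/-- Both sides are Borel invariant and each orbit of nondegenerate points of the fibre meets the
slice. -/
theorem exists_hamiltonianK_eq
    (hFuchs : n * θt + n * θ1 + θ0 + ∑ i ∈ Finset.Icc 1 (2 * n), κ i = 0)
    (hα : Sasano.ParameterIdentification n θt θ1 κ α) {t : ℂ} (ht : t ≠ 0) (ht1 : t - 1 ≠ 0) :
    ∃ c : ℂ, ∀ p : PhaseSpace n, InBorelFiber θt θ1 κ p → Nondegenerate p →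
      t * (t - 1) * hamiltonianK θt θ1 θ0 t p + (t - 1) * ∑ i, lam t i p * mu t i p
        = Sasano.hamiltonian α t (fun i => lam t i p) (fun i => mu t i p) + c := by
  obtain ⟨c, hc⟩ := exists_hamiltonianK_coordPoint (θ0 := θ0) hFuchs hα ht ht1
  refine ⟨c, fun p hp hn => ?_⟩
  obtain ⟨P, Q, S, hB, hG⟩ := borelEquiv_coordPoint (θt := θt) (θ1 := θ1) ht hp hn
  rw [← hc, hG.hamiltonianK_eq hB]

end

end Schlesinger

section

attribute [local instance] Matrix.normedAddCommGroup Matrix.normedSpace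
open scoped Topology

namespace Schlesinger

variable {n : ℕ}

/-! ### Borel invariant functions -/

section

variable {f : PhaseSpace n → ℂ} {p : PhaseSpace n}

/-- `f` takes the value `f p` on the Borel orbit of `p`. -/
def BorelInvariantAt [NeZero n] (f : PhaseSpace n → ℂ) (p : PhaseSpace n) : Prop :=
  ∀ q, BorelEquiv p q → f q = f p

theorem fderiv_eq_zero_of_eventuallyEq (hf : DifferentiableAt ℂ f p) {c : ℂ → PhaseSpace n}
    {v : PhaseSpace n} (hc : HasDerivAt c v 0) (hc0 : c 0 = p)
    (h : ∀ᶠ s in 𝓝 0, f (c s) = f p) : fderiv ℂ f p v = 0 := by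
  have h1 : HasDerivAt (fun s => f (c s)) (fderiv ℂ f p v) 0 := by
    rw [← hc0] at hf ⊢
    exact hf.hasFDerivAt.comp_hasDerivAt 0 hc
  exact h1.unique ((hasDerivAt_const (0 : ℂ) (f p)).congr_of_eventuallyEq h)

/-- `(1 + s E) (1 - s / (1 + c s) E) = 1` for an idempotent or square-zero `E`. -/
theorem one_add_smul_mul {E : Matrix (Fin n) (Fin n) ℂ} {c : ℂ} (hE : E * E = c • E) {s : ℂ}
    (hs : 1 + c * s ≠ 0) : (1 + s • E) * (1 - (s / (1 + c * s)) • E) = 1 ∧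
      (1 - (s / (1 + c * s)) • E) * (1 + s • E) = 1 := by
  have h : s - s / (1 + c * s) - s * (s / (1 + c * s)) * c = 0 := by
    linear_combination -div_mul_cancel₀ s hs
  constructor
  · have : (1 + s • E) * (1 - (s / (1 + c * s)) • E)
        = 1 + (s - s / (1 + c * s) - s * (s / (1 + c * s)) * c) • E := by
      simp only [add_mul, mul_sub, one_mul, mul_one, smul_mul_smul_comm, hE, sub_smul, smul_smul]
      abel
    rw [this, h, zero_smul, add_zero]
  · have : (1 - (s / (1 + c * s)) • E) * (1 + s • E)
        = 1 + (s - s / (1 + c * s) - s * (s / (1 + c * s)) * c) • E := by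
      simp only [mul_add, sub_mul, one_mul, mul_one, smul_mul_smul_comm, hE, sub_smul, smul_smul,
        mul_comm (s / (1 + c * s)) s]
      abel
    rw [this, h, zero_smul, add_zero]

theorem single_mul_single_self (j i : Fin n) :
    Matrix.single j i (1 : ℂ) * Matrix.single j i 1
      = (if i = j then (1 : ℂ) else 0) • Matrix.single j i 1 := by
  split_ifs with h
  · subst h
    rw [Matrix.single_mul_single_same, one_smul, one_mul]
  · rw [Matrix.single_mul_single_of_ne _ _ _ _ h, zero_smul]

theorem eventually_one_add_ne_zero (c : ℂ) : ∀ᶠ s : ℂ in 𝓝 0, 1 + c * s ≠ 0 := by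
  have : ContinuousAt (fun s : ℂ => 1 + c * s) 0 := by fun_prop
  exact this.eventually_ne (by simp)

theorem hasDerivAt_div_one_add (c : ℂ) : HasDerivAt (fun s : ℂ => s / (1 + c * s)) 1 0 := by
  have h : HasDerivAt (fun s : ℂ => s / (1 + c * s))
      ((1 * (1 + c * 0) - 0 * (c * 1)) / (1 + c * 0) ^ 2) 0 :=
    (hasDerivAt_id' 0).fun_div (((hasDerivAt_id' 0).const_mul c).const_add 1) (by simp)
  simpa using h

theorem sum_single_mul_apply (M F : Matrix (Fin n) (Fin n) ℂ) (i j : Fin n) :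
    ∑ a, ∑ b, (Matrix.single j i 1 * M : Matrix (Fin n) (Fin n) ℂ) a b * F a b
      = ∑ b, M i b * F j b := by
  rw [Finset.sum_eq_single j]
  · simp
  · intro a _ ha
    simp [Matrix.single_mul_apply_of_ne _ _ _ _ _ ha]
  · simp

theorem sum_mul_single_apply (M F : Matrix (Fin n) (Fin n) ℂ) (i j : Fin n) :
    ∑ a, ∑ b, (M * Matrix.single j i 1 : Matrix (Fin n) (Fin n) ℂ) a b * F a b
      = ∑ a, M a j * F a i := by
  refine Finset.sum_congr rfl fun a _ => ?_
  rw [Finset.sum_eq_single i]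
  · simp
  · intro b _ hb
    simp [Matrix.mul_single_apply_of_ne _ _ _ _ _ hb]
  · simp

variable [NeZero n]

/-- This direction is the velocity at `s = 0` of the gauge transforms by `P = (1 + s E)⁻¹`, along
which `f` is constant. The conditions on `i`, `j` place `E` in the Lie algebra of the Borel group.
-/
theorem BorelInvariantAt.fderiv_upper (hinv : BorelInvariantAt f p) (hf : DifferentiableAt ℂ f p)
    {i j : Fin n} (hj : j ≠ 0) (hij : j ≤ i) :
    fderiv ℂ f p (fun ξ => -(p.1 ξ * Matrix.single j i 1),
      fun ξ => Matrix.single j i 1 * p.2 ξ) = 0 := by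
  set E : Matrix (Fin n) (Fin n) ℂ := Matrix.single j i 1 with hE
  set c : ℂ := if i = j then 1 else 0 with hc
  set v : PhaseSpace n := (fun ξ => p.1 ξ * E, 0) with hv
  set w : PhaseSpace n := (0, fun ξ => E * p.2 ξ) with hw
  have hvw : ((fun ξ => -(p.1 ξ * E), fun ξ => E * p.2 ξ) : PhaseSpace n)
      = 0 - (1 : ℂ) • v + (1 : ℂ) • w := by
    ext <;> simp [hv, hw]
  rw [hvw]
  refine fderiv_eq_zero_of_eventuallyEq hf
    (c := fun s => p - (s / (1 + c * s)) • v + s • w) ?_ (by simp) ?_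
  · exact (((hasDerivAt_const _ _).sub ((hasDerivAt_div_one_add c).smul_const v)).add
      ((hasDerivAt_id (0 : ℂ)).smul_const w))
  · filter_upwards [eventually_one_add_ne_zero c] with s hs
    obtain ⟨h1, h2⟩ := one_add_smul_mul (single_mul_single_self j i) hs
    refine hinv _ ⟨1 - (s / (1 + c * s)) • E, 1, 0, ⟨?_, by simp, ?_, ?_, ?_, by simp⟩, ?_, ?_⟩
    · exact (Matrix.isUnit_iff_isUnit_det _).mp (IsUnit.of_mul_eq_one _ h2)
    · intro a b hab
      have : ¬ (j = a ∧ i = b) := fun h => absurd hab (by rw [← h.1, ← h.2]; exact hij.not_gt)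
      simp [hE, this, Matrix.one_apply_ne hab.ne']
    · intro b hb
      simp [hE, hj, Matrix.one_apply_ne hb.symm]
    · intro a b hab
      exact Matrix.one_apply_ne hab.ne
    · intro ξ
      have : (p - (s / (1 + c * s)) • v + s • w).2 ξ = (1 + s • E) * p.2 ξ := by
        simp [hv, hw, add_mul]
      rw [this, ← mul_assoc, h2, one_mul, mul_one]
    · intro ξ
      simp [hv, hw, mul_sub]

/-- The same argument with `Q = 1 + s E`. -/
theorem BorelInvariantAt.fderiv_lower (hinv : BorelInvariantAt f p) (hf : DifferentiableAt ℂ f p)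
    {i j : Fin n} (hij : i ≤ j) :
    fderiv ℂ f p (fun ξ => -(Matrix.single j i 1 * p.1 ξ),
      fun ξ => p.2 ξ * Matrix.single j i 1) = 0 := by
  set E : Matrix (Fin n) (Fin n) ℂ := Matrix.single j i 1 with hE
  set c : ℂ := if i = j then 1 else 0 with hc
  set v : PhaseSpace n := (fun ξ => E * p.1 ξ, 0) with hv
  set w : PhaseSpace n := (0, fun ξ => p.2 ξ * E) with hw
  have hvw : ((fun ξ => -(E * p.1 ξ), fun ξ => p.2 ξ * E) : PhaseSpace n)
      = 0 - (1 : ℂ) • v + (1 : ℂ) • w := by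
    ext <;> simp [hv, hw]
  rw [hvw]
  refine fderiv_eq_zero_of_eventuallyEq hf
    (c := fun s => p - (s / (1 + c * s)) • v + s • w) ?_ (by simp) ?_
  · exact (((hasDerivAt_const _ _).sub ((hasDerivAt_div_one_add c).smul_const v)).add
      ((hasDerivAt_id (0 : ℂ)).smul_const w))
  · filter_upwards [eventually_one_add_ne_zero c] with s hs
    obtain ⟨h1, h2⟩ := one_add_smul_mul (single_mul_single_self j i) hs
    refine hinv _ ⟨1, 1 + s • E, 0, ⟨by simp, ?_, ?_, ?_, ?_, by simp⟩, ?_, ?_⟩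
    · exact (Matrix.isUnit_iff_isUnit_det _).mp (IsUnit.of_mul_eq_one _ h1)
    · intro a b hab
      exact Matrix.one_apply_ne hab.ne'
    · intro b hb
      exact Matrix.one_apply_ne hb.symm
    · intro a b hab
      have : ¬ (j = a ∧ i = b) := fun h => absurd hab (by rw [← h.1, ← h.2]; exact hij.not_gt)
      simp [hE, this, Matrix.one_apply_ne hab.ne]
    · intro ξ
      simp [hv, hw, mul_add]
    · intro ξ
      have : (p - (s / (1 + c * s)) • v + s • w).1 ξ = (1 - (s / (1 + c * s)) • E) * p.1 ξ := by
        simp [hv, hw, sub_mul]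
      rw [this, ← mul_assoc, h1, one_mul, mul_one, sub_zero]

/-- The flow line of a Borel invariant function with few nonzero partial derivatives with respect
to `B` stays in the Borel fibre. -/
theorem BorelInvariantAt.inBorelFiber_add_smul_hamVec (hinv : BorelInvariantAt f p)
    (hf : DifferentiableAt ℂ f p)
    (hB : ∀ ξ a b, b ≠ 0 → partialB f ξ a b p = 0)
    (hBC : ∀ ξ i j, partialC f ξ 0 i p * partialB f ξ j 0 p = 0)
    {θt θ1 : ℂ} {κ : ℕ → ℂ} (hp : InBorelFiber θt θ1 κ p) (s : ℂ) :
    InBorelFiber θt θ1 κ (p + s • hamVec f p) := by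
  have hC0 (ξ : Pole) {i : Fin n} (hi : i ≠ 0) (j : Fin n) : (hamVec f p).2 ξ i j = 0 := by
    simp [hamVec, hB ξ j i hi]
  -- Noether's argument: invariance of `f` under a generator is the vanishing of the first
  -- variation, along the Hamiltonian vector field of `f`, of the matching component of the moment
  -- map. In `C B` only `B` varies here, because `hC0` freezes the lower rows of `C`.
  have hup {i j : Fin n} (hi : i ≠ 0) (hj : j ≠ 0) (hij : j ≤ i) :
      ∑ ξ, (p.2 ξ * (hamVec f p).1 ξ) i j = 0 := by
    rw [← hinv.fderiv_upper hf hj hij, fderiv_eq_sum hf]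
    refine Finset.sum_congr rfl fun ξ _ => ?_
    simp only [Finset.sum_add_distrib]
    rw [sum_single_mul_apply _ fun a b => partialC f ξ a b p, Matrix.mul_apply]
    simp only [Matrix.neg_apply, neg_mul, Finset.sum_neg_distrib]
    rw [sum_mul_single_apply _ fun a b => partialB f ξ a b p]
    simp [hB _ _ _ hi, hamVec]
  have hlow {i j : Fin n} (hij : i ≤ j) :
      ∑ ξ, ((hamVec f p).1 ξ * p.2 ξ + p.1 ξ * (hamVec f p).2 ξ) i j = 0 := by
    rw [← hinv.fderiv_lower hf hij, fderiv_eq_sum hf]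
    refine Finset.sum_congr rfl fun ξ _ => ?_
    simp only [Finset.sum_add_distrib]
    rw [sum_mul_single_apply _ fun a b => partialC f ξ a b p, Matrix.add_apply, Matrix.mul_apply,
      Matrix.mul_apply]
    simp only [Matrix.neg_apply, neg_mul, Finset.sum_neg_distrib]
    rw [sum_single_mul_apply _ fun a b => partialB f ξ a b p]
    simp [hamVec, add_comm, mul_comm]
  -- The fibre equations are quadratic; with the second order term gone too, the whole line, and not
  -- just its tangent, lies in the fibre.
  have hquad (ξ : Pole) (i j : Fin n) : ((hamVec f p).1 ξ * (hamVec f p).2 ξ) i j = 0 := by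
    rw [Matrix.mul_apply]
    refine Finset.sum_eq_zero fun k _ => ?_
    rcases eq_or_ne k 0 with rfl | hk
    · simp [hamVec, hBC]
    · rw [hC0 ξ hk, mul_zero]
  rw [inBorelFiber_iff_blocks] at hp ⊢
  obtain ⟨h1, h2, h3⟩ := hp
  refine ⟨fun i j hi hj hij => ?_, fun i j hi => ?_, fun i j hij => ?_⟩
  · have hrow (ξ : Pole) : ((p + s • hamVec f p).2 ξ * (p + s • hamVec f p).1 ξ) i j
        = (p.2 ξ * p.1 ξ) i j + s * (p.2 ξ * (hamVec f p).1 ξ) i j := by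
      simp only [Matrix.mul_apply, Finset.mul_sum, ← Finset.sum_add_distrib]
      refine Finset.sum_congr rfl fun k _ => ?_
      simp [hC0 ξ hi]
      ring
    have := hup hi hj hij
    rw [Pole.sum_univ] at this
    rw [hrow, hrow, ← h1 i j hi hj hij]
    linear_combination s * this
  · simp [hC0 _ hi, h2 i j hi]
  · have hrow (ξ : Pole) : ((p + s • hamVec f p).1 ξ * (p + s • hamVec f p).2 ξ) i j
        = (p.1 ξ * p.2 ξ) i j
          + s * ((hamVec f p).1 ξ * p.2 ξ + p.1 ξ * (hamVec f p).2 ξ) i j := by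
      have : (p + s • hamVec f p).1 ξ * (p + s • hamVec f p).2 ξ = p.1 ξ * p.2 ξ
          + s • ((hamVec f p).1 ξ * p.2 ξ + p.1 ξ * (hamVec f p).2 ξ)
          + (s * s) • ((hamVec f p).1 ξ * (hamVec f p).2 ξ) := by
        simp only [Prod.fst_add, Prod.snd_add, Prod.smul_fst, Prod.smul_snd, Pi.add_apply,
          Pi.smul_apply, add_mul, mul_add, smul_mul_assoc, mul_smul_comm, smul_add, smul_smul]
        abel
      rw [this, Matrix.add_apply, Matrix.add_apply, Matrix.smul_apply, Matrix.smul_apply, hquad]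
      simp
    have := hlow hij
    rw [Pole.sum_univ] at this
    rw [hrow, hrow, ← h3 i j hij]
    linear_combination s * this

end

end Schlesinger

end

/-! ### Partial derivatives of the Sasano Hamiltonian and Hamilton's equations for `λ`, `μ`. -/

section

attribute [local instance] Matrix.normedAddCommGroup Matrix.normedSpace
open scoped Topology

namespace Sasano

variable {n : ℕ}

theorem differentiable_hamiltonian (α : ℕ → ℂ) (t : ℂ) :
    Differentiable ℂ fun x : (Fin n → ℂ) × (Fin n → ℂ) => hamiltonian α t x.1 x.2 := by
  unfold hamiltonian hVI
  fun_prop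

theorem deriv_hamiltonian_snd (α : ℕ → ℂ) (t : ℂ) (l m : Fin n → ℂ) (i : Fin n) :
    deriv (fun y => hamiltonian α t l (Function.update m i y)) (m i)
      = fderiv ℂ (fun x : (Fin n → ℂ) × (Fin n → ℂ) => hamiltonian α t x.1 x.2) (l, m)
        (0, Pi.single i 1) := by
  have h1 : HasDerivAt (fun y => ((l, Function.update m i y) : (Fin n → ℂ) × (Fin n → ℂ)))
      (0, Pi.single i 1) (m i) := (hasDerivAt_const _ _).prodMk (hasDerivAt_update m i (m i))
  have h2 := (differentiable_hamiltonian α t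
    (l, Function.update m i (m i))).hasFDerivAt.comp_hasDerivAt (m i) h1
  rw [Function.update_eq_self] at h2
  exact h2.deriv

theorem deriv_hamiltonian_fst (α : ℕ → ℂ) (t : ℂ) (l m : Fin n → ℂ) (i : Fin n) :
    deriv (fun y => hamiltonian α t (Function.update l i y) m) (l i)
      = fderiv ℂ (fun x : (Fin n → ℂ) × (Fin n → ℂ) => hamiltonian α t x.1 x.2) (l, m)
        (Pi.single i 1, 0) := by
  have h1 : HasDerivAt (fun y => ((Function.update l i y, m) : (Fin n → ℂ) × (Fin n → ℂ)))
      (Pi.single i 1, 0) (l i) := (hasDerivAt_update l i (l i)).prodMk (hasDerivAt_const _ _)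
  have h2 := (differentiable_hamiltonian α t
    (Function.update l i (l i), m)).hasFDerivAt.comp_hasDerivAt (l i) h1
  rw [Function.update_eq_self] at h2
  exact h2.deriv

end Sasano

namespace Schlesinger

variable {n : ℕ}

theorem hasDerivAt_comp_add_smul {F : PhaseSpace n → ℂ} {p : PhaseSpace n}
    (hF : DifferentiableAt ℂ F p) (v : PhaseSpace n) :
    HasDerivAt (fun s : ℂ => F (p + s • v)) (fderiv ℂ F p v) 0 := by
  have h1 : HasDerivAt (fun s : ℂ => p + s • v) v 0 := by
    have h := ((hasDerivAt_id' (0 : ℂ)).smul_const v).const_add p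
    rwa [one_smul] at h
  have h2 : p + (0 : ℂ) • v = p := by simp
  rw [← h2] at hF
  have := hF.hasFDerivAt.comp_hasDerivAt (0 : ℂ) h1
  rwa [h2] at this

theorem hasDerivAt_comp_of_entries {X : ℂ → PhaseSpace n} {t : ℂ} {V : PhaseSpace n}
    (hB : ∀ ξ i j, HasDerivAt (fun z => (X z).1 ξ i j) (V.1 ξ i j) t)
    (hC : ∀ ξ i j, HasDerivAt (fun z => (X z).2 ξ i j) (V.2 ξ i j) t) :
    HasDerivAt X V t :=
  HasDerivAt.prodMk
    (hasDerivAt_pi.mpr fun ξ => hasDerivAt_pi.mpr fun i => hasDerivAt_pi.mpr fun j => hB ξ i j)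
    (hasDerivAt_pi.mpr fun ξ => hasDerivAt_pi.mpr fun i => hasDerivAt_pi.mpr fun j => hC ξ i j)

theorem bracket_apply_fst (F : PhaseSpace n → ℂ) (ξ : Pole) (i j : Fin n) (p : PhaseSpace n) :
    bracket F (fun p => p.1 ξ i j) p = partialC F ξ j i p := by
  have hd : Differentiable ℂ fun p : PhaseSpace n => p.1 ξ i j := by fun_prop
  rw [bracket_eq_fderiv _ (hd p)]
  refine (hasDerivAt_comp_add_smul (hd p) _).unique ?_
  have h := ((hasDerivAt_id' (0 : ℂ)).mul_const (partialC F ξ j i p)).const_add (p.1 ξ i j)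
  rwa [one_mul] at h

theorem bracket_apply_snd (F : PhaseSpace n → ℂ) (ξ : Pole) (i j : Fin n) (p : PhaseSpace n) :
    bracket F (fun p => p.2 ξ i j) p = -partialB F ξ j i p := by
  have hd : Differentiable ℂ fun p : PhaseSpace n => p.2 ξ i j := by fun_prop
  rw [bracket_eq_fderiv _ (hd p)]
  refine (hasDerivAt_comp_add_smul (hd p) _).unique ?_
  have h := ((hasDerivAt_id' (0 : ℂ)).mul_const (-partialB F ξ j i p)).const_add (p.2 ξ i j)
  rwa [one_mul] at h

variable [NeZero n] {θt θ1 θ0 : ℂ} {κ α : ℕ → ℂ}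

/-! ### The Hamiltonian flow in the coordinates `λ`, `μ` -/

/-- Along a direction tangent to the Borel fibre the differential of `K` is that of the Sasano
Hamiltonian. -/
theorem fderiv_hamiltonianK_eq
    (hFuchs : n * θt + n * θ1 + θ0 + ∑ i ∈ Finset.Icc 1 (2 * n), κ i = 0)
    (hα : Sasano.ParameterIdentification n θt θ1 κ α) {t : ℂ} (ht : t ≠ 0) (ht1 : t - 1 ≠ 0)
    {p v : PhaseSpace n} (hn : Nondegenerate p)
    (hv : ∀ s : ℂ, InBorelFiber θt θ1 κ (p + s • v)) :
    t * (t - 1) * fderiv ℂ (hamiltonianK θt θ1 θ0 t) p v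
      + (t - 1) * ∑ i, (fderiv ℂ (lam t i) p v * mu t i p + lam t i p * fderiv ℂ (mu t i) p v)
    = fderiv ℂ (fun x : (Fin n → ℂ) × (Fin n → ℂ) => Sasano.hamiltonian α t x.1 x.2)
        (fun i => lam t i p, fun i => mu t i p)
        (fun i => fderiv ℂ (lam t i) p v, fun i => fderiv ℂ (mu t i) p v) := by
  obtain ⟨c, hc⟩ := exists_hamiltonianK_eq (θ0 := θ0) hFuchs hα ht ht1
  have hl (i : Fin n) := hasDerivAt_comp_add_smul (hn.differentiableAt_lam t i) v
  have hm (i : Fin n) := hasDerivAt_comp_add_smul (hn.differentiableAt_mu t i) v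
  have hK := hasDerivAt_comp_add_smul (differentiable_hamiltonianK θt θ1 θ0 t p) v
  have h0 : p + (0 : ℂ) • v = p := by simp
  have hL := (hK.const_mul (t * (t - 1))).add
    ((HasDerivAt.fun_sum fun i (_ : i ∈ Finset.univ) => (hl i).mul (hm i)).const_mul (t - 1))
  have hlm : HasDerivAt (fun s : ℂ => ((fun i => lam t i (p + s • v), fun i => mu t i (p + s • v)) :
      (Fin n → ℂ) × (Fin n → ℂ)))
      (fun i => fderiv ℂ (lam t i) p v, fun i => fderiv ℂ (mu t i) p v) 0 :=
    (hasDerivAt_pi.mpr hl).prodMk (hasDerivAt_pi.mpr hm)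
  have hR := ((Sasano.differentiable_hamiltonian α t _).hasFDerivAt.comp_hasDerivAt (0 : ℂ)
    hlm).add_const c
  simp only [h0] at hL hR
  refine hL.unique (hR.congr_of_eventuallyEq ?_)
  have hcont : ContinuousAt (fun s : ℂ => p + s • v) 0 := by fun_prop
  have hev : ∀ᶠ s : ℂ in 𝓝 0, Nondegenerate (p + s • v) :=
    hcont.eventually (by beta_reduce; rw [h0]; exact eventually_nondegenerate hn)
  filter_upwards [hev] with s hs
  exact hc _ (hv s) hs

theorem lam_borelInvariantAt (t : ℂ) (i : Fin n) (p : PhaseSpace n) :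
    BorelInvariantAt (lam t i) p := by
  rintro q ⟨P, Q, S, hB, hG⟩
  exact hG.lam_eq hB t i

theorem Nondegenerate.mu_borelInvariantAt {p : PhaseSpace n} (hn : Nondegenerate p) (t : ℂ)
    (i : Fin n) : BorelInvariantAt (mu t i) p := by
  rintro q ⟨P, Q, S, hB, hG⟩
  exact hG.mu_eq hB hn t i

theorem fderiv_lam_hamVec_lam {t : ℂ} {p : PhaseSpace n} (hn : Nondegenerate p) (i j : Fin n) :
    fderiv ℂ (lam t i) p (hamVec (lam t j) p) = 0 := by
  rw [← bracket_eq_fderiv _ (hn.differentiableAt_lam t i), bracket_lam_lam]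

theorem fderiv_mu_hamVec_lam {t : ℂ} (ht : t ≠ 0) {p : PhaseSpace n} (hn : Nondegenerate p)
    (i j : Fin n) :
    fderiv ℂ (mu t i) p (hamVec (lam t j) p) = -if i = j then 1 else 0 := by
  rw [← bracket_eq_fderiv _ (hn.differentiableAt_mu t i), bracket_antisymm, bracket_mu_lam ht i j hn]

theorem fderiv_lam_hamVec_mu {t : ℂ} (ht : t ≠ 0) {p : PhaseSpace n} (hn : Nondegenerate p)
    (i j : Fin n) :
    fderiv ℂ (lam t i) p (hamVec (mu t j) p) = if i = j then 1 else 0 := by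
  rw [← bracket_eq_fderiv _ (hn.differentiableAt_lam t i), bracket_mu_lam ht j i hn]
  simp only [eq_comm]

theorem fderiv_mu_hamVec_mu {t : ℂ} {p : PhaseSpace n} (hn : Nondegenerate p) (i j : Fin n) :
    fderiv ℂ (mu t i) p (hamVec (mu t j) p) = 0 := by
  rw [← bracket_eq_fderiv _ (hn.differentiableAt_mu t i), bracket_mu_mu _ _ _ hn]

/-- The Hamiltonian vector field of `λ_j` leaves every `λ_i` fixed and changes only `μ_j`, at rate
`-1`. It is tangent to the Borel fibre, so the formula for `K` can be differentiated along it. For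
`μ_j` the roles are exchanged. -/
theorem bracket_hamiltonianK_lam
    (hFuchs : n * θt + n * θ1 + θ0 + ∑ i ∈ Finset.Icc 1 (2 * n), κ i = 0)
    (hα : Sasano.ParameterIdentification n θt θ1 κ α) {t : ℂ} (ht : t ≠ 0) (ht1 : t - 1 ≠ 0)
    {p : PhaseSpace n} (hn : Nondegenerate p) (hp : InBorelFiber θt θ1 κ p) (j : Fin n) :
    t * (t - 1) * bracket (hamiltonianK θt θ1 θ0 t) (lam t j) p
      = deriv (fun y => Sasano.hamiltonian α t (fun i => lam t i p)
          (Function.update (fun i => mu t i p) j y)) (mu t j p) - (t - 1) * lam t j p := by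
  have h := fderiv_hamiltonianK_eq (θ0 := θ0) hFuchs hα ht ht1 hn
    ((lam_borelInvariantAt t j p).inBorelFiber_add_smul_hamVec (hn.differentiableAt_lam t j)
      (fun _ _ _ _ => partialB_lam _ _ _ _ _ _) (fun _ _ _ => by rw [partialB_lam, mul_zero]) hp)
  simp only [fderiv_lam_hamVec_lam hn, fderiv_mu_hamVec_lam ht hn, zero_mul, zero_add,
    mul_neg, mul_ite, mul_one, mul_zero, Finset.sum_neg_distrib, Finset.sum_ite_eq',
    Finset.mem_univ, if_true] at h
  have hvec : ((fun _ => 0, fun i => -if i = j then (1 : ℂ) else 0) :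
      (Fin n → ℂ) × (Fin n → ℂ)) = -(0, Pi.single j 1) := by
    ext i
    · simp
    · simp [Pi.single_apply]
  rw [hvec, map_neg, ← Sasano.deriv_hamiltonian_snd, ← bracket_eq_fderiv _
    (differentiable_hamiltonianK θt θ1 θ0 t p), bracket_antisymm] at h
  linear_combination -h

theorem bracket_hamiltonianK_mu
    (hFuchs : n * θt + n * θ1 + θ0 + ∑ i ∈ Finset.Icc 1 (2 * n), κ i = 0)
    (hα : Sasano.ParameterIdentification n θt θ1 κ α) {t : ℂ} (ht : t ≠ 0) (ht1 : t - 1 ≠ 0)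
    {p : PhaseSpace n} (hn : Nondegenerate p) (hp : InBorelFiber θt θ1 κ p) (j : Fin n) :
    t * (t - 1) * bracket (hamiltonianK θt θ1 θ0 t) (mu t j) p
      = -deriv (fun y => Sasano.hamiltonian α t (Function.update (fun i => lam t i p) j y)
          (fun i => mu t i p)) (lam t j p) + (t - 1) * mu t j p := by
  have h := fderiv_hamiltonianK_eq (θ0 := θ0) hFuchs hα ht ht1 hn
    ((hn.mu_borelInvariantAt t j).inBorelFiber_add_smul_hamVec (hn.differentiableAt_mu t j)
      (fun ξ a b hb => by
        cases ξ
        · exact partialB_mu_t_of_ne _ _ _ hb _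
        · exact partialB_mu_one _ _ _ _ _)
      (fun ξ a b => by
        cases ξ
        · rw [partialC_mu_t _ _ _ hn, zero_mul]
        · rw [partialB_mu_one, mul_zero]) hp)
  simp only [fderiv_lam_hamVec_mu ht hn, fderiv_mu_hamVec_mu hn, mul_zero, add_zero, ite_mul,
    one_mul, zero_mul, Finset.sum_ite_eq', Finset.mem_univ, if_true] at h
  have hvec : ((fun i => if i = j then (1 : ℂ) else 0, fun _ => 0) :
      (Fin n → ℂ) × (Fin n → ℂ)) = (Pi.single j 1, 0) := by
    ext i
    · simp [Pi.single_apply]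
    · simp
  rw [hvec, ← Sasano.deriv_hamiltonian_fst, ← bracket_eq_fderiv _
    (differentiable_hamiltonianK θt θ1 θ0 t p), bracket_antisymm] at h
  linear_combination -h

theorem lam_eq_mul (t : ℂ) (i : Fin n) (p : PhaseSpace n) : lam t i p = t * lam 1 i p := by
  simp only [lam]
  ring

theorem mu_eq_inv_mul (t : ℂ) (i : Fin n) (p : PhaseSpace n) : mu t i p = t⁻¹ * mu 1 i p := by
  simp only [mu]
  ring

/-- The flow of `K` on the Borel fibre becomes the Sasano system. -/
theorem IsHamiltonianSolution.isSolution
    (hFuchs : n * θt + n * θ1 + θ0 + ∑ i ∈ Finset.Icc 1 (2 * n), κ i = 0)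
    (hα : Sasano.ParameterIdentification n θt θ1 κ α) {U : Set ℂ} (h0 : 0 ∉ U) (h1 : 1 ∉ U)
    {X : ℂ → PhaseSpace n} (hX : IsHamiltonianSolution θt θ1 θ0 U X)
    (hfib : ∀ t ∈ U, InBorelFiber θt θ1 κ (X t)) (hn : ∀ t ∈ U, Nondegenerate (X t)) :
    Sasano.IsSolution α U (fun t i => lam t i (X t)) (fun t i => mu t i (X t)) := by
  intro t htU i
  have ht : t ≠ 0 := fun h => h0 (h ▸ htU)
  have ht1 : t - 1 ≠ 0 := fun h => h1 (sub_eq_zero.mp h ▸ htU)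
  have hXt : HasDerivAt X (hamVec (hamiltonianK θt θ1 θ0 t) (X t)) t := by
    refine hasDerivAt_comp_of_entries (fun ξ i j => ?_) fun ξ i j => ?_
    · have := (hX t htU ξ i j).1
      rwa [bracket_apply_fst] at this
    · have := (hX t htU ξ i j).2
      rwa [bracket_apply_snd] at this
  have hcomp {F : PhaseSpace n → ℂ} (hF : DifferentiableAt ℂ F (X t)) :
      HasDerivAt (fun z => F (X z)) (bracket (hamiltonianK θt θ1 θ0 t) F (X t)) t := by
    rw [bracket_eq_fderiv _ hF]
    exact hF.hasFDerivAt.comp_hasDerivAt t hXt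
  have hl : HasDerivAt (fun z => lam z i (X z))
      (t⁻¹ * lam t i (X t) + bracket (hamiltonianK θt θ1 θ0 t) (lam t i) (X t)) t := by
    -- The explicit time dependence is isolated as a factor `z`, leaving a fixed function on the
    -- phase space for the chain rule. Its contribution `λ / t` cancels the correction term in the
    -- bracket.
    have h := (hasDerivAt_id' t).mul ((hcomp ((hn t htU).differentiableAt_lam t i)).const_mul t⁻¹)
    refine (h.congr_deriv ?_).congr_of_eventuallyEq (.of_forall fun z => ?_)
    · field_simp
    · change lam z i (X z) = z * (t⁻¹ * lam t i (X z))
      rw [lam_eq_mul z, lam_eq_mul t, inv_mul_cancel_left₀ ht]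
  have hm : HasDerivAt (fun z => mu z i (X z))
      (-t⁻¹ * mu t i (X t) + bracket (hamiltonianK θt θ1 θ0 t) (mu t i) (X t)) t := by
    have h := (hasDerivAt_inv ht).mul ((hcomp ((hn t htU).differentiableAt_mu t i)).const_mul t)
    refine (h.congr_deriv ?_).congr_of_eventuallyEq (.of_forall fun z => ?_)
    · field_simp
    · change mu z i (X z) = z⁻¹ * (t * mu t i (X z))
      rw [mu_eq_inv_mul z, mu_eq_inv_mul t, mul_inv_cancel_left₀ ht]
  refine ⟨hl.differentiableAt, hm.differentiableAt, ?_, ?_⟩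
  · have := bracket_hamiltonianK_lam (θ0 := θ0) hFuchs hα ht ht1 (hn t htU) (hfib t htU) i
    rw [hl.deriv, mul_add, this]
    field_simp
    ring
  · have := bracket_hamiltonianK_mu (θ0 := θ0) hFuchs hα ht ht1 (hn t htU) (hfib t htU) i
    rw [hm.deriv, mul_add, this]
    field_simp
    ring

end Schlesinger

end

namespace Schlesinger

variable {n : ℕ}

/-! ### The torus fibre -/

theorem num_injective : Function.Injective (Idx.num (n := n)) := by
  rintro (i | i) (j | j) h <;> simp only [Idx.num, Sum.elim_inl, Sum.elim_inr] at h
  · rw [Fin.ext (a := i) (b := j) (by omega)]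
  · omega
  · omega
  · rw [Fin.ext (a := i) (b := j) (by omega)]

theorem num_mem_Icc (r : Idx n) : r.num ∈ Set.Icc 1 (2 * n) := by
  rcases r with i | i <;> simp only [Idx.num, Sum.elim_inl, Sum.elim_inr, Set.mem_Icc] <;> omega

theorem kappa_num_injective {κ : ℕ → ℂ} (hκ : Set.InjOn κ (Set.Icc 1 (2 * n))) :
    Function.Injective fun r : Idx n => -κ r.num :=
  fun r s h => num_injective (hκ (num_mem_Icc r) (num_mem_Icc s) (neg_injective h))

section

variable {ι : Type*} [Fintype ι] [DecidableEq ι]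

/-- A matrix intertwining two diagonal matrices with the same distinct entries is diagonal. -/
theorem apply_eq_zero_of_commute_diagonal {d : ι → ℂ} (hd : Function.Injective d)
    {N : Matrix ι ι ℂ} (h : N * Matrix.diagonal d = Matrix.diagonal d * N) {r s : ι} (hrs : r ≠ s) :
    N r s = 0 := by
  have := congrFun (congrFun h r) s
  rw [Matrix.mul_diagonal, Matrix.diagonal_mul] at this
  by_contra h0
  exact hrs (hd (mul_left_cancel₀ h0 (by rw [this, mul_comm])).symm)

/-- A triangular matrix with distinct diagonal entries is diagonalized by a triangular matrix. -/
theorem exists_blockTriangular_mul_eq {b : ι → ℕ} (hb : Function.Injective b) {M : Matrix ι ι ℂ}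
    (hM : M.BlockTriangular b) (hd : Function.Injective fun r => M r r) :
    ∃ N : Matrix ι ι ℂ, N.BlockTriangular b ∧ (∀ r, N r r ≠ 0) ∧
      M * N = N * Matrix.diagonal fun r => M r r := by
  have key (s : ι) : ∃ v : ι → ℂ, v s ≠ 0 ∧ (∀ k, b s < b k → v k = 0) ∧
      M.mulVec v = M s s • v := by
    have hdet : (M - Matrix.diagonal fun _ => M s s).det = 0 := by
      have htri : (M - Matrix.diagonal fun _ => M s s).BlockTriangular b :=
        hM.sub (Matrix.blockTriangular_diagonal _)
      rw [htri.det]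
      refine Finset.prod_eq_zero (Finset.mem_image_of_mem b (Finset.mem_univ s))
        (Matrix.det_eq_zero_of_row_eq_zero ⟨s, rfl⟩ fun ⟨k, hk⟩ => ?_)
      obtain rfl := hb hk
      simp [Matrix.toSquareBlock_def]
    obtain ⟨v, hv0, hv⟩ := Matrix.exists_mulVec_eq_zero_iff.mpr hdet
    rw [Matrix.sub_mulVec, sub_eq_zero] at hv
    have hv' : M.mulVec v = M s s • v := by
      rw [hv]
      ext k
      rw [Matrix.mulVec_diagonal, Pi.smul_apply, smul_eq_mul]
    -- Reading the eigenvalue equation at the last index `r` of the support of `v` gives `M r r = M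
    -- s s`, so `r = s` as the diagonal entries are distinct.
    obtain ⟨r, hr, hmax⟩ := (Finset.univ.filter fun k => v k ≠ 0).exists_max_image b (by
      obtain ⟨k, hk⟩ := Function.ne_iff.mp hv0
      exact ⟨k, by simpa using hk⟩)
    have hr0 : v r ≠ 0 := by simpa using hr
    have hlarge (k : ι) (hk : b r < b k) : v k = 0 := by
      by_contra h0
      exact absurd (hmax k (by simpa using h0)) hk.not_ge
    have hrow := congrFun hv' r
    rw [Matrix.mulVec, dotProduct, Finset.sum_eq_single r, Pi.smul_apply, smul_eq_mul] at hrow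
    · have : r = s := hd (mul_right_cancel₀ hr0 hrow)
      subst this
      exact ⟨v, hr0, hlarge, hv'⟩
    · intro k _ hk
      rcases lt_or_gt_of_ne (hb.ne hk) with h | h
      · rw [hM h, zero_mul]
      · rw [hlarge k h, mul_zero]
    · simp
  choose v hv0 hv1 hv2 using key
  refine ⟨Matrix.of fun k s => v s k, fun k s h => hv1 s k h, hv0, ?_⟩
  ext k s
  have := congrFun (hv2 s) k
  rw [Matrix.mul_diagonal, Matrix.mul_apply]
  rw [Pi.smul_apply, smul_eq_mul, mul_comm] at this
  exact this

end

section

variable [NeZero n] {θt θ1 θ0 : ℂ} {κ : ℕ → ℂ} {p q : PhaseSpace n}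

theorem ResidueRelation.inTorusFiber (h : ResidueRelation θt θ1 θ0 κ p) :
    InTorusFiber θt θ1 κ p := by
  obtain ⟨a0, aInf, h⟩ := h
  intro r s hr hs
  have := congrFun (congrFun h r) s
  simp only [Matrix.add_apply, residueZero, residueInfty, if_neg hr, if_neg hs, add_zero,
    Matrix.zero_apply] at this
  split_ifs at this ⊢
  · linear_combination this
  · linear_combination this

theorem InTorusFiber.residueRelation
    (hFuchs : n * θt + n * θ1 + θ0 + ∑ i ∈ Finset.Icc 1 (2 * n), κ i = 0)
    (h : InTorusFiber θt θ1 κ p) : ResidueRelation θt θ1 θ0 κ p := by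
  refine ⟨fun s => -residueSum θt θ1 p (Sum.inl 0) s,
    fun r => -residueSum θt θ1 p r (Sum.inl 0), ?_⟩
  ext r s
  simp only [Matrix.add_apply, residueZero, residueInfty, Matrix.zero_apply]
  by_cases hr : r = Sum.inl 0
  · subst hr
    by_cases hs : s = Sum.inl 0
    · subst hs
      have := h.inBorelFiber.residueSum_zero_zero hFuchs
      simp only [if_true, Idx.num_inl_zero]
      linear_combination this
    · simp [hs, Ne.symm hs]
  · by_cases hs : s = Sum.inl 0
    · subst hs
      simp [hr]
    · rw [h r s hr hs]
      simp only [if_neg hr, if_neg hs]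
      split_ifs <;> ring

theorem borelEquiv_torusAct (d : Idx n → ℂˣ) (p : PhaseSpace n) : BorelEquiv p (torusAct d p) := by
  refine ⟨Matrix.diagonal fun i => (d (Sum.inl i) : ℂ), Matrix.diagonal fun i => (d (Sum.inr i) : ℂ),
    0, ⟨?_, ?_, fun i j h => Matrix.diagonal_apply_ne _ h.ne',
      fun j h => Matrix.diagonal_apply_ne _ h.symm, fun i j h => Matrix.diagonal_apply_ne _ h.ne,
      fun _ => rfl⟩, fun ξ => ?_, fun ξ => ?_⟩
  · rw [Matrix.det_diagonal, isUnit_iff_ne_zero]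
    exact Finset.prod_ne_zero_iff.mpr fun i _ => (d _).ne_zero
  · rw [Matrix.det_diagonal, isUnit_iff_ne_zero]
    exact Finset.prod_ne_zero_iff.mpr fun i _ => (d _).ne_zero
  · ext i j
    rw [Matrix.diagonal_mul, Matrix.mul_diagonal]
    simp [torusAct, mul_assoc]
  · ext i j
    rw [sub_zero, Matrix.diagonal_mul, Matrix.mul_diagonal]
    simp [torusAct, mul_assoc]

/-- Borel equivalent points of the torus fibre differ by the residual torus. -/
theorem BorelEquiv.exists_torusAct (hκ : Set.InjOn κ (Set.Icc 1 (2 * n)))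
    (hp : InTorusFiber θt θ1 κ p) (hq : InTorusFiber θt θ1 κ q) (h : BorelEquiv p q) :
    ∃ d : Idx n → ℂˣ, q = torusAct d p := by
  obtain ⟨P, Q, S, hB, hG⟩ := h
  have hcomm := hG.gaugeMatrix_mul_stripFirst hB θt θ1 (-κ 1)
  rw [inTorusFiber_iff.mp hp, inTorusFiber_iff.mp hq] at hcomm
  have hN {r s : Idx n} (hrs : r ≠ s) : gaugeMatrix P Q S r s = 0 :=
    apply_eq_zero_of_commute_diagonal (kappa_num_injective hκ) hcomm hrs
  have hP : P = Matrix.diagonal fun i => P i i := by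
    ext i j
    rcases eq_or_ne i j with rfl | hij
    · simp
    · rw [Matrix.diagonal_apply_ne _ hij]
      exact hN (r := Sum.inl i) (s := Sum.inl j) (by simpa using hij)
  have hQ : Q = Matrix.diagonal fun i => Q i i := by
    ext i j
    rcases eq_or_ne i j with rfl | hij
    · simp
    · rw [Matrix.diagonal_apply_ne _ hij]
      exact hN (r := Sum.inr i) (s := Sum.inr j) (by simpa using hij)
  have hS : S = 0 := by
    ext i j
    exact hN (r := Sum.inr i) (s := Sum.inl j) (by simp)
  refine ⟨fun r => Units.mk0 _ (hB.gaugeMatrix_diag_ne_zero r), Prod.ext ?_ ?_⟩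
  · ext ξ i j
    have := congrFun (congrFun (hG.b ξ) i) j
    rw [hP, hQ, hS, sub_zero, Matrix.diagonal_mul, Matrix.mul_diagonal] at this
    have h0 := hB.diagQ_ne_zero i
    simp only [torusAct, Units.val_inv_eq_inv_val, Units.val_mk0, gaugeMatrix,
      Matrix.fromBlocks_apply₁₁, Matrix.fromBlocks_apply₂₂]
    rw [mul_assoc, ← this, inv_mul_cancel_left₀ h0]
  · ext ξ i j
    have := congrFun (congrFun (hG.c ξ) i) j
    rw [hP, hQ, Matrix.diagonal_mul, Matrix.mul_diagonal] at this
    have h0 := hB.diagP_ne_zero i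
    simp only [torusAct, Units.val_inv_eq_inv_val, Units.val_mk0, gaugeMatrix,
      Matrix.fromBlocks_apply₁₁, Matrix.fromBlocks_apply₂₂]
    rw [mul_assoc, ← this, inv_mul_cancel_left₀ h0]

/-- Every point of the Borel fibre is equivalent to a point of the torus fibre. -/
theorem InBorelFiber.exists_inTorusFiber (hκ : Set.InjOn κ (Set.Icc 1 (2 * n)))
    (hp : InBorelFiber θt θ1 κ p) : ∃ q, BorelEquiv p q ∧ InTorusFiber θt θ1 κ q := by
  obtain ⟨htri, hdiag⟩ := inBorelFiber_iff.mp hp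
  set M := stripFirst (-κ 1) (residueSum θt θ1 p) with hM
  have hinj : Function.Injective fun r => M r r := by
    simp only [hdiag]
    exact kappa_num_injective hκ
  obtain ⟨N, hN, hN0, hMN⟩ := exists_blockTriangular_mul_eq borelOrder_injective htri hinj
  -- The first row of `M` is diagonal, so distinct eigenvalues force `N` to decouple the first
  -- index, as a Borel gauge must.
  have hrow (s : Idx n) (hs : s ≠ Sum.inl 0) : N (Sum.inl 0) s = 0 := by
    have := congrFun (congrFun hMN (Sum.inl 0)) s
    rw [Matrix.mul_diagonal, Matrix.mul_apply, Finset.sum_eq_single (Sum.inl 0)] at this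
    · by_contra h0
      exact hs (hinj (mul_right_cancel₀ h0 (by rw [this, mul_comm]))).symm
    · intro k _ hk
      simp [hM, stripFirst, hk.symm]
    · simp
  have hNb : gaugeMatrix N.toBlocks₁₁ N.toBlocks₂₂ N.toBlocks₂₁ = N := by
    have h12 : N.toBlocks₁₂ = 0 := by
      ext i j
      rcases eq_or_ne i 0 with rfl | hi
      · exact hrow (Sum.inr j) (by simp)
      · exact hN (borelOrder_inr_lt_inl hi j)
    rw [gaugeMatrix, ← h12, Matrix.fromBlocks_toBlocks]
  have hB : IsBorel N.toBlocks₁₁ N.toBlocks₂₂ N.toBlocks₂₁ := by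
    have hup : N.toBlocks₁₁.BlockTriangular id := by
      intro i j (hij : j < i)
      have hi : i ≠ 0 := ne_zero_of_lt hij
      refine hN ?_
      rcases eq_or_ne j 0 with rfl | hj
      · rw [borelOrder_inl_zero]
        exact borelOrder_pos (by simpa using hi)
      · rw [borelOrder_inl hi, borelOrder_inl hj]
        have := Fin.lt_def.mp hij
        omega
    have hlow : N.toBlocks₂₂.BlockTriangular OrderDual.toDual := by
      intro i j (hij : i < j)
      refine hN ?_
      rw [borelOrder_inr, borelOrder_inr]
      have := Fin.lt_def.mp hij
      omega
    refine ⟨?_, ?_, fun i j h => hup h, fun j hj => hrow (Sum.inl j) (by simpa using hj),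
      fun i j h => hlow h, fun i => hN (by rw [borelOrder_inl_zero]; exact borelOrder_pos (by simp))⟩
    · rw [Matrix.det_of_isUpperTriangular hup, isUnit_iff_ne_zero]
      exact Finset.prod_ne_zero_iff.mpr fun i _ => hN0 (Sum.inl i)
    · rw [Matrix.det_of_isLowerTriangular _ hlow, isUnit_iff_ne_zero]
      exact Finset.prod_ne_zero_iff.mpr fun i _ => hN0 (Sum.inr i)
  have hG := isGauge_gaugeAct hB p
  refine ⟨_, ⟨_, _, _, hB, hG⟩, ?_⟩
  have hint := hG.gaugeMatrix_mul_stripFirst hB θt θ1 (-κ 1)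
  have hdet := hB.isUnit_det_gaugeMatrix
  rw [hNb] at hint hdet
  rw [inTorusFiber_iff]
  rw [← hM, hMN] at hint
  simp only [hdiag] at hint
  have := congrArg (fun L => N⁻¹ * L) hint
  simpa only [Matrix.nonsing_inv_mul_cancel_left _ _ hdet] using this

theorem exists_torusAct_iff (hκ : Set.InjOn κ (Set.Icc 1 (2 * n))) {t : ℂ} (ht : t ≠ 0)
    (hp : InTorusFiber θt θ1 κ p) (hnp : Nondegenerate p)
    (hq : InTorusFiber θt θ1 κ q) (hnq : Nondegenerate q) :
    (∀ i : Fin n, lam t i p = lam t i q ∧ mu t i p = mu t i q) ↔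
      ∃ d : Idx n → ℂˣ, q = torusAct d p := by
  constructor
  · intro h
    have h1 := borelEquiv_coordPoint ht hp.inBorelFiber hnp
    have h2 := borelEquiv_coordPoint ht hq.inBorelFiber hnq
    simp only [fun i => (h i).1, fun i => (h i).2] at h1
    exact (h1.trans h2.symm).exists_torusAct hκ hp hq
  · rintro ⟨d, rfl⟩ i
    obtain ⟨P, Q, S, hB, hG⟩ := borelEquiv_torusAct d p
    exact ⟨(hG.lam_eq hB t i).symm, (hG.mu_eq hB hnp t i).symm⟩

theorem exists_lam_mu_eq_iff (hκ : Set.InjOn κ (Set.Icc 1 (2 * n)))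
    (hFuchs : n * θt + n * θ1 + θ0 + ∑ i ∈ Finset.Icc 1 (2 * n), κ i = 0) {t : ℂ} (ht : t ≠ 0)
    (l m : Fin n → ℂ) :
    (∃ p : PhaseSpace n, ResidueRelation θt θ1 θ0 κ p ∧ Nondegenerate p ∧
      ∀ i : Fin n, lam t i p = l i ∧ mu t i p = m i) ↔ l 0 ≠ 0 := by
  constructor
  · rintro ⟨p, -, hn, h⟩
    rw [← (h 0).1]
    exact lam_zero_ne_zero ht hn
  · intro hl
    have hn := coordPoint_nondegenerate (θt + θ1) κ ht hl m
    -- The slice lies only in the Borel fibre; a gauge transformation moves the point into the torus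
    -- fibre without changing `λ`, `μ`.
    obtain ⟨q, ⟨P, Q, S, hB, hG⟩, hq⟩ :=
      (coordPoint_inBorelFiber θt θ1 κ t l m).exists_inTorusFiber hκ
    refine ⟨q, hq.residueRelation hFuchs, hG.nondegenerate hB hn, fun i => ?_⟩
    rw [hG.lam_eq hB, hG.mu_eq hB hn, lam_coordPoint _ _ ht, mu_coordPoint _ _ ht hl]
    exact ⟨rfl, rfl⟩

end

end Schlesinger

section

attribute [local instance] Matrix.normedAddCommGroup Matrix.normedSpace
open scoped Topology

/-! ### Entrywise derivatives of matrix valued functions -/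

/-- Every entry of `A` has the corresponding entry of `A'` as its derivative at `z`. -/
def HasMatrixDerivAt {m k : Type*} (A : ℂ → Matrix m k ℂ) (A' : Matrix m k ℂ) (z : ℂ) : Prop :=
  ∀ i j, HasDerivAt (fun w => A w i j) (A' i j) z

namespace HasMatrixDerivAt

variable {m k l : Type*} {A A₁ : ℂ → Matrix m k ℂ} {A' A₁' : Matrix m k ℂ} {z : ℂ}

theorem congr_deriv (h : HasMatrixDerivAt A A' z) (h' : A' = A₁') : HasMatrixDerivAt A A₁' z :=
  h' ▸ h

theorem congr (h : HasMatrixDerivAt A A' z) (h' : ∀ᶠ w in 𝓝 z, A₁ w = A w) :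
    HasMatrixDerivAt A₁ A' z :=
  fun i j => (h i j).congr_of_eventuallyEq (h'.mono fun w hw => by beta_reduce; rw [hw])

theorem const (M : Matrix m k ℂ) (z : ℂ) : HasMatrixDerivAt (fun _ => M) 0 z :=
  fun i j => hasDerivAt_const z (M i j)

theorem add (h : HasMatrixDerivAt A A' z) (h₁ : HasMatrixDerivAt A₁ A₁' z) :
    HasMatrixDerivAt (fun w => A w + A₁ w) (A' + A₁') z :=
  fun i j => (h i j).fun_add (h₁ i j)

theorem sub (h : HasMatrixDerivAt A A' z) (h₁ : HasMatrixDerivAt A₁ A₁' z) :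
    HasMatrixDerivAt (fun w => A w - A₁ w) (A' - A₁') z :=
  fun i j => (h i j).fun_sub (h₁ i j)

theorem add_smul (M V : Matrix m k ℂ) : HasMatrixDerivAt (fun s : ℂ => M + s • V) V 0 := by
  intro i j
  have h := ((hasDerivAt_id' (0 : ℂ)).mul_const (V i j)).const_add (M i j)
  rwa [one_mul] at h

theorem unique (h : HasMatrixDerivAt A A' z) (h₁ : HasMatrixDerivAt A A₁' z) : A' = A₁' := by
  ext i j
  exact (h i j).unique (h₁ i j)

theorem fromBlocks {m' k' : Type*} {B : ℂ → Matrix m k' ℂ} {C : ℂ → Matrix m' k ℂ}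
    {D : ℂ → Matrix m' k' ℂ} {B' : Matrix m k' ℂ} {C' : Matrix m' k ℂ} {D' : Matrix m' k' ℂ}
    (hA : HasMatrixDerivAt A A' z) (hB : HasMatrixDerivAt B B' z) (hC : HasMatrixDerivAt C C' z)
    (hD : HasMatrixDerivAt D D' z) :
    HasMatrixDerivAt (fun w => Matrix.fromBlocks (A w) (B w) (C w) (D w))
      (Matrix.fromBlocks A' B' C' D') z := by
  rintro (i | i) (j | j)
  · exact hA i j
  · exact hB i j
  · exact hC i j
  · exact hD i j

variable [Fintype k]

theorem mul {B : ℂ → Matrix k l ℂ} {B' : Matrix k l ℂ} (h : HasMatrixDerivAt A A' z)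
    (hB : HasMatrixDerivAt B B' z) :
    HasMatrixDerivAt (fun w => A w * B w) (A' * B z + A z * B') z := by
  intro i j
  simp only [Matrix.mul_apply, Matrix.add_apply, ← Finset.sum_add_distrib]
  exact HasDerivAt.fun_sum fun c _ => (h i c).fun_mul (hB c j)

theorem trace {A : ℂ → Matrix k k ℂ} {A' : Matrix k k ℂ} (h : HasMatrixDerivAt A A' z) :
    HasDerivAt (fun w => (A w).trace) A'.trace z :=
  HasDerivAt.fun_sum fun i _ => h i i

end HasMatrixDerivAt

section

variable {k : Type*} [Fintype k] [DecidableEq k] {A : ℂ → Matrix k k ℂ} {z : ℂ}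

theorem differentiableAt_det (h : ∀ i j, DifferentiableAt ℂ (fun w => A w i j) z) :
    DifferentiableAt ℂ (fun w => (A w).det) z := by
  simp only [Matrix.det_apply]
  exact DifferentiableAt.fun_sum fun σ _ =>
    (DifferentiableAt.fun_finsetProd fun i _ => h _ _).const_smul _

theorem differentiableAt_inv_apply (h : ∀ i j, DifferentiableAt ℂ (fun w => A w i j) z)
    (hdet : (A z).det ≠ 0) (i j : k) : DifferentiableAt ℂ (fun w => (A w)⁻¹ i j) z := by
  simp only [Matrix.inv_def, Ring.inverse_eq_inv', Matrix.smul_apply, Matrix.adjugate_apply,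
    smul_eq_mul]
  refine ((differentiableAt_det h).inv hdet).mul (differentiableAt_det fun a b => ?_)
  simp only [Matrix.updateRow_apply]
  split_ifs
  · exact differentiableAt_const _
  · exact h a b

end

namespace Schlesinger

variable {n : ℕ}

/-! ### The Hamiltonian vector field of `K` -/

/-- The velocity of `B` under `Ã' = [Z, Ã]`. -/
def velocityB (Z : Matrix (Idx n) (Idx n) ℂ) (B : Matrix (Fin n) (Fin n) ℂ) :
    Matrix (Fin n) (Fin n) ℂ :=
  Z.toBlocks₂₁ + Z.toBlocks₂₂ * B - B * (Z.toBlocks₁₁ + Z.toBlocks₁₂ * B)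

/-- The velocity of `C` under `Ã' = [Z, Ã]`. -/
def velocityC (θ : ℂ) (Z : Matrix (Idx n) (Idx n) ℂ) (B C : Matrix (Fin n) (Fin n) ℂ) :
    Matrix (Fin n) (Fin n) ℂ :=
  (Z.toBlocks₁₁ + Z.toBlocks₁₂ * B) * C - ((θ • 1 - C * B) * Z.toBlocks₁₂ + C * Z.toBlocks₂₂)

/-- The differential of `residue θ` at `(B, C)` in the direction `(B', C')`. -/
def residueDeriv (θ : ℂ) (B C B' C' : Matrix (Fin n) (Fin n) ℂ) : Matrix (Idx n) (Idx n) ℂ :=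
  Matrix.fromBlocks (-(C' * B + C * B')) C' (B' * (θ • 1 - C * B) - B * (C' * B + C * B'))
    (B' * C + B * C')

theorem hasMatrixDerivAt_residue {θ z : ℂ} {B C : ℂ → Matrix (Fin n) (Fin n) ℂ}
    {B' C' : Matrix (Fin n) (Fin n) ℂ} (hB : HasMatrixDerivAt B B' z)
    (hC : HasMatrixDerivAt C C' z) :
    HasMatrixDerivAt (fun w => residue θ (B w) (C w)) (residueDeriv θ (B z) (C z) B' C') z := by
  simp only [residue_eq_fromBlocks, residueDeriv]
  have h := (HasMatrixDerivAt.const (θ • (1 : Matrix (Fin n) (Fin n) ℂ)) z).sub (hC.mul hB)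
  refine (h.congr_deriv (zero_sub _)).fromBlocks hC ((hB.mul h).congr_deriv ?_) (hB.mul hC)
  rw [zero_sub, Matrix.mul_neg, ← sub_eq_add_neg]

theorem trace_fromBlocks (A B C D : Matrix (Fin n) (Fin n) ℂ) :
    (Matrix.fromBlocks A B C D).trace = A.trace + D.trace :=
  Fintype.sum_sum_type _

/-- If a function of `Ã` has differential `tr (Z dÃ)`, its partial derivatives in `C` and `B` are
read off here. Its Hamiltonian vector field is then the velocity of `(B, C)` that corresponds to `Ã'
= [Z, Ã]`. -/
theorem trace_residueDeriv_mul (θ : ℂ) (B C B' C' : Matrix (Fin n) (Fin n) ℂ)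
    (Z : Matrix (Idx n) (Idx n) ℂ) : (residueDeriv θ B C B' C' * Z).trace
      = (C' * velocityB Z B).trace - (B' * velocityC θ Z B C).trace := by
  obtain ⟨Z11, Z12, Z21, Z22, rfl⟩ : ∃ Z11 Z12 Z21 Z22, Z = Matrix.fromBlocks Z11 Z12 Z21 Z22 :=
    ⟨_, _, _, _, (Matrix.fromBlocks_toBlocks Z).symm⟩
  have h1 : (C * (B' * Z11)).trace = (B' * (Z11 * C)).trace := by
    rw [Matrix.trace_mul_comm, Matrix.mul_assoc]
  have h2 : (B * (C' * (B * Z12))).trace = (C' * (B * (Z12 * B))).trace := by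
    rw [Matrix.trace_mul_comm, Matrix.mul_assoc, Matrix.mul_assoc]
  have h3 : (B * (C * (B' * Z12))).trace = (B' * (Z12 * (B * C))).trace := by
    rw [← Matrix.mul_assoc, Matrix.trace_mul_comm, Matrix.mul_assoc]
  have h4 : (B * (C' * Z22)).trace = (C' * (Z22 * B)).trace := by
    rw [Matrix.trace_mul_comm, Matrix.mul_assoc]
  rw [residueDeriv, Matrix.fromBlocks_multiply, trace_fromBlocks, velocityB, velocityC]
  simp only [Matrix.toBlocks_fromBlocks₁₁, Matrix.toBlocks_fromBlocks₁₂,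
    Matrix.toBlocks_fromBlocks₂₁, Matrix.toBlocks_fromBlocks₂₂, Matrix.mul_add, Matrix.mul_sub,
    Matrix.add_mul, Matrix.sub_mul, Matrix.neg_mul, Matrix.mul_assoc, Matrix.trace_add,
    Matrix.trace_sub, Matrix.trace_neg, Matrix.mul_smul, Matrix.smul_mul, Matrix.one_mul]
  linear_combination -h1 - h2 - h3 + h4

theorem trace_single_one_mul (i j : Fin n) (M : Matrix (Fin n) (Fin n) ℂ) :
    (Matrix.single i j 1 * M).trace = M j i := by
  rw [Matrix.trace_single_mul, one_smul]

section

variable [NeZero n]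

/-- The first column of `M`, without its diagonal entry. -/
def firstColumn (M : Matrix (Idx n) (Idx n) ℂ) : Matrix (Idx n) (Idx n) ℂ :=
  Matrix.of fun r s => if s = Sum.inl 0 ∧ r ≠ Sum.inl 0 then M r s else 0

/-- The matrices `Z_ξ` with `dK = ∑ tr(Z_ξ dÃ_ξ)`. -/
noncomputable def gradientK (θt θ1 θ0 t : ℂ) (p : PhaseSpace n) : Pole → Matrix (Idx n) (Idx n) ℂ
  | Pole.t => (1 / (t - 1)) • residue θ1 (p.1 Pole.one) (p.2 Pole.one) +
      (1 / t) • (residueZeroOf θt θ1 θ0 p - firstColumn (residue θt (p.1 Pole.t) (p.2 Pole.t)))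
  | Pole.one => (1 / (t - 1)) • residue θt (p.1 Pole.t) (p.2 Pole.t) -
      (1 / t) • firstColumn (residue θt (p.1 Pole.t) (p.2 Pole.t))

/-- The exponent at a pole. -/
def exponent (θt θ1 : ℂ) : Pole → ℂ
  | Pole.t => θt
  | Pole.one => θ1

/-- `Ã_0` varies by minus the off-diagonal first row of the variation of `Ã_t + Ã_1`; under the
trace pairing the adjoint of this operation is `-firstColumn`. -/
theorem trace_mul_firstRow (M D : Matrix (Idx n) (Idx n) ℂ) :
    (M * Matrix.of fun r s => if r = Sum.inl 0 then (if s = Sum.inl 0 then 0 else -D r s)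
      else 0).trace = -(D * firstColumn M).trace := by
  simp only [Matrix.trace, Matrix.diag_apply, Matrix.mul_apply, firstColumn, Matrix.of_apply]
  rw [Finset.sum_comm, ← Finset.sum_neg_distrib]
  refine Finset.sum_congr rfl fun r _ => ?_
  rw [← Finset.sum_neg_distrib]
  refine Finset.sum_congr rfl fun s _ => ?_
  by_cases hr : r = Sum.inl 0
  · by_cases hs : s = Sum.inl 0
    · simp [hr, hs]
    · simp [hr, hs, mul_comm]
  · simp [hr]

theorem hasDerivAt_hamiltonianK {θt θ1 θ0 t z : ℂ} {X : ℂ → PhaseSpace n} {V : PhaseSpace n}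
    (hB : ∀ ξ, HasMatrixDerivAt (fun w => (X w).1 ξ) (V.1 ξ) z)
    (hC : ∀ ξ, HasMatrixDerivAt (fun w => (X w).2 ξ) (V.2 ξ) z) :
    HasDerivAt (fun w => hamiltonianK θt θ1 θ0 t (X w))
      (∑ ξ, ((V.2 ξ * velocityB (gradientK θt θ1 θ0 t (X z) ξ) ((X z).1 ξ)).trace
        - (V.1 ξ * velocityC (exponent θt θ1 ξ) (gradientK θt θ1 θ0 t (X z) ξ) ((X z).1 ξ)
          ((X z).2 ξ)).trace)) z := by
  have ht := hasMatrixDerivAt_residue (θ := θt) (hB Pole.t) (hC Pole.t)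
  have h1 := hasMatrixDerivAt_residue (θ := θ1) (hB Pole.one) (hC Pole.one)
  set Dt := residueDeriv θt ((X z).1 Pole.t) ((X z).2 Pole.t) (V.1 Pole.t) (V.2 Pole.t) with hDt
  set D1 := residueDeriv θ1 ((X z).1 Pole.one) ((X z).2 Pole.one) (V.1 Pole.one) (V.2 Pole.one)
    with hD1
  have h0 : HasMatrixDerivAt (fun w => residueZeroOf θt θ1 θ0 (X w)) (Matrix.of fun r s =>
      if r = Sum.inl 0 then (if s = Sum.inl 0 then 0 else -(Dt + D1) r s) else 0) z := by
    intro r s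
    simp only [residueZeroOf, residueZero, Matrix.of_apply]
    split_ifs with hr hs
    · exact hasDerivAt_const _ _
    · subst hr
      exact ((ht.add h1) _ _).fun_neg
    · exact hasDerivAt_const _ _
  have hK := ((ht.mul h1).trace.div_const (t - 1)).fun_add ((ht.mul h0).trace.div_const t)
  refine hK.congr_deriv ?_
  rw [Pole.sum_univ]
  simp only [← trace_residueDeriv_mul, exponent, gradientK]
  rw [← hDt, ← hD1, Matrix.trace_add, Matrix.trace_add, trace_mul_firstRow]
  simp only [Matrix.mul_add, Matrix.mul_sub, Matrix.add_mul, Matrix.mul_smul, smul_sub,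
    Matrix.trace_add, Matrix.trace_sub, Matrix.trace_smul, smul_eq_mul]
  rw [Matrix.trace_mul_comm (residue θt _ _) D1]
  ring

theorem bracket_hamiltonianK_fst (θt θ1 θ0 t : ℂ) (ξ : Pole) (i j : Fin n) (p : PhaseSpace n) :
    bracket (hamiltonianK θt θ1 θ0 t) (fun p => p.1 ξ i j) p
      = velocityB (gradientK θt θ1 θ0 t p ξ) (p.1 ξ) i j := by
  rw [bracket_apply_fst, partialC, lineDeriv]
  set V : PhaseSpace n := (0, Pi.single ξ (Matrix.single j i 1)) with hV
  have h := hasDerivAt_hamiltonianK (θt := θt) (θ1 := θ1) (θ0 := θ0) (t := t) (z := 0)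
    (X := fun s => p + s • V) (V := V) (fun η => HasMatrixDerivAt.add_smul _ _)
    fun η => HasMatrixDerivAt.add_smul _ _
  rw [h.deriv, Finset.sum_eq_single ξ]
  · simp [hV, trace_single_one_mul]
  · intro η _ hη
    simp [hV, hη]
  · simp

theorem bracket_hamiltonianK_snd (θt θ1 θ0 t : ℂ) (ξ : Pole) (i j : Fin n) (p : PhaseSpace n) :
    bracket (hamiltonianK θt θ1 θ0 t) (fun p => p.2 ξ i j) p
      = velocityC (exponent θt θ1 ξ) (gradientK θt θ1 θ0 t p ξ) (p.1 ξ) (p.2 ξ) i j := by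
  rw [bracket_apply_snd, partialB, lineDeriv]
  set V : PhaseSpace n := (Pi.single ξ (Matrix.single j i 1), 0) with hV
  have h := hasDerivAt_hamiltonianK (θt := θt) (θ1 := θ1) (θ0 := θ0) (t := t) (z := 0)
    (X := fun s => p + s • V) (V := V) (fun η => HasMatrixDerivAt.add_smul _ _)
    fun η => HasMatrixDerivAt.add_smul _ _
  rw [h.deriv, Finset.sum_eq_single ξ]
  · simp [hV, trace_single_one_mul]
  · intro η _ hη
    simp [hV, hη]
  · simp

end

end Schlesinger

end

section

attribute [local instance] Matrix.normedAddCommGroup Matrix.normedSpace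
open scoped Topology

namespace Schlesinger

variable {n : ℕ}

/-! ### From the Schlesinger flow to the Hamiltonian flow -/

/-- `C` and `B C` are blocks of the residue, so `B = (B C) C⁻¹` is differentiable where `C` is
invertible, and the product rule for `B C` yields its derivative. -/
theorem hasMatrixDerivAt_of_residue {θ z : ℂ} {B C : ℂ → Matrix (Fin n) (Fin n) ℂ}
    {Z : Matrix (Idx n) (Idx n) ℂ}
    (h : HasMatrixDerivAt (fun w => residue θ (B w) (C w))
      (Z * residue θ (B z) (C z) - residue θ (B z) (C z) * Z) z)
    (hdet : ∀ᶠ w in 𝓝 z, (C w).det ≠ 0) :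
    HasMatrixDerivAt B (velocityB Z (B z)) z ∧ HasMatrixDerivAt C (velocityC θ Z (B z) (C z)) z := by
  obtain ⟨Z11, Z12, Z21, Z22, rfl⟩ : ∃ Z11 Z12 Z21 Z22, Z = Matrix.fromBlocks Z11 Z12 Z21 Z22 :=
    ⟨_, _, _, _, (Matrix.fromBlocks_toBlocks Z).symm⟩
  simp only [residue_eq_fromBlocks, Matrix.fromBlocks_multiply, sub_eq_add_neg,
    Matrix.fromBlocks_neg, Matrix.fromBlocks_add] at h
  have hC : HasMatrixDerivAt C _ z := fun i j => h (Sum.inl i) (Sum.inr j)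
  have hBC : HasMatrixDerivAt (fun w => B w * C w) _ z := fun i j => h (Sum.inr i) (Sum.inr j)
  replace hC := hC.congr_deriv (A₁' := velocityC θ (Matrix.fromBlocks Z11 Z12 Z21 Z22) (B z) (C z))
    (by
      ext i j
      simp only [Matrix.fromBlocks_apply₁₂, velocityC, Matrix.toBlocks_fromBlocks₁₁,
        Matrix.toBlocks_fromBlocks₁₂, Matrix.toBlocks_fromBlocks₂₂, Matrix.add_mul, sub_eq_add_neg,
        Matrix.mul_assoc])
  replace hBC := hBC.congr_deriv (A₁' := Z21 * C z + Z22 * (B z * C z) -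
      (B z * (θ • 1 - C z * B z) * Z12 + B z * C z * Z22))
    (by
      ext i j
      simp only [Matrix.fromBlocks_apply₂₂, sub_eq_add_neg])
  refine ⟨?_, hC⟩
  have hB' : HasMatrixDerivAt B (Matrix.of fun i j => deriv (fun w => B w i j) z) z := by
    intro i j
    refine DifferentiableAt.hasDerivAt (DifferentiableAt.congr_of_eventuallyEq
      (f := fun w => ∑ k, (B w * C w) i k * (C w)⁻¹ k j) ?_ ?_)
    · exact DifferentiableAt.fun_sum fun k _ => (hBC i k).differentiableAt.mul
        (differentiableAt_inv_apply (fun a b => (hC a b).differentiableAt) hdet.self_of_nhds k j)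
    · filter_upwards [hdet] with w hw
      rw [← Matrix.mul_apply, Matrix.mul_nonsing_inv_cancel_right _ _ (isUnit_iff_ne_zero.mpr hw)]
  have hu := (hB'.mul hC).unique hBC
  refine hB'.congr_deriv ?_
  have hCz : IsUnit (C z).det := isUnit_iff_ne_zero.mpr hdet.self_of_nhds
  refine (Matrix.mul_left_injective_of_inv _ _ (Matrix.mul_nonsing_inv _ hCz)) ?_
  beta_reduce
  rw [eq_sub_of_add_eq hu]
  simp only [velocityB, velocityC, Matrix.toBlocks_fromBlocks₁₁,
        Matrix.toBlocks_fromBlocks₁₂, Matrix.toBlocks_fromBlocks₂₁, Matrix.toBlocks_fromBlocks₂₂,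
        Matrix.add_mul, Matrix.sub_mul, Matrix.mul_add, Matrix.mul_sub, Matrix.mul_assoc]
  abel

theorem IsLowerUnitriangular.det_eq_one {G : Matrix (Idx n) (Idx n) ℂ}
    (h : IsLowerUnitriangular G) : G.det = 1 := by
  have htri : G.BlockTriangular fun r : Idx n => OrderDual.toDual r.num :=
    fun r s hrs => h.2 r s hrs
  rw [htri.det]
  refine Finset.prod_eq_one fun b _ => ?_
  have : G.toSquareBlock (fun r : Idx n => OrderDual.toDual r.num) b = 1 := by
    ext ⟨i, hi⟩ ⟨j, hj⟩
    obtain rfl : i = j := num_injective (OrderDual.toDual.injective (hi.trans hj.symm))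
    simp [Matrix.toSquareBlock_def, h.1]
  rw [this, Matrix.det_one]

section

variable [NeZero n] {G M : Matrix (Idx n) (Idx n) ℂ}

/-- `G` agrees with the identity matrix outside of the first column, and at the first diagonal
entry. -/
structure IsColumnUnipotent (G : Matrix (Idx n) (Idx n) ℂ) : Prop where
  diag : ∀ r, G r r = 1
  off : ∀ r s, r ≠ s → s ≠ Sum.inl 0 → G r s = 0

theorem IsColumnUnipotent.apply_of_ne (h : IsColumnUnipotent G) {s : Idx n} (hs : s ≠ Sum.inl 0)
    (r : Idx n) : G r s = (1 : Matrix (Idx n) (Idx n) ℂ) r s := by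
  rcases eq_or_ne r s with rfl | hrs
  · rw [h.diag, Matrix.one_apply_eq]
  · rw [h.off r s hrs hs, Matrix.one_apply_ne hrs]

theorem IsColumnUnipotent.apply_zero (h : IsColumnUnipotent G) (s : Idx n) :
    G (Sum.inl 0) s = (1 : Matrix (Idx n) (Idx n) ℂ) (Sum.inl 0) s := by
  rcases eq_or_ne s (Sum.inl 0) with rfl | hs
  · rw [h.diag, Matrix.one_apply_eq]
  · exact h.apply_of_ne hs _

theorem IsColumnUnipotent.eq_one_add (h : IsColumnUnipotent G) : G = 1 + firstColumn G := by
  ext r s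
  simp only [firstColumn, Matrix.add_apply, Matrix.of_apply]
  rcases eq_or_ne s (Sum.inl 0) with rfl | hs
  · rcases eq_or_ne r (Sum.inl 0) with rfl | hr
    · simp [h.diag]
    · simp [hr]
  · simp [hs, h.apply_of_ne hs]

theorem firstColumn_mul_firstColumn (M N : Matrix (Idx n) (Idx n) ℂ) :
    firstColumn M * firstColumn N = 0 := by
  ext r s
  rw [Matrix.mul_apply]
  refine Finset.sum_eq_zero fun k _ => ?_
  by_cases hk : k = Sum.inl 0
  · simp [firstColumn, hk]
  · simp [firstColumn, hk]

theorem IsColumnUnipotent.firstColumn_mul (h : IsColumnUnipotent G) :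
    firstColumn M * G = firstColumn M := by
  rw [h.eq_one_add, Matrix.mul_add, Matrix.mul_one, firstColumn_mul_firstColumn, add_zero]

theorem IsColumnUnipotent.mul_firstColumn (h : IsColumnUnipotent G) :
    G * firstColumn M = firstColumn M := by
  rw [h.eq_one_add, Matrix.add_mul, Matrix.one_mul, firstColumn_mul_firstColumn, add_zero]

theorem IsColumnUnipotent.two_sub_mul (h : IsColumnUnipotent G) :
    ((1 + 1 : Matrix (Idx n) (Idx n) ℂ) - G) * G = 1 := by
  have h1 := h.eq_one_add
  rw [Matrix.sub_mul, Matrix.add_mul, Matrix.one_mul]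
  conv_lhs => rw [h1]
  rw [Matrix.add_mul, Matrix.one_mul, Matrix.mul_add, Matrix.mul_one, firstColumn_mul_firstColumn]
  abel

/-- Every column of `residueInfty` but the first is that of the diagonal matrix, so `κ_r G_{rs} =
G_{rs} κ_s` there and distinctness applies. -/
theorem isColumnUnipotent_of_conj {κ : ℕ → ℂ} (hκ : Set.InjOn κ (Set.Icc 1 (2 * n)))
    (hdiag : ∀ r, G r r = 1) {a : Idx n → ℂ}
    (h : Matrix.diagonal (fun r : Idx n => κ r.num) * G = G * residueInfty κ a) :
    IsColumnUnipotent G where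
  diag := hdiag
  off r s hrs hs := by
    have h1 := congrFun (congrFun h r) s
    rw [Matrix.diagonal_mul, Matrix.mul_apply, Finset.sum_eq_single s] at h1
    · rw [residueInfty, if_pos rfl, mul_comm] at h1
      by_contra h0
      exact hrs (num_injective (hκ (num_mem_Icc r) (num_mem_Icc s) (mul_left_cancel₀ h0 h1)))
    · intro k _ hk
      rw [residueInfty, if_neg hk, if_neg hs, mul_zero]
    · simp

/-- The derivative of the gauge transformation. -/
theorem hasMatrixDerivAt_gauge {U : Set ℂ} (hU : IsOpen U) {t θ0 : ℂ} (htU : t ∈ U) (hθ0 : θ0 ≠ 0)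
    {A0 G : ℂ → Matrix (Idx n) (Idx n) ℂ} {At Rt : Matrix (Idx n) (Idx n) ℂ} {a : ℂ → Idx n → ℂ}
    (hG : ∀ z ∈ U, IsColumnUnipotent (G z))
    (h0 : ∀ z ∈ U, A0 z * G z = G z * residueZero θ0 (a z))
    (ht : At * G t = G t * Rt)
    (hA0 : HasMatrixDerivAt A0 ((1 / t) • (At * A0 t - A0 t * At)) t) :
    HasMatrixDerivAt G ((1 / t) • firstColumn Rt) t := by
  -- `A_0` has rank one with the first column of `G` as its column factor, so that column consists
  -- of quotients of entries of `A_0`.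
  have hrow : ∀ z ∈ U, ∀ r s, A0 z r s = G z r (Sum.inl 0) * A0 z (Sum.inl 0) s := by
    intro z hz r s
    have hA : A0 z = G z * (residueZero θ0 (a z) * ((1 + 1) - G z)) := by
      rw [← Matrix.mul_assoc, ← h0 z hz, Matrix.mul_assoc,
        mul_eq_one_comm.mp (hG z hz).two_sub_mul, Matrix.mul_one]
    have hrs (r : Idx n) : A0 z r s = G z r (Sum.inl 0) *
        (residueZero θ0 (a z) * ((1 + 1) - G z) : Matrix (Idx n) (Idx n) ℂ) (Sum.inl 0) s := by
      conv_lhs => rw [hA]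
      rw [Matrix.mul_apply, Finset.sum_eq_single (Sum.inl 0)]
      · intro k _ hk
        rw [Matrix.mul_apply, Finset.sum_eq_zero, mul_zero]
        intro j _
        rw [residueZero, if_neg hk, zero_mul]
      · simp
    rw [hrs r, hrs (Sum.inl 0), (hG z hz).diag, one_mul]
  -- A vanishing first row of `A_0` would make the corner entry `θ0` of the normalized residue zero.
  obtain ⟨c, hc⟩ : ∃ c, A0 t (Sum.inl 0) c ≠ 0 := by
    by_contra! hcon
    have := congrFun (congrFun (h0 t htU) (Sum.inl 0)) (Sum.inl 0)
    rw [Matrix.mul_apply, Finset.sum_eq_zero fun k _ => by rw [hcon, zero_mul], Matrix.mul_apply,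
      Finset.sum_eq_single (Sum.inl 0) (fun k _ hk => by rw [residueZero, if_neg hk, mul_zero])
        (by simp), (hG t htU).diag] at this
    simp [residueZero, hθ0.symm] at this
  intro r s
  by_cases hrs : s = Sum.inl 0 ∧ r ≠ Sum.inl 0
  · obtain ⟨rfl, hr⟩ := hrs
    have hne : ∀ᶠ z in 𝓝 t, A0 z (Sum.inl 0) c ≠ 0 :=
      (hA0 (Sum.inl 0) c).continuousAt.eventually_ne hc
    have hd : DifferentiableAt ℂ (fun z => G z r (Sum.inl 0)) t := by
      refine DifferentiableAt.congr_of_eventuallyEq (f := fun z => A0 z r c / A0 z (Sum.inl 0) c)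
        ((hA0 r c).differentiableAt.fun_div (hA0 _ c).differentiableAt hc) ?_
      filter_upwards [hne, hU.mem_nhds htU] with z hz hzU
      rw [hrow z hzU r c, mul_div_cancel_right₀ _ hz]
    refine hd.hasDerivAt.congr_deriv ?_
    -- The product rule for `G_{r1} A0_{1c}` is compared with the Schlesinger equation for
    -- `A0_{rc}`, which determines the derivative of `G_{r1}`.
    have hprod := (hd.hasDerivAt.fun_mul (hA0 (Sum.inl 0) c)).unique
      ((hA0 r c).congr_of_eventuallyEq (by
        filter_upwards [hU.mem_nhds htU] with z hzU
        exact (hrow z hzU r c).symm))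
    have h1 (r : Idx n) : (At * A0 t) r c = (G t * Rt) r (Sum.inl 0) * A0 t (Sum.inl 0) c := by
      rw [← ht, Matrix.mul_apply, Matrix.mul_apply, Finset.sum_mul]
      refine Finset.sum_congr rfl fun k _ => ?_
      rw [hrow t htU k c, mul_assoc]
    have h2 : (A0 t * At) r c = G t r (Sum.inl 0) * (A0 t * At) (Sum.inl 0) c := by
      rw [Matrix.mul_apply, Matrix.mul_apply, Finset.mul_sum]
      refine Finset.sum_congr rfl fun k _ => ?_
      rw [hrow t htU r k, mul_assoc]
    have h3 : (G t * Rt) (Sum.inl 0) (Sum.inl 0) = Rt (Sum.inl 0) (Sum.inl 0) := by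
      simp only [Matrix.mul_apply, (hG t htU).apply_zero]
      rw [← Matrix.mul_apply, Matrix.one_mul]
    have h4 : (G t * Rt) r (Sum.inl 0) = Rt r (Sum.inl 0)
        + G t r (Sum.inl 0) * Rt (Sum.inl 0) (Sum.inl 0) := by
      conv_lhs => rw [(hG t htU).eq_one_add]
      rw [Matrix.add_mul, Matrix.one_mul, Matrix.add_apply, Matrix.mul_apply,
        Finset.sum_eq_single (Sum.inl 0) (fun k _ hk => by simp [firstColumn, hk]) (by simp)]
      simp [firstColumn, hr]
    simp only [Matrix.smul_apply, Matrix.sub_apply, smul_eq_mul, h1, h2, h3, h4] at hprod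
    refine mul_right_cancel₀ hc ?_
    simp only [Matrix.smul_apply, firstColumn, Matrix.of_apply, smul_eq_mul, ne_eq, hr,
      not_false_eq_true, and_self, if_true]
    linear_combination hprod
  · have hval : ((1 / t) • firstColumn Rt) r s = 0 := by
      rw [Matrix.smul_apply, firstColumn, Matrix.of_apply, if_neg hrs, smul_zero]
    rw [hval]
    refine (hasDerivAt_const t ((1 : Matrix (Idx n) (Idx n) ℂ) r s)).congr_of_eventuallyEq ?_
    filter_upwards [hU.mem_nhds htU] with z hz
    rcases eq_or_ne s (Sum.inl 0) with rfl | hs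
    · have hr : r = Sum.inl 0 := by
        by_contra hr
        exact hrs ⟨rfl, hr⟩
      rw [hr, (hG z hz).apply_zero]
    · exact (hG z hz).apply_of_ne hs r

/-- The derivative of a gauge transformed matrix. -/
theorem hasMatrixDerivAt_conj_gauge {t : ℂ} {A R G : ℂ → Matrix (Idx n) (Idx n) ℂ}
    {A' D L : Matrix (Idx n) (Idx n) ℂ} {c : ℂ} (hG : ∀ᶠ z in 𝓝 t, IsColumnUnipotent (G z))
    (hA : HasMatrixDerivAt A A' t) (hGt : HasMatrixDerivAt G (c • firstColumn L) t)
    (hR : ∀ᶠ z in 𝓝 t, A z * G z = G z * R z) (hD : A' * G t = G t * D) :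
    HasMatrixDerivAt R (D + c • (R t * firstColumn L - firstColumn L * R t)) t := by
  have hconj {z : ℂ} (hz : IsColumnUnipotent (G z)) {M N : Matrix (Idx n) (Idx n) ℂ}
      (h : M * G z = G z * N) : ((1 + 1) - G z) * (M * G z) = N := by
    rw [h, ← Matrix.mul_assoc, hz.two_sub_mul, Matrix.one_mul]
  -- `(1 + 1) - G` is the inverse of `G`. As `G` fixes `firstColumn L` from both sides, `G⁻¹ G'` is
  -- again `c • firstColumn L`, whence the commutator.
  have h := ((HasMatrixDerivAt.const (1 + 1) t).sub hGt).mul (hA.mul hGt)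
  refine (h.congr_deriv ?_).congr ?_
  · have hu := hG.self_of_nhds
    have hRt := hR.self_of_nhds
    have e1 : firstColumn L * (A t * G t) = firstColumn L * R t := by
      rw [hRt, ← Matrix.mul_assoc, hu.firstColumn_mul]
    have e2 : ((1 + 1) - G t) * (A t * firstColumn L) = R t * firstColumn L := by
      conv_lhs => rw [← hu.mul_firstColumn (M := L), ← Matrix.mul_assoc (A t), ← Matrix.mul_assoc,
        hconj hu hRt]
    rw [Matrix.mul_add, hconj hu hD, zero_sub, Matrix.neg_mul, Matrix.smul_mul, e1, Matrix.mul_smul,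
      Matrix.mul_smul, e2, smul_sub]
    abel
  · filter_upwards [hG, hR] with z hz hRz
    exact (hconj hz hRz).symm

theorem Nondegenerate.det_ne_zero {p : PhaseSpace n} (hp : Nondegenerate p) (ξ : Pole) :
    (p.2 ξ).det ≠ 0 := by
  have h : headMinor (p.2 ξ) 0 0 0 = (p.2 ξ).det := by
    have he : headTail (0 : Fin n) 0 = finCongr (by simp) := by
      ext a
      simp only [headTail, Fin.val_zero, zero_add]
      split_ifs with ha
      · exact ha.symm
      · rfl
    rw [headMinor, he, Matrix.det_submatrix_equiv_self]
  rw [← h]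
  cases ξ
  · exact (hp 0).2.1
  · exact (hp 0).1

/-- The Schlesinger flow in the normalized gauge is the Hamiltonian flow of `K`. -/
theorem isHamiltonianSolution_of_gauge {θt θ1 θ0 : ℂ} (hθ0 : θ0 ≠ 0) {U : Set ℂ} (hU : IsOpen U)
    {At A1 A0 G : ℂ → Matrix (Idx n) (Idx n) ℂ} {a : ℂ → Idx n → ℂ} {X : ℂ → PhaseSpace n}
    (hAt : ∀ t ∈ U, HasMatrixDerivAt At (-((1 / t) • (At t * A0 t - A0 t * At t))
        - (1 / (t - 1)) • (At t * A1 t - A1 t * At t)) t)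
    (hA1 : ∀ t ∈ U, HasMatrixDerivAt A1 ((1 / (t - 1)) • (At t * A1 t - A1 t * At t)) t)
    (hA0 : ∀ t ∈ U, HasMatrixDerivAt A0 ((1 / t) • (At t * A0 t - A0 t * At t)) t)
    (hG : ∀ t ∈ U, IsColumnUnipotent (G t))
    (h0 : ∀ t ∈ U, A0 t * G t = G t * residueZero θ0 (a t))
    (h0' : ∀ t ∈ U, residueZeroOf θt θ1 θ0 (X t) = residueZero θ0 (a t))
    (ht : ∀ t ∈ U, At t * G t = G t * residue θt ((X t).1 Pole.t) ((X t).2 Pole.t))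
    (h1 : ∀ t ∈ U, A1 t * G t = G t * residue θ1 ((X t).1 Pole.one) ((X t).2 Pole.one))
    (hn : ∀ t ∈ U, Nondegenerate (X t)) :
    IsHamiltonianSolution θt θ1 θ0 U X := by
  have hmul {G M N M' N' : Matrix (Idx n) (Idx n) ℂ} (h : M * G = G * M') (h' : N * G = G * N') :
      (M * N - N * M) * G = G * (M' * N' - N' * M') := by
    rw [Matrix.sub_mul, Matrix.mul_assoc, h', ← Matrix.mul_assoc, h, Matrix.mul_assoc N, h,
      ← Matrix.mul_assoc N, h', Matrix.mul_sub, Matrix.mul_assoc, Matrix.mul_assoc]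
  intro t htU
  have hUt := hU.mem_nhds htU
  have hGt := hasMatrixDerivAt_gauge hU htU hθ0 hG h0 (ht t htU) (hA0 t htU)
  have hev {P : ℂ → Prop} (h : ∀ z ∈ U, P z) : ∀ᶠ z in 𝓝 t, P z := by
    filter_upwards [hUt] with z hz using h z hz
  have hdt := hasMatrixDerivAt_conj_gauge (D := -((1 / t) •
      (residue θt ((X t).1 Pole.t) ((X t).2 Pole.t) * residueZero θ0 (a t)
        - residueZero θ0 (a t) * residue θt ((X t).1 Pole.t) ((X t).2 Pole.t)))
      - (1 / (t - 1)) • (residue θt ((X t).1 Pole.t) ((X t).2 Pole.t)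
          * residue θ1 ((X t).1 Pole.one) ((X t).2 Pole.one)
        - residue θ1 ((X t).1 Pole.one) ((X t).2 Pole.one)
          * residue θt ((X t).1 Pole.t) ((X t).2 Pole.t))) (hev hG) (hAt t htU) hGt (hev ht) (by
    rw [Matrix.sub_mul, Matrix.neg_mul, Matrix.smul_mul, Matrix.smul_mul, hmul (ht t htU) (h0 t htU),
      hmul (ht t htU) (h1 t htU), Matrix.mul_sub (G t) (-_), Matrix.mul_neg, Matrix.mul_smul, Matrix.mul_smul])
  have hd1 := hasMatrixDerivAt_conj_gauge (D := (1 / (t - 1)) •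
      (residue θt ((X t).1 Pole.t) ((X t).2 Pole.t) * residue θ1 ((X t).1 Pole.one) ((X t).2 Pole.one)
        - residue θ1 ((X t).1 Pole.one) ((X t).2 Pole.one) * residue θt ((X t).1 Pole.t) ((X t).2 Pole.t)))
      (hev hG)
    (hA1 t htU) hGt (hev h1) (by
      rw [Matrix.smul_mul, hmul (ht t htU) (h1 t htU), Matrix.mul_smul])
  -- The gauge commutator with `firstColumn Ã_t` supplies the part of the gradient of `K` that comes
  -- from the dependence of `Ã_0` on the residues. The other Schlesinger terms are the rest of
  -- `[Z_t, Ã_t]`.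
  have hBt := hasMatrixDerivAt_of_residue (Z := gradientK θt θ1 θ0 t (X t) Pole.t)
    (hdt.congr_deriv (by
      rw [gradientK, h0' t htU]
      simp only [Matrix.add_mul, Matrix.mul_add, Matrix.sub_mul, Matrix.mul_sub, Matrix.smul_mul,
        Matrix.mul_smul, smul_sub]
      abel)) (hev fun z hz => (hn z hz).det_ne_zero Pole.t)
  have hB1 := hasMatrixDerivAt_of_residue (Z := gradientK θt θ1 θ0 t (X t) Pole.one)
    (hd1.congr_deriv (by
      rw [gradientK]
      simp only [Matrix.sub_mul, Matrix.mul_sub, Matrix.smul_mul, Matrix.mul_smul, smul_sub]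
      abel)) (hev fun z hz => (hn z hz).det_ne_zero Pole.one)
  intro ξ i j
  rw [bracket_hamiltonianK_fst, bracket_hamiltonianK_snd]
  cases ξ
  · exact ⟨hBt.1 i j, hBt.2 i j⟩
  · exact ⟨hB1.1 i j, hB1.2 i j⟩

/-- The Schlesinger flow, brought to the normal form by a gauge transformation, is the Hamiltonian
flow of `K`. -/
theorem isHamiltonianSolution_of_isSolution {θt θ1 θ0 : ℂ} {κ : ℕ → ℂ} (hθ0 : θ0 ≠ 0)
    (hκ : Set.InjOn κ (Set.Icc 1 (2 * n))) {U : Set ℂ} (hU : IsOpen U)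
    {At A1 A0 : ℂ → Matrix (Idx n) (Idx n) ℂ} {G₁ : Matrix (Idx n) (Idx n) ℂ}
    {G₂ : ℂ → Matrix (Idx n) (Idx n) ℂ} {a0 aInf : ℂ → Idx n → ℂ} {X : ℂ → PhaseSpace n}
    (hS : IsSolution U At A1 A0) (hG₁ : IsUnit G₁.det)
    (hκG : ∀ t ∈ U,
      G₁⁻¹ * (-At t - A1 t - A0 t) * G₁ = Matrix.diagonal (fun r : Idx n => κ r.num))
    (hG₂ : ∀ t ∈ U, IsLowerUnitriangular (G₂ t))
    (h0 : ∀ t ∈ U, (G₁ * G₂ t)⁻¹ * A0 t * (G₁ * G₂ t) = residueZero θ0 (a0 t))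
    (hInf : ∀ t ∈ U,
      (G₁ * G₂ t)⁻¹ * (-At t - A1 t - A0 t) * (G₁ * G₂ t) = residueInfty κ (aInf t))
    (ht : ∀ t ∈ U, (G₁ * G₂ t)⁻¹ * At t * (G₁ * G₂ t)
      = residue θt ((X t).1 Pole.t) ((X t).2 Pole.t))
    (h1 : ∀ t ∈ U, (G₁ * G₂ t)⁻¹ * A1 t * (G₁ * G₂ t)
      = residue θ1 ((X t).1 Pole.one) ((X t).2 Pole.one))
    (hn : ∀ t ∈ U, Nondegenerate (X t)) :
    IsHamiltonianSolution θt θ1 θ0 U X ∧ ∀ t ∈ U, ResidueRelation θt θ1 θ0 κ (X t) := by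
  have hrel : ∀ t ∈ U, residueSum θt θ1 (X t) + residueZero θ0 (a0 t) + residueInfty κ (aInf t)
      = 0 := by
    intro t htU
    rw [residueSum, ← ht t htU, ← h1 t htU, ← h0 t htU, ← hInf t htU]
    simp only [← Matrix.add_mul, ← Matrix.mul_add]
    have : At t + A1 t + A0 t + (-At t - A1 t - A0 t) = 0 := by abel
    rw [this, Matrix.mul_zero, Matrix.zero_mul]
  have hdet : ∀ t ∈ U, IsUnit (G₂ t).det := by
    intro t htU
    rw [(hG₂ t htU).det_eq_one]
    exact isUnit_one
  have hconj {t : ℂ} (htU : t ∈ U) {M N : Matrix (Idx n) (Idx n) ℂ}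
      (h : (G₁ * G₂ t)⁻¹ * M * (G₁ * G₂ t) = N) : G₁⁻¹ * M * G₁ * G₂ t = G₂ t * N := by
    rw [← h, Matrix.mul_inv_rev]
    simp only [Matrix.mul_assoc]
    rw [Matrix.mul_nonsing_inv_cancel_left _ _ (hdet t htU)]
  have hmul (M N : Matrix (Idx n) (Idx n) ℂ) :
      G₁⁻¹ * (M * N - N * M) * G₁
        = G₁⁻¹ * M * G₁ * (G₁⁻¹ * N * G₁) - G₁⁻¹ * N * G₁ * (G₁⁻¹ * M * G₁) := by
    simp only [Matrix.mul_sub, Matrix.sub_mul, Matrix.mul_assoc,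
      Matrix.mul_nonsing_inv_cancel_left _ _ hG₁]
  have hd {A : ℂ → Matrix (Idx n) (Idx n) ℂ} {A' : Matrix (Idx n) (Idx n) ℂ} {t : ℂ}
      (h : HasMatrixDerivAt A A' t) :
      HasMatrixDerivAt (fun z => G₁⁻¹ * A z * G₁) (G₁⁻¹ * A' * G₁) t := by
    refine (((HasMatrixDerivAt.const G₁⁻¹ t).mul h).mul
      (HasMatrixDerivAt.const G₁ t)).congr_deriv ?_
    rw [Matrix.zero_mul, zero_add, Matrix.mul_zero, add_zero]
  refine ⟨?_, fun t htU => ⟨_, _, hrel t htU⟩⟩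
  -- The Schlesinger equations are invariant under constant conjugation, so `G₁` is absorbed into
  -- the residues and only `G₂` remains as gauge.
  refine isHamiltonianSolution_of_gauge hθ0 hU (At := fun z => G₁⁻¹ * At z * G₁)
    (A1 := fun z => G₁⁻¹ * A1 z * G₁) (A0 := fun z => G₁⁻¹ * A0 z * G₁) (G := G₂) (a := a0)
    (fun t htU => ?_) (fun t htU => ?_) (fun t htU => ?_) (fun t htU => ?_)
    (fun t htU => hconj htU (h0 t htU)) (fun t htU => ?_) (fun t htU => hconj htU (ht t htU))
    (fun t htU => hconj htU (h1 t htU)) hn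
  · refine (hd fun r s => (hS t htU r s).1).congr_deriv ?_
    rw [Matrix.mul_sub, Matrix.sub_mul, Matrix.mul_neg, Matrix.neg_mul, Matrix.mul_smul,
      Matrix.mul_smul, Matrix.smul_mul, Matrix.smul_mul, hmul, hmul]
  · refine (hd fun r s => (hS t htU r s).2.1).congr_deriv ?_
    rw [Matrix.mul_smul, Matrix.smul_mul, hmul]
  · refine (hd fun r s => (hS t htU r s).2.2).congr_deriv ?_
    rw [Matrix.mul_smul, Matrix.smul_mul, hmul]
  · refine isColumnUnipotent_of_conj hκ (hG₂ t htU).1 (a := aInf t) ?_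
    rw [← hκG t htU]
    exact hconj htU (hInf t htU)
  · ext r s
    have := congrFun (congrFun (hrel t htU) (Sum.inl 0)) s
    simp only [Matrix.add_apply, Matrix.zero_apply, residueZero, if_true] at this
    simp only [residueZeroOf, residueZero]
    split_ifs with hr hs
    · rfl
    · rw [if_neg hs, residueInfty, if_neg (Ne.symm hs), if_neg hs] at this
      linear_combination -this
    · rfl

end

theorem Nondegenerate.lineDifferentiableAt_lam [NeZero n] {p : PhaseSpace n} (hp : Nondegenerate p)
    (t : ℂ) (i : Fin n) (v : PhaseSpace n) : LineDifferentiableAt ℂ (lam t i) p v :=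
  (hp.differentiableAt_lam t i).lineDifferentiableAt

theorem Nondegenerate.lineDifferentiableAt_mu [NeZero n] {p : PhaseSpace n} (hp : Nondegenerate p)
    (t : ℂ) (i : Fin n) (v : PhaseSpace n) : LineDifferentiableAt ℂ (mu t i) p v :=
  (hp.differentiableAt_mu t i).lineDifferentiableAt

end Schlesinger

end

/-! ### Assembly of the canonical relations, the coordinates and the two flows. -/

theorem theorem1 (n : ℕ) [NeZero n] (θt θ1 θ0 : ℂ) (κ α : ℕ → ℂ)
    -- spectral type `(n,n), (n,n), (2n-1,1), (1^{2n})` and the Fuchs relation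
    (hθt : θt ≠ 0) (hθ1 : θ1 ≠ 0) (hθ0 : θ0 ≠ 0)
    (hκ : Set.InjOn κ (Set.Icc 1 (2 * n)))
    (hFuchs : n * θt + n * θ1 + θ0 + ∑ i ∈ Finset.Icc 1 (2 * n), κ i = 0)
    (hα : Sasano.ParameterIdentification n θt θ1 κ α) :
    -- the functions `λ_i`, `μ_i` satisfy the canonical Poisson relations
    (∀ t : ℂ, t ≠ 0 → ∀ p : PhaseSpace n, Schlesinger.Nondegenerate p →
      (∀ (i : Fin n) (v : PhaseSpace n),
        LineDifferentiableAt ℂ (Schlesinger.lam t i) p v ∧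
        LineDifferentiableAt ℂ (Schlesinger.mu t i) p v) ∧
      ∀ i j : Fin n,
        Schlesinger.bracket (Schlesinger.mu t i) (Schlesinger.lam t j) p
          = (if i = j then 1 else 0) ∧
        Schlesinger.bracket (Schlesinger.mu t i) (Schlesinger.mu t j) p = 0 ∧
        Schlesinger.bracket (Schlesinger.lam t i) (Schlesinger.lam t j) p = 0) ∧
    -- they are coordinates on the `2n`-dimensional space of solutions of the residue
    -- relation modulo the residual gauge group
    (∀ t : ℂ, t ≠ 0 →
      (∀ p q : PhaseSpace n,
        Schlesinger.ResidueRelation θt θ1 θ0 κ p → Schlesinger.Nondegenerate p →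
        Schlesinger.ResidueRelation θt θ1 θ0 κ q → Schlesinger.Nondegenerate q →
        ((∀ i : Fin n, Schlesinger.lam t i p = Schlesinger.lam t i q ∧
            Schlesinger.mu t i p = Schlesinger.mu t i q) ↔
          ∃ d : Idx n → ℂˣ, q = Schlesinger.torusAct d p)) ∧
      (∀ l m : Fin n → ℂ,
        (∃ p : PhaseSpace n, Schlesinger.ResidueRelation θt θ1 θ0 κ p ∧
          Schlesinger.Nondegenerate p ∧
          ∀ i : Fin n, Schlesinger.lam t i p = l i ∧ Schlesinger.mu t i p = m i) ↔
        l 0 ≠ 0)) ∧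
    -- the Hamiltonian flow of `K` becomes the Sasano system
    (∀ U : Set ℂ, IsOpen U → 0 ∉ U → 1 ∉ U → ∀ X : ℂ → PhaseSpace n,
      Schlesinger.IsHamiltonianSolution θt θ1 θ0 U X →
      (∀ t ∈ U, Schlesinger.ResidueRelation θt θ1 θ0 κ (X t)) →
      (∀ t ∈ U, Schlesinger.Nondegenerate (X t)) →
      Sasano.IsSolution α U (fun t i => Schlesinger.lam t i (X t))
        (fun t i => Schlesinger.mu t i (X t))) ∧
    -- the Schlesinger flow itself, brought to the normal form by the gauge transformation
    -- `G = G₁ G₂`, becomes the Sasano system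
    (∀ U : Set ℂ, IsOpen U → 0 ∉ U → 1 ∉ U →
      ∀ (At A1 A0 : ℂ → Matrix (Idx n) (Idx n) ℂ) (G₁ : Matrix (Idx n) (Idx n) ℂ)
        (G₂ : ℂ → Matrix (Idx n) (Idx n) ℂ) (a0 aInf : ℂ → Idx n → ℂ) (X : ℂ → PhaseSpace n),
      Schlesinger.IsSolution U At A1 A0 →
      IsUnit G₁.det →
      (∀ t ∈ U,
        G₁⁻¹ * (-At t - A1 t - A0 t) * G₁ = Matrix.diagonal (fun r : Idx n => κ r.num) ∧
        Schlesinger.IsLowerUnitriangular (G₂ t) ∧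
        (G₁ * G₂ t)⁻¹ * A0 t * (G₁ * G₂ t) = Schlesinger.residueZero θ0 (a0 t) ∧
        (G₁ * G₂ t)⁻¹ * (-At t - A1 t - A0 t) * (G₁ * G₂ t)
          = Schlesinger.residueInfty κ (aInf t) ∧
        (G₁ * G₂ t)⁻¹ * At t * (G₁ * G₂ t)
          = Schlesinger.residue θt ((X t).1 Pole.t) ((X t).2 Pole.t) ∧
        (G₁ * G₂ t)⁻¹ * A1 t * (G₁ * G₂ t)
          = Schlesinger.residue θ1 ((X t).1 Pole.one) ((X t).2 Pole.one) ∧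
        Schlesinger.Nondegenerate (X t)) →
      Sasano.IsSolution α U (fun t i => Schlesinger.lam t i (X t))
        (fun t i => Schlesinger.mu t i (X t))) := by
  refine ⟨fun t ht p hp => ⟨fun i v => ⟨hp.lineDifferentiableAt_lam t i v,
      hp.lineDifferentiableAt_mu t i v⟩, fun i j =>
      ⟨Schlesinger.bracket_mu_lam ht i j hp, Schlesinger.bracket_mu_mu t i j hp,
        Schlesinger.bracket_lam_lam t i j p⟩⟩,
    fun t ht => ⟨fun p q hp hnp hq hnq =>
      Schlesinger.exists_torusAct_iff hκ ht hp.inTorusFiber hnp hq.inTorusFiber hnq,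
      Schlesinger.exists_lam_mu_eq_iff hκ hFuchs ht⟩,
    fun U _ h0 h1 X hX hrel hn => hX.isSolution hFuchs hα h0 h1
      (fun t htU => (hrel t htU).inTorusFiber.inBorelFiber) hn,
    fun U hU h0 h1 At A1 A0 G₁ G₂ a0 aInf X hS hG₁ hG => ?_⟩
  have hn : ∀ t ∈ U, Schlesinger.Nondegenerate (X t) := fun t htU => (hG t htU).2.2.2.2.2.2
  obtain ⟨hX, hrel⟩ := Schlesinger.isHamiltonianSolution_of_isSolution hθ0 hκ hU hS hG₁
    (fun t htU => (hG t htU).1) (fun t htU => (hG t htU).2.1) (fun t htU => (hG t htU).2.2.1)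
    (fun t htU => (hG t htU).2.2.2.1) (fun t htU => (hG t htU).2.2.2.2.1)
    (fun t htU => (hG t htU).2.2.2.2.2.1) hn
  exact hX.isSolution hFuchs hα h0 h1 (fun t htU => (hrel t htU).inTorusFiber.inBorelFiber) hn
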